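/- Let $N\ge 1$, let $\eta_1,\dots,\eta_{2N}$ be points of the unit circle with $0<\arg\eta_1<\dots<\arg\eta_{2N}<\pi$, and let $1\le \ell\le N$. Call the arcs $[\eta_{2k-1},\eta_{2k}]$ ($1\le k\le \ell$) of the unit circle and their complex conjugates the bands, and the arcs $[\eta_{2k},\eta_{2k+1}]$ ($1\le k<\ell$), the last gap $[\eta_{2\ell},-1]$, and their complex conjugates the gaps. Let $$\hat R_\ell(z)=\prod_{j=1}^{2\ell}\sqrt{(z-\eta_j)(z-\eta_j^{-1})}$$ with branch cuts along the bands and $\hat R_\ell(z)\sim z^{2\ell}$ as $z\to\infty$. Let $$\hat P_\ell(z)=z^{-2}\Big(\sum_{j=0}^{\ell}B_j(z^{2\ell+2-j}+z^j)+B_{\ell+1}z^{\ell+1}\Big),\qquad \hat Q_\ell(z)=z^{-3}\Big(\sum_{j=0}^{\ell+1}C_j(z^{2\ell+4-j}+z^j)+C_{\ell+2}z^{\ell+2}\Big),$$ where the $B_j,C_j$ are real, $B_0=C_0=1$, $B_1=C_1=-\sum_{j=1}^{2\ell}\operatorname{Re}\eta_j$, $C_2=\frac18\big[(\sum_{j=1}^{2\ell}(\eta_j+\eta_j^{-1}))^2-2\sum_{j=1}^{2\ell}(\eta_j^2+\eta_j^{-2})\big]$,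 and the integrals of $\hat P_\ell\,dz/\hat R_\ell$ and of $\hat Q_\ell\,dz/\hat R_\ell$ over every gap vanish. Put $$V(z;\xi)=\frac{\xi}{2}\int_{\eta_1}^z\frac{\hat P_\ell(s)}{\hat R_\ell(s)}\,ds-\int_{\eta_1}^z\frac{\hat Q_\ell(s)}{\hat R_\ell(s)}\,ds ,\qquad \xi_{2\ell}=\frac{2\hat Q_\ell(\eta_{2\ell})}{\hat P_\ell(\eta_{2\ell})},$$ where the integration is in $\mathbb C\setminus\{0\}$ cut along the arcs $\arg\eta_1\le|\arg z|\le\pi$ of the unit circle, and where on these arcs $V$ denotes the boundary value from outside the unit disc. Then these conditions determine the coefficients $B_j$ and $C_j$ uniquely, and there is a finite $\xi_0<\xi_{2\ell}$ such that the following holds on the open last gap $\gamma=\{e^{i\theta}:\arg\eta_{2\ell}<\theta<\pi\}$, where derivatives are taken with respect to $\theta$. 1. For every $\xi<\xi_{2\ell}$, $\operatorname{Im}V(\cdot;\xi)$ is $C^2$ on $\gamma$ and has a nondegenerate, negative, strict global minimum on $\gamma$ at a point $\beta(\xi)$. If $\xi_0<\xi<\xi_{2\ell}$, then $\operatorname{Im}V(\cdot;\xi)$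 changes sign exactly once on $\gamma$, at a point $\rho(\xi)$, from negative to positive as $\gamma$ is traversed counterclockwise; it has a nondegenerate, positive, strict global maximum on $\gamma$ at a point $s(\xi)$; it has no critical points on $\gamma$ other than $\beta(\xi)$ and $s(\xi)$; and $\arg\beta(\xi)<\arg\rho(\xi)<\arg s(\xi)$. If $\xi\le\xi_0$, then $\operatorname{Im}V(\cdot;\xi)<0$ on all of $\gamma$ and $\beta(\xi)$ is its only critical point there. 2. $\arg\beta(\xi)$ is strictly decreasing in $\xi$ on $(-\infty,\xi_{2\ell})$, $\arg s(\xi)$ and $\arg\rho(\xi)$ are strictly decreasing in $\xi$ on $(\xi_0,\xi_{2\ell})$, and $$\lim_{\xi\to\xi_0^+}s(\xi)=\lim_{\xi\to\xi_0^+}\rho(\xi)=-1 .$$ 3. If $\ell<N$, there is exactly one $\xi_{2\ell+1}\in(\xi_0,\xi_{2\ell})$ with $\rho(\xi_{2\ell+1})=\eta_{2\ell+1}$, and $$\xi_{2\ell+1}=2\int_{\eta_{2\ell}}^{\eta_{2\ell+1}}\frac{\hat Q_\ell(z)\,dz}{\hat R_\ell(z)}\bigg/\int_{\eta_{2\ell}}^{\eta_{2\ell+1}}\frac{\hat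 P_\ell(z)\,dz}{\hat R_\ell(z)},$$ the integrals being taken along the last gap. -/

import Mathlib

namespace DarkGas

noncomputable section

/-- `2N` branch points `η₁, …, η_{2N}` on the open upper unit semicircle,
with `0 < arg η₁ < ⋯ < arg η_{2N} < π`.  Only the entries with index `1, …, 2N` are used. -/
structure IsSpectrum (N : ℕ) (η : ℕ → ℂ) : Prop where
  norm_eq : ∀ j ∈ Set.Icc 1 (2 * N), ‖η j‖ = 1
  arg_pos : ∀ j ∈ Set.Icc 1 (2 * N), 0 < (η j).arg
  arg_lt : ∀ j ∈ Set.Icc 1 (2 * N), (η j).arg < Real.pi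
  arg_strictMono : StrictMonoOn (fun j => (η j).arg) (Set.Icc 1 (2 * N))

/-- For `a, b` on the unit circle with `0 < arg b - arg a < 2π`: the branch of
`√((z - a)(z - b))` whose cut is the arc of the unit circle from `a` counterclockwise to `b`
and which is `∼ z` at infinity.  (The Möbius map `z ↦ e^{i(arg b - arg a)/2} (z - a)/(z - b)` sends
that arc onto the negative real axis, and the exterior of the disc to the upper half plane, so
on the cut the function equals its boundary value from the exterior of the disc.) -/
def arcSqrt (a b z : ℂ) : ℂ :=
  (z - b) * Complex.exp (-(((b.arg - a.arg) / 4 : ℝ) : ℂ) * Complex.I) *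
    ((z - a) / (z - b) * Complex.exp ((((b.arg - a.arg) / 2 : ℝ) : ℂ) * Complex.I)) ^ (1 / 2 : ℂ)

/-- `R̂_ℓ(z) = ∏_{j=1}^{2ℓ} √((z - η_j)(z - η_j⁻¹))` with cuts along the bands
`[η_{2k-1}, η_{2k}]`, `k = 1, …, ℓ`, and their complex conjugates, `R̂_ℓ(z) ∼ z^{2ℓ}` at infinity.
On the bands it takes its boundary value from the exterior of the unit disc. -/
def Rhat (η : ℕ → ℂ) (ℓ : ℕ) (z : ℂ) : ℂ :=
  ∏ k ∈ Finset.Icc 1 ℓ,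
    (arcSqrt (η (2 * k - 1)) (η (2 * k)) z *
      arcSqrt (starRingEnd ℂ (η (2 * k))) (starRingEnd ℂ (η (2 * k - 1))) z)

/-- The palindromic polynomial `∑_{j<m} B_j z^{2m-j} + ∑_{j<m} B_j z^j + B_m z^m`. -/
def palindrome (m : ℕ) (B : Fin (m + 1) → ℝ) (z : ℂ) : ℂ :=
  ∑ j : Fin m, (B j.castSucc : ℂ) * z ^ (2 * m - (j : ℕ)) +
    ∑ j : Fin m, (B j.castSucc : ℂ) * z ^ (j : ℕ) + (B (Fin.last m) : ℂ) * z ^ m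

/-- The numerator `P̂_ℓ` of the first differential, with coefficients `B₀, …, B_{ℓ+1}`. -/
def Phat (ℓ : ℕ) (B : Fin (ℓ + 2) → ℝ) (z : ℂ) : ℂ := palindrome (ℓ + 1) B z / z ^ 2

/-- The numerator `Q̂_ℓ` of the second differential, with coefficients `C₀, …, C_{ℓ+2}`. -/
def Qhat (ℓ : ℕ) (C : Fin (ℓ + 3) → ℝ) (z : ℂ) : ℂ := palindrome (ℓ + 2) C z / z ^ 3

/-- `∫ F(z) dz` along the arc `z = e^{iθ}`, `θ` from `a` to `b`. -/
def arcIntegral (F : ℂ → ℂ) (a b : ℝ) : ℂ :=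
  ∫ θ in a..b, F (Complex.exp (θ * Complex.I)) * (Complex.I * Complex.exp (θ * Complex.I))

/-- The argument of the final point of the `k`-th gap: the gaps are `[η_{2k}, η_{2k+1}]` for
`1 ≤ k < ℓ` and `[η_{2ℓ}, -1]` for `k = ℓ`. -/
def gapEnd (η : ℕ → ℂ) (ℓ k : ℕ) : ℝ := if k < ℓ then (η (2 * k + 1)).arg else Real.pi

/-- All integrals of `F dz` over the gaps and over the conjugate gaps vanish. -/
def GapIntegralsVanish (η : ℕ → ℂ) (ℓ : ℕ) (F : ℂ → ℂ) : Prop :=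
  ∀ k ∈ Set.Icc 1 ℓ,
    arcIntegral F (η (2 * k)).arg (gapEnd η ℓ k) = 0 ∧
      arcIntegral F (-gapEnd η ℓ k) (-(η (2 * k)).arg) = 0

/-- The conditions that determine the real coefficients of `P̂_ℓ`. -/
structure IsFirstCoeffs (η : ℕ → ℂ) (ℓ : ℕ) (B : Fin (ℓ + 2) → ℝ) : Prop where
  zero : B 0 = 1
  one : B 1 = -∑ j ∈ Finset.Icc 1 (2 * ℓ), (η j).re
  gaps : GapIntegralsVanish η ℓ (fun z => Phat ℓ B z / Rhat η ℓ z)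

/-- The conditions that determine the real coefficients of `Q̂_ℓ`.  Here
`η_j + η_j⁻¹ = 2 Re η_j` and `η_j² + η_j⁻² = 2 Re η_j²`, so the value of `C₂` reads
`⅛ [(∑ (η_j + η_j⁻¹))² - 2 ∑ (η_j² + η_j⁻²)]`, the sums being over `1 ≤ j ≤ 2ℓ`. -/
structure IsSecondCoeffs (η : ℕ → ℂ) (ℓ : ℕ) (C : Fin (ℓ + 3) → ℝ) : Prop where
  zero : C 0 = 1
  one : C 1 = -∑ j ∈ Finset.Icc 1 (2 * ℓ), (η j).re
  two : C 2 = 1 / 8 * ((∑ j ∈ Finset.Icc 1 (2 * ℓ), 2 * (η j).re) ^ 2 -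
    2 * ∑ j ∈ Finset.Icc 1 (2 * ℓ), 2 * (η j ^ 2).re)
  gaps : GapIntegralsVanish η ℓ (fun z => Qhat ℓ C z / Rhat η ℓ z)

/-- The path `t ↦ exp((1 - t) log a + t log z)`, `0 ≤ t ≤ 1`, from `a` to `z`
(principal logarithms).  If `|a| = 1`, it stays for `t > 0` inside the open unit disc when `|z| < 1`,
outside the closed unit disc when `|z| > 1`, and on the unit circle when `|z| = 1`; it avoids `0`. -/
def spiral (a z : ℂ) (t : ℝ) : ℂ :=
  Complex.exp ((1 - (t : ℂ)) * Complex.log a + (t : ℂ) * Complex.log z)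

/-- `∫_a^z F(s) ds` along `spiral a z`. -/
def spiralIntegral (F : ℂ → ℂ) (a z : ℂ) : ℂ :=
  ∫ t in (0 : ℝ)..1, F (spiral a z t) * (spiral a z t * (Complex.log z - Complex.log a))

/-- `φ̂⁽¹⁾_ℓ(z) = ∫_{η₁}^z P̂_ℓ/R̂_ℓ ds`.  For `z` in the plane without `0` and without the arcs
`arg η₁ ≤ |arg z| ≤ π` of the unit circle, the path of integration lies (apart from its starting
point) in that domain; for `z` on those arcs the value is the boundary value from the exterior
of the unit disc. -/
def phi1 (η : ℕ → ℂ) (ℓ : ℕ) (B : Fin (ℓ + 2) → ℝ) (z : ℂ) : ℂ :=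
  spiralIntegral (fun s => Phat ℓ B s / Rhat η ℓ s) (η 1) z

/-- `φ̂⁽²⁾_ℓ(z) = ∫_{η₁}^z Q̂_ℓ/R̂_ℓ ds`, with the same paths as `phi1`. -/
def phi2 (η : ℕ → ℂ) (ℓ : ℕ) (C : Fin (ℓ + 3) → ℝ) (z : ℂ) : ℂ :=
  spiralIntegral (fun s => Qhat ℓ C s / Rhat η ℓ s) (η 1) z

/-- `V(z; ξ) = (ξ/2) φ̂⁽¹⁾_ℓ(z) - φ̂⁽²⁾_ℓ(z)`. -/
def V (η : ℕ → ℂ) (ℓ : ℕ) (B : Fin (ℓ + 2) → ℝ) (C : Fin (ℓ + 3) → ℝ) (ξ : ℝ) (z : ℂ) : ℂ :=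
  (ξ : ℂ) / 2 * phi1 η ℓ B z - phi2 η ℓ C z

/-- The transition value `ξ_{2ℓ} = 2 Q̂_ℓ(η_{2ℓ}) / P̂_ℓ(η_{2ℓ})` (this quotient is real). -/
def xiEven (η : ℕ → ℂ) (ℓ : ℕ) (B : Fin (ℓ + 2) → ℝ) (C : Fin (ℓ + 3) → ℝ) : ℝ :=
  (2 * Qhat ℓ C (η (2 * ℓ)) / Phat ℓ B (η (2 * ℓ))).re

/-- `2 ∫ Q̂_ℓ/R̂_ℓ dz / ∫ P̂_ℓ/R̂_ℓ dz`, both integrals along the arc from `η_{2ℓ}` to `η_{2ℓ+1}`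
(this quotient is real). -/
def xiOdd (η : ℕ → ℂ) (ℓ : ℕ) (B : Fin (ℓ + 2) → ℝ) (C : Fin (ℓ + 3) → ℝ) : ℝ :=
  (2 * arcIntegral (fun z => Qhat ℓ C z / Rhat η ℓ z) (η (2 * ℓ)).arg (η (2 * ℓ + 1)).arg /
    arcIntegral (fun z => Phat ℓ B z / Rhat η ℓ z) (η (2 * ℓ)).arg (η (2 * ℓ + 1)).arg).re

/-- The interior of the last gap, the open arc of the unit circle from `η_{2ℓ}` to `-1`. -/
def lastGap (η : ℕ → ℂ) (ℓ : ℕ) : Set ℂ :=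
  {z | ‖z‖ = 1 ∧ (η (2 * ℓ)).arg < z.arg ∧ z.arg < Real.pi}

/-- `Im V(e^{iθ}; ξ)` as a function of the angle. -/
def imV (η : ℕ → ℂ) (ℓ : ℕ) (B : Fin (ℓ + 2) → ℝ) (C : Fin (ℓ + 3) → ℝ) (ξ θ : ℝ) : ℝ :=
  (V η ℓ B C ξ (Complex.exp (θ * Complex.I))).im

end

end DarkGas

open DarkGas

/-! ### Palindromic polynomials on the unit circle as real polynomials in the cosine -/

namespace DarkGas

open Polynomial Finset

/-! Reduction to real polynomials. At z = e^{iθ} a palindrome of formal degree 2m is z^m times a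
real polynomial of degree at most m in cos θ (`exp_mul_chebPoly`), and R̂_ℓ is z^ℓ times a positive
function times a power of i that is constant between consecutive endpoints (`IsNodes.Rhat_exp`).
Along each arc the two differentials are therefore, up to a constant factor, p(cos θ)w(θ)dθ and
q(cos θ)w(θ)dθ with w > 0 integrable, deg p = ℓ + 1, deg q = ℓ + 2. They are purely imaginary on
gaps and real on bands, so on the last gap Im V is the primitive, starting at η_{2ℓ}, of (-1)^ℓ(xp -
q)(cos θ)w(θ) up to a positive constant, where x = ξ/2 (`im_V_exp`).

Root counting. A real polynomial with vanishing integral over a gap has a root in that gap. This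
gives existence and uniqueness of the coefficients (`IsNodes.existsUnique_coeffs`). The prescribed
values of B₁, C₁, C₂ make the residues at 0 vanish on the branch inside the disc; Cauchy's theorem,
carried to the boundary of the disc, then shows that the integrals over the additional gap through 1
also vanish (`IsNodes.sum_integral_eq_zero`). Hence every nonzero combination ap + bq, of degree at
most ℓ + 2, has ℓ + 1 vanishing gap integrals, and a double root in a gap would produce ℓ + 3 roots.
So q'p - qp' has no zero on the last gap (`IsPencil.wronskian_ne_zero`); one more count shows that
it is positive there and that v₀ = (q/p)(-1) is less than v₁ = (q/p)(cos arg η_{2ℓ})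
(`IsPencil.wronskian_pos`).

Consequences. On the last gap p has one zero, at an angle m, and as θ increases q/p decreases from
v₁ to -∞ before m and from +∞ to v₀ after it. The critical points of Im V are the solutions of q/p =
x: one, β, before m if x < v₁, and one, s, after m if x > v₀. As Im V vanishes at both ends of the
gap, it goes down to β, up to s and down again, with one sign change ρ between β and s; for x ≤ v₀
the second descent is missing and Im V stays negative. Finally Im V is affine in x with positive
slope at each interior point, because the primitive of p(cos θ)w(θ)(-1)^ℓ is positive there; this
yields the monotonicity of ρ, its limit at v₀ and the odd transition value. -/

/-- The polynomial `K_n` with `K_n (cos θ) = e^{inθ} + e^{-inθ}` for `n ≥ 1` and `K_0 = 1`. -/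
noncomputable def chebBasis (n : ℕ) : ℝ[X] := if n = 0 then 1 else C 2 * Chebyshev.T ℝ n

/-- The polynomial in `cos θ` which represents `e^{-imθ} palindrome m B (e^{iθ})`. -/
noncomputable def chebPoly (m : ℕ) (B : Fin (m + 1) → ℝ) : ℝ[X] :=
  ∑ i : Fin (m + 1), C (B i) * chebBasis (m - i)

lemma natDegree_chebBasis (n : ℕ) : (chebBasis n).natDegree = n := by
  unfold chebBasis
  split_ifs with h
  · simp [h]
  · rw [natDegree_C_mul two_ne_zero, Chebyshev.natDegree_T]
    simp

lemma coeff_chebBasis_self (n : ℕ) : (chebBasis n).coeff n = 2 ^ n := by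
  unfold chebBasis
  split_ifs with h
  · simp [h]
  · have := Chebyshev.leadingCoeff_T ℝ (n : ℤ)
    rw [leadingCoeff, Chebyshev.natDegree_T, Int.natAbs_natCast] at this
    rw [coeff_C_mul, this, ← pow_succ']
    congr 1
    omega

lemma chebPoly_add (m : ℕ) (B C : Fin (m + 1) → ℝ) :
    chebPoly m (B + C) = chebPoly m B + chebPoly m C := by
  simp [chebPoly, add_mul, Finset.sum_add_distrib]

lemma chebPoly_smul (m : ℕ) (c : ℝ) (B : Fin (m + 1) → ℝ) :
    chebPoly m (c • B) = c • chebPoly m B := by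
  simp [chebPoly, Finset.smul_sum, smul_eq_C_mul, mul_assoc]

/-- The map from coefficients to polynomials is triangular: the `i`-th basis element has degree
exactly `m - i`, with leading coefficient `2 ^ (m - i)`. Killing the first coefficients lowers the
degree, and the first survivor is the leading one. -/
lemma chebPoly_coeff {m : ℕ} {B : Fin (m + 1) → ℝ} {j : Fin (m + 1)}
    (h : ∀ i < j, B i = 0) :
    (chebPoly m B).natDegree ≤ m - j ∧ (chebPoly m B).coeff (m - j) = B j * 2 ^ (m - (j : ℕ)) := by
  constructor
  · refine natDegree_sum_le_of_forall_le _ _ fun i _ => ?_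
    rcases lt_or_ge i j with hij | hij
    · simp [h i hij]
    · refine (natDegree_C_mul_le _ _).trans ?_
      rw [natDegree_chebBasis]
      have : (j : ℕ) ≤ i := hij
      omega
  · rw [chebPoly, finsetSum_coeff, Finset.sum_eq_single j]
    · rw [coeff_C_mul, coeff_chebBasis_self]
    · intro i _ hij
      rcases lt_or_gt_of_ne hij with hij | hij
      · simp [h i hij]
      · rw [coeff_C_mul, coeff_eq_zero_of_natDegree_lt, mul_zero]
        rw [natDegree_chebBasis]
        have h1 : (j : ℕ) < i := hij
        have := i.2
        omega
    · simp

lemma chebPoly_natDegree_of_zero {m : ℕ} {B : Fin (m + 1) → ℝ} (h : B 0 = 1) :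
    (chebPoly m B).natDegree = m ∧ 0 < (chebPoly m B).leadingCoeff := by
  obtain ⟨h1, h2⟩ := chebPoly_coeff (B := B) (j := 0) (fun i hi => absurd hi (Fin.not_lt_zero i))
  simp only [Fin.val_zero, Nat.sub_zero, h, one_mul] at h1 h2
  have h3 : (chebPoly m B).natDegree = m := by
    refine le_antisymm h1 (le_natDegree_of_ne_zero ?_)
    rw [h2]
    positivity
  refine ⟨h3, ?_⟩
  rw [leadingCoeff, h3, h2]
  positivity

lemma eq_zero_of_chebPoly_eq_zero {m : ℕ} {B : Fin (m + 1) → ℝ} (h : chebPoly m B = 0) :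
    B = 0 := by
  have key : ∀ n : ℕ, ∀ j : Fin (m + 1), (j : ℕ) = n → B j = 0 := by
    intro n
    induction n using Nat.strong_induction_on with
    | _ n ih =>
      intro j hj
      have := (chebPoly_coeff (B := B) (j := j) (fun i hi => ih i (hj ▸ hi) i rfl)).2
      rw [h, coeff_zero] at this
      have h2 : (2 : ℝ) ^ (m - (j : ℕ)) ≠ 0 := by positivity
      simpa [h2] using this.symm
  exact funext fun j => key _ j rfl

/-- The monomials of exponents 2m - j and j pair up to z^m · 2cos((m - j)θ), a Chebyshev polynomial
in cos θ; the unpaired middle term is why the basis element of index 0 is 1 and not 2. -/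
lemma exp_mul_chebPoly (m : ℕ) (B : Fin (m + 1) → ℝ) (θ : ℝ) :
    palindrome m B (Complex.exp (θ * Complex.I)) =
      Complex.exp (θ * Complex.I) ^ m * ((chebPoly m B).eval (Real.cos θ) : ℝ) := by
  rw [palindrome, chebPoly, eval_finsetSum, Fin.sum_univ_castSucc, ← Finset.sum_add_distrib]
  push_cast
  rw [mul_add, Finset.mul_sum]
  congr 1
  · refine Finset.sum_congr rfl fun j _ => ?_
    have hj : m - (j : ℕ) ≠ 0 := by have := j.2; omega
    have hj' : (j : ℕ) ≤ m := j.2.le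
    simp only [chebBasis, Fin.val_castSucc, hj, if_false, eval_mul, eval_C, Complex.ofReal_mul,
      Chebyshev.T_real_cos, Complex.ofReal_cos]
    rw [Complex.cos]
    simp only [← Complex.exp_nat_mul]
    push_cast [Nat.cast_sub hj', Nat.cast_sub (show (j : ℕ) ≤ 2 * m by omega)]
    have e1 : ((2 * m - j : ℂ)) * (θ * Complex.I) =
        m * (θ * Complex.I) + (m - j) * θ * Complex.I := by ring
    have e2 : (j : ℂ) * (θ * Complex.I) =
        m * (θ * Complex.I) + -((m - j) * θ) * Complex.I := by ring
    rw [e1, e2, Complex.exp_add, Complex.exp_add]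
    ring
  · simp [chebBasis, mul_comm]

end DarkGas

/-! ### Boundary values of R̂ on the unit circle -/

namespace DarkGas

open Finset Complex

/-- The arguments `0 < arg η₁ < ⋯ < arg η_{2ℓ} < π` of the endpoints of the bands and gaps. -/
structure IsNodes (ℓ : ℕ) (t : ℕ → ℝ) : Prop where
  zero : t 0 = 0
  last : t (2 * ℓ + 1) = Real.pi
  lt : ∀ j ≤ 2 * ℓ, t j < t (j + 1)

/-- The positive function `1 / |∏ (cos θ - cos t_j)|^{1/2}`. -/
noncomputable def weight (ℓ : ℕ) (t : ℕ → ℝ) (θ : ℝ) : ℝ :=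
  ∏ j ∈ Icc 1 (2 * ℓ), (√|Real.cos θ - Real.cos (t j)|)⁻¹

namespace IsNodes

variable {ℓ : ℕ} {t : ℕ → ℝ}

lemma strictMonoOn (h : IsNodes ℓ t) : StrictMonoOn t (Set.Iic (2 * ℓ + 1)) :=
  strictMonoOn_of_lt_add_one Set.ordConnected_Iic fun j _ _ hj => h.lt j (by simpa using hj)

lemma le_of_le (h : IsNodes ℓ t) {i j : ℕ} (hij : i ≤ j) (hj : j ≤ 2 * ℓ + 1) : t i ≤ t j :=
  h.strictMonoOn.monotoneOn (Set.mem_Iic.2 (hij.trans hj)) hj hij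

lemma lt_of_lt (h : IsNodes ℓ t) {i j : ℕ} (hij : i < j) (hj : j ≤ 2 * ℓ + 1) : t i < t j :=
  h.strictMonoOn (Set.mem_Iic.2 (hij.le.trans hj)) hj hij

lemma nonneg (h : IsNodes ℓ t) {j : ℕ} (hj : j ≤ 2 * ℓ + 1) : 0 ≤ t j := by
  rw [← h.zero]; exact h.le_of_le (Nat.zero_le _) hj

lemma le_pi (h : IsNodes ℓ t) {j : ℕ} (hj : j ≤ 2 * ℓ + 1) : t j ≤ Real.pi := by
  rw [← h.last]; exact h.le_of_le hj le_rfl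

lemma pos (h : IsNodes ℓ t) {j : ℕ} (h1 : 1 ≤ j) (hj : j ≤ 2 * ℓ + 1) : 0 < t j := by
  rw [← h.zero]; exact h.lt_of_lt h1 hj

lemma lt_pi (h : IsNodes ℓ t) {j : ℕ} (hj : j ≤ 2 * ℓ) : t j < Real.pi := by
  rw [← h.last]; exact h.lt_of_lt (by omega) le_rfl

lemma cos_ne (h : IsNodes ℓ t) {i j : ℕ} (hi : i ≤ 2 * ℓ) (hj : j ∈ Icc 1 (2 * ℓ)) {θ : ℝ}
    (hθ : θ ∈ Set.Ioo (t i) (t (i + 1))) : Real.cos θ ≠ Real.cos (t j) := by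
  rw [Finset.mem_Icc] at hj
  have h0 := h.nonneg (show i ≤ 2 * ℓ + 1 by omega)
  have hpi := h.le_pi (show i + 1 ≤ 2 * ℓ + 1 by omega)
  intro hc
  have := Real.injOn_cos ⟨h0.trans hθ.1.le, hθ.2.le.trans hpi⟩
    ⟨h.nonneg (show j ≤ 2 * ℓ + 1 by omega), h.le_pi (by omega)⟩ hc
  rcases Nat.lt_or_ge i j with hij | hij
  · have := h.le_of_le (show i + 1 ≤ j from hij) (by omega)
    linarith [hθ.2]
  · have := h.le_of_le hij (by omega)
    linarith [hθ.1]

lemma weight_pos (h : IsNodes ℓ t)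
    {i : ℕ} (hi : i ≤ 2 * ℓ) {θ : ℝ} (hθ : θ ∈ Set.Ioo (t i) (t (i + 1))) :
    0 < weight ℓ t θ :=
  Finset.prod_pos fun _ hj => inv_pos.2 (Real.sqrt_pos.2 (abs_pos.2
    (sub_ne_zero.2 (h.cos_ne hi hj hθ))))

end IsNodes

lemma exp_sub_exp (x y : ℝ) : exp (x * I) - exp (y * I) =
    2 * I * (Real.sin ((x - y) / 2) : ℝ) * exp (((x + y) / 2 : ℝ) * I) := by
  have h1 : exp (x * I) = exp (((x + y) / 2 : ℝ) * I) * exp (((x - y) / 2 : ℝ) * I) := by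
    rw [← Complex.exp_add]; congr 1; push_cast; ring
  have h2 : exp (y * I) = exp (((x + y) / 2 : ℝ) * I) * exp (-((x - y) / 2 : ℝ) * I) := by
    rw [← Complex.exp_add]; congr 1; push_cast; ring
  rw [h1, h2, ofReal_sin, Complex.sin]
  linear_combination (exp (((x + y) / 2 : ℝ) * I) * exp (((x - y) / 2 : ℝ) * I) -
    exp (((x + y) / 2 : ℝ) * I) * exp (-((x - y) / 2 : ℝ) * I)) * I_sq

/-- The phase of `arcSqrt` on the unit circle: `-1` before the arc, `-i` on it and `1` after it. -/
noncomputable def arcPhase (α β θ : ℝ) : ℂ := if θ < α then -1 else if θ < β then -I else 1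

lemma ofReal_cpow_half_of_nonneg {r : ℝ} (hr : 0 ≤ r) : (r : ℂ) ^ (1 / 2 : ℂ) = (√r : ℝ) := by
  rw [Real.sqrt_eq_rpow, ofReal_cpow hr]; norm_num

lemma ofReal_cpow_half_of_nonpos {r : ℝ} (hr : r ≤ 0) :
    (r : ℂ) ^ (1 / 2 : ℂ) = I * (√(-r) : ℝ) := by
  rw [ofReal_cpow_of_nonpos hr, ← ofReal_neg, ofReal_cpow_half_of_nonneg (by linarith), mul_comm]
  congr 1
  rw [show (Real.pi : ℂ) * I * (1 / 2) = (Real.pi / 2) * I by ring, exp_pi_div_two_mul_I]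

/-- The Möbius map in `arcSqrt` sends the unit circle to the real line, so the base of the power is
a real quotient of half-angle sines. It is negative exactly on the arc, where the principal root
contributes the factor i. -/
lemma arcSqrt_exp {α β θ : ℝ} (hα : α ∈ Set.Ioo (-Real.pi) Real.pi)
    (hβ : β ∈ Set.Ioo (-Real.pi) Real.pi) (hθ : θ ∈ Set.Ioo (-Real.pi) Real.pi)
    (hαβ : α < β) (h1 : θ ≠ α) (h2 : θ ≠ β) :
    arcSqrt (exp (α * I)) (exp (β * I)) (exp (θ * I)) =
      2 * I * exp ((θ / 2 + (α + β) / 4 : ℝ) * I) * arcPhase α β θ *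
        (√|Real.sin ((θ - α) / 2) * Real.sin ((θ - β) / 2)| : ℝ) := by
  have sgn : ∀ γ ∈ Set.Ioo (-Real.pi) Real.pi, (θ < γ → Real.sin ((θ - γ) / 2) < 0) ∧
      (γ < θ → 0 < Real.sin ((θ - γ) / 2)) := by
    intro γ hγ
    refine ⟨fun h => Real.sin_neg_of_neg_of_neg_pi_lt (by linarith) (by linarith [hγ.2, hθ.1]),
      fun h => Real.sin_pos_of_pos_of_lt_pi (by linarith) (by linarith [hγ.1, hθ.2])⟩
  have hs : Real.sin ((θ - β) / 2) ≠ 0 := by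
    rcases lt_or_gt_of_ne h2 with h | h
    · exact ((sgn β hβ).1 h).ne
    · exact ((sgn β hβ).2 h).ne'
  have hs' : (Real.sin ((θ - β) / 2) : ℂ) ≠ 0 := ofReal_ne_zero.2 hs
  have hargα : arg (exp (α * I)) = α := by
    rw [arg_exp_mul_I, toIocMod_eq_self]; exact ⟨hα.1, by linarith [hα.2]⟩
  have hargβ : arg (exp (β * I)) = β := by
    rw [arg_exp_mul_I, toIocMod_eq_self]; exact ⟨hβ.1, by linarith [hβ.2]⟩
  have hr : (exp (θ * I) - exp (α * I)) / (exp (θ * I) - exp (β * I)) *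
      exp (((β - α) / 2 : ℝ) * I) =
      ((Real.sin ((θ - α) / 2) / Real.sin ((θ - β) / 2) : ℝ) : ℂ) := by
    rw [exp_sub_exp, exp_sub_exp, ofReal_div (Real.sin _)]
    have e : exp (((θ + β) / 2 : ℝ) * I) =
        exp (((θ + α) / 2 : ℝ) * I) * exp (((β - α) / 2 : ℝ) * I) := by
      rw [← Complex.exp_add]; congr 1; push_cast; ring
    rw [e]
    have n1 := Complex.exp_ne_zero (((θ + α) / 2 : ℝ) * I)
    have n2 := Complex.exp_ne_zero (((β - α) / 2 : ℝ) * I)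
    generalize exp (((θ + α) / 2 : ℝ) * I) = E1 at *
    generalize exp (((β - α) / 2 : ℝ) * I) = E2 at *
    generalize ((Real.sin ((θ - β) / 2) : ℝ) : ℂ) = S1 at *
    generalize ((Real.sin ((θ - α) / 2) : ℝ) : ℂ) = S2 at *
    field_simp
  rw [arcSqrt, hargα, hargβ, hr, exp_sub_exp]
  have e : exp ((θ / 2 + (α + β) / 4 : ℝ) * I) =
      exp (((θ + β) / 2 : ℝ) * I) * exp (-((β - α) / 4 : ℝ) * I) := by
    rw [← Complex.exp_add]; congr 1; push_cast; ring
  -- Only a real identity with signs remains: writing us = (u/s)s² gives √|us| = √|u/s|·|s|, and the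
  -- phase records the sign of s together with the i from a negative quotient.
  suffices hk : (Real.sin ((θ - β) / 2) : ℂ) *
      ((Real.sin ((θ - α) / 2) / Real.sin ((θ - β) / 2) : ℝ) : ℂ) ^ (1 / 2 : ℂ) =
      arcPhase α β θ * (√|Real.sin ((θ - α) / 2) * Real.sin ((θ - β) / 2)| : ℝ) by
    rw [e]
    linear_combination (2 * I * (exp (((θ + β) / 2 : ℝ) * I) * exp (-((β - α) / 4 : ℝ) * I))) * hk
  have sα := sgn α hα
  have sβ := sgn β hβ
  generalize Real.sin ((θ - α) / 2) = u at *
  generalize Real.sin ((θ - β) / 2) = s at *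
  have hsq : √(s * s) = |s| := Real.sqrt_mul_self_eq_abs s
  unfold arcPhase
  rcases lt_or_gt_of_ne h1 with h1 | h1
  · have hu := sα.1 h1
    have hs0 := sβ.1 (h1.trans hαβ)
    rw [if_pos h1, ofReal_cpow_half_of_nonneg (div_nonneg_of_nonpos hu.le hs0.le),
      abs_of_pos (mul_pos_of_neg_of_neg hu hs0),
      show u * s = u / s * (s * s) by field_simp, Real.sqrt_mul (div_nonneg_of_nonpos hu.le hs0.le),
      hsq, abs_of_neg hs0]
    push_cast
    ring
  · have hu := sα.2 h1
    rcases lt_or_gt_of_ne h2 with h2 | h2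
    · have hs0 := sβ.1 h2
      have hd : u / s ≤ 0 := (div_neg_of_pos_of_neg hu hs0).le
      rw [if_neg h1.not_gt, if_pos h2, ofReal_cpow_half_of_nonpos hd,
        abs_of_neg (mul_neg_of_pos_of_neg hu hs0),
        show -(u * s) = -(u / s) * (s * s) by field_simp, Real.sqrt_mul (by linarith),
        hsq, abs_of_neg hs0]
      push_cast
      ring
    · have hs0 := sβ.2 h2
      rw [if_neg h1.not_gt, if_neg h2.not_gt, ofReal_cpow_half_of_nonneg (by positivity),
        abs_of_pos (mul_pos hu hs0),
        show u * s = u / s * (s * s) by field_simp, Real.sqrt_mul (by positivity),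
        hsq, abs_of_pos hs0]
      push_cast
      ring

/-- The four half-angle sines of an arc and its conjugate regroup through cos θ - cos γ = -2
sin((θ-γ)/2) sin((θ+γ)/2), which turns the modulus into a function of cos θ. -/
lemma sqrt_sin_mul_sqrt_sin (α β θ : ℝ) :
    √|Real.sin ((θ - α) / 2) * Real.sin ((θ - β) / 2)| *
      √|Real.sin ((θ - -β) / 2) * Real.sin ((θ - -α) / 2)| =
    √|Real.cos θ - Real.cos α| * √|Real.cos θ - Real.cos β| / 2 := by
  have h : ∀ γ, Real.cos θ - Real.cos γ =
      -2 * (Real.sin ((θ - γ) / 2) * Real.sin ((θ - -γ) / 2)) := by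
    intro γ
    rw [Real.cos_sub_cos, sub_neg_eq_add]; ring
  rw [← Real.sqrt_mul (abs_nonneg _), ← Real.sqrt_mul (abs_nonneg _), ← abs_mul, ← abs_mul, h, h,
    eq_div_iff two_ne_zero]
  generalize Real.sin ((θ - α) / 2) = a
  generalize Real.sin ((θ - β) / 2) = b
  generalize Real.sin ((θ - -β) / 2) = c
  generalize Real.sin ((θ - -α) / 2) = d
  rw [show -2 * (a * d) * (-2 * (b * c)) = (a * b * (c * d)) * 2 ^ 2 by ring, abs_mul _ (2 ^ 2 : ℝ),
    Real.sqrt_mul (abs_nonneg (_ * _)), abs_of_pos (by norm_num : (0 : ℝ) < 2 ^ 2),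
    Real.sqrt_sq (by norm_num)]

lemma arcSqrt_pair_exp {α β θ : ℝ} (hα : 0 < α) (hβ : β < Real.pi)
    (hθ : θ ∈ Set.Ioo 0 Real.pi) (hαβ : α < β) (h1 : θ ≠ α) (h2 : θ ≠ β) :
    arcSqrt (exp (α * I)) (exp (β * I)) (exp (θ * I)) *
      arcSqrt (exp ((-β : ℝ) * I)) (exp ((-α : ℝ) * I)) (exp (θ * I)) =
    -2 * exp (θ * I) * arcPhase α β θ *
      ((√|Real.cos θ - Real.cos α| * √|Real.cos θ - Real.cos β| : ℝ) : ℂ) := by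
  obtain ⟨h3, h4⟩ := hθ
  rw [arcSqrt_exp ⟨by linarith, by linarith⟩ ⟨by linarith, by linarith⟩ ⟨by linarith, h4⟩ hαβ h1 h2,
    arcSqrt_exp (α := -β) (β := -α) ⟨by linarith, by linarith⟩ ⟨by linarith, by linarith⟩
      ⟨by linarith, h4⟩ (by linarith) (by linarith) (by linarith)]
  have hp : arcPhase (-β) (-α) θ = 1 := by
    rw [arcPhase, if_neg (by linarith), if_neg (by linarith)]
  have hM := congrArg (fun x : ℝ => (x : ℂ)) (sqrt_sin_mul_sqrt_sin α β θ)
  simp only [ofReal_mul, ofReal_div, ofReal_ofNat] at hM ⊢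
  rw [hp]
  have e : exp (θ * I) = exp ((θ / 2 + (α + β) / 4 : ℝ) * I) *
      exp ((θ / 2 + (-β + -α) / 4 : ℝ) * I) := by
    rw [← Complex.exp_add]; congr 1; push_cast; ring
  rw [e]
  linear_combination (-4 * exp ((θ / 2 + (α + β) / 4 : ℝ) * I) *
      exp ((θ / 2 + (-β + -α) / 4 : ℝ) * I) * arcPhase α β θ) * hM +
    (4 * exp ((θ / 2 + (α + β) / 4 : ℝ) * I) *
      exp ((θ / 2 + (-β + -α) / 4 : ℝ) * I) * arcPhase α β θ *
      (√|Real.sin ((θ - α) / 2) * Real.sin ((θ - β) / 2)| *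
      √|Real.sin ((θ - -β) / 2) * Real.sin ((θ - -α) / 2)|)) * I_sq

/-- In the lower half plane the two arcs exchange roles: the upper one always contributes phase -1,
and the lower one carries the phase information, conjugated. -/
lemma arcSqrt_pair_exp_neg {α β θ : ℝ} (hα : 0 < α) (hβ : β < Real.pi)
    (hθ : θ ∈ Set.Ioo 0 Real.pi) (hαβ : α < β) (h1 : θ ≠ α) (h2 : θ ≠ β) :
    arcSqrt (exp (α * I)) (exp (β * I)) (exp ((-θ : ℝ) * I)) *
      arcSqrt (exp ((-β : ℝ) * I)) (exp ((-α : ℝ) * I)) (exp ((-θ : ℝ) * I)) =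
    -2 * exp ((-θ : ℝ) * I) * starRingEnd ℂ (arcPhase α β θ) *
      ((√|Real.cos θ - Real.cos α| * √|Real.cos θ - Real.cos β| : ℝ) : ℂ) := by
  obtain ⟨h3, h4⟩ := hθ
  rw [arcSqrt_exp ⟨by linarith, by linarith⟩ ⟨by linarith, by linarith⟩
      ⟨by linarith, by linarith⟩ hαβ (by linarith) (by linarith),
    arcSqrt_exp (α := -β) (β := -α) ⟨by linarith, by linarith⟩ ⟨by linarith, by linarith⟩
      ⟨by linarith, by linarith⟩ (by linarith) (by simpa using h2) (by simpa using h1)]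
  have hp : arcPhase α β (-θ) = -1 := by
    rw [arcPhase, if_pos (by linarith)]
  have hp' : arcPhase (-β) (-α) (-θ) = -starRingEnd ℂ (arcPhase α β θ) := by
    unfold arcPhase
    rcases lt_or_gt_of_ne h1 with h1 | h1
    · simp [h1, h1.not_gt, (h1.trans hαβ).not_gt]
    · rcases lt_or_gt_of_ne h2 with h2 | h2
      · simp [h1, h2, h2.not_gt, h1.not_gt]
      · simp [h2, h2.not_gt, h1.not_gt]
  have hM := congrArg (fun x : ℝ => (x : ℂ)) (sqrt_sin_mul_sqrt_sin α β (-θ))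
  simp only [ofReal_mul, ofReal_div, ofReal_ofNat, Real.cos_neg] at hM ⊢
  rw [hp, hp']
  have e : exp ((-θ : ℝ) * I) = exp ((-θ / 2 + (α + β) / 4 : ℝ) * I) *
      exp ((-θ / 2 + (-β + -α) / 4 : ℝ) * I) := by
    rw [← Complex.exp_add]; congr 1; push_cast; ring
  rw [e]
  generalize starRingEnd ℂ (arcPhase α β θ) = κ
  linear_combination (-4 * exp ((-θ / 2 + (α + β) / 4 : ℝ) * I) *
      exp ((-θ / 2 + (-β + -α) / 4 : ℝ) * I) * κ) * hM +
    (4 * exp ((-θ / 2 + (α + β) / 4 : ℝ) * I) *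
      exp ((-θ / 2 + (-β + -α) / 4 : ℝ) * I) * κ *
      (√|Real.sin ((-θ - α) / 2) * Real.sin ((-θ - β) / 2)| *
      √|Real.sin ((-θ - -β) / 2) * Real.sin ((-θ - -α) / 2)|)) * I_sq

lemma conj_exp_mul_I (x : ℝ) : starRingEnd ℂ (exp (x * I)) = exp ((-x : ℝ) * I) := by
  rw [← exp_conj]; simp

lemma IsNodes.Rhat_pair {ℓ : ℕ} {t : ℕ → ℝ} (h : IsNodes ℓ t) {η : ℕ → ℂ}
    (hη : ∀ j ∈ Icc 1 (2 * ℓ), η j = exp (t j * I)) {k : ℕ} (hk : k ∈ Icc 1 ℓ) {i : ℕ}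
    (hi : i ≤ 2 * ℓ) {θ : ℝ} (hθ : θ ∈ Set.Ioo (t i) (t (i + 1))) :
    arcSqrt (η (2 * k - 1)) (η (2 * k)) (exp (θ * I)) *
      arcSqrt (starRingEnd ℂ (η (2 * k))) (starRingEnd ℂ (η (2 * k - 1))) (exp (θ * I)) =
    -2 * exp (θ * I) * arcPhase (t (2 * k - 1)) (t (2 * k)) θ *
      ((√|Real.cos θ - Real.cos (t (2 * k - 1))| * √|Real.cos θ - Real.cos (t (2 * k))| : ℝ) : ℂ) ∧
    arcSqrt (η (2 * k - 1)) (η (2 * k)) (exp ((-θ : ℝ) * I)) *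
      arcSqrt (starRingEnd ℂ (η (2 * k))) (starRingEnd ℂ (η (2 * k - 1))) (exp ((-θ : ℝ) * I)) =
    starRingEnd ℂ (arcSqrt (η (2 * k - 1)) (η (2 * k)) (exp (θ * I)) *
      arcSqrt (starRingEnd ℂ (η (2 * k))) (starRingEnd ℂ (η (2 * k - 1))) (exp (θ * I))) := by
  rw [Finset.mem_Icc] at hk
  have m1 : 2 * k - 1 ∈ Icc 1 (2 * ℓ) := by rw [Finset.mem_Icc]; omega
  have m2 : 2 * k ∈ Icc 1 (2 * ℓ) := by rw [Finset.mem_Icc]; omega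
  have a1 : 0 < t (2 * k - 1) := h.pos (by omega) (by omega)
  have a2 : t (2 * k) < Real.pi := h.lt_pi (by omega)
  have a3 : t (2 * k - 1) < t (2 * k) := h.lt_of_lt (by omega) (by omega)
  have a4 : θ ∈ Set.Ioo 0 Real.pi :=
    ⟨(h.nonneg (by omega)).trans_lt hθ.1, hθ.2.trans_le (h.le_pi (by omega))⟩
  have a5 : θ ≠ t (2 * k - 1) := fun e => h.cos_ne hi m1 hθ (by rw [e])
  have a6 : θ ≠ t (2 * k) := fun e => h.cos_ne hi m2 hθ (by rw [e])
  rw [hη _ m1, hη _ m2, conj_exp_mul_I, conj_exp_mul_I, arcSqrt_pair_exp a1 a2 a4 a3 a5 a6,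
    arcSqrt_pair_exp_neg a1 a2 a4 a3 a5 a6]
  refine ⟨rfl, ?_⟩
  rw [map_mul, map_mul, map_mul, conj_exp_mul_I, conj_ofReal,
    show starRingEnd ℂ (-2) = -2 by rw [map_neg, map_ofNat]]

/-- Each pair of arcs contributes the phase 1 before its band, i on it and -1 after it, so i enters
once for every endpoint already passed. On gaps the total phase is a sign. -/
lemma IsNodes.Rhat_exp {ℓ : ℕ} {t : ℕ → ℝ} (h : IsNodes ℓ t) {η : ℕ → ℂ}
    (hη : ∀ j ∈ Icc 1 (2 * ℓ), η j = exp (t j * I)) {i : ℕ}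
    (hi : i ≤ 2 * ℓ) {θ : ℝ} (hθ : θ ∈ Set.Ioo (t i) (t (i + 1))) :
    Rhat η ℓ (exp (θ * I)) =
      2 ^ ℓ * exp (θ * I) ^ ℓ * I ^ i * ((weight ℓ t θ)⁻¹ : ℝ) := by
  -- The induction is over the number `n` of bands included; `min i (2 * n)` counts those of their
  -- endpoints that lie before θ.
  have key : ∀ n ≤ ℓ, Rhat η n (exp (θ * I)) =
      2 ^ n * exp (θ * I) ^ n * I ^ (min i (2 * n)) * ((weight n t θ)⁻¹ : ℝ) := by
    intro n
    induction n with
    | zero => intro _; simp [Rhat, weight]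
    | succ n ih =>
      intro hn
      have hR : Rhat η (n + 1) (exp (θ * I)) = Rhat η n (exp (θ * I)) *
          (arcSqrt (η (2 * (n + 1) - 1)) (η (2 * (n + 1))) (exp (θ * I)) *
          arcSqrt (starRingEnd ℂ (η (2 * (n + 1)))) (starRingEnd ℂ (η (2 * (n + 1) - 1)))
            (exp (θ * I))) := by
        rw [Rhat, Finset.prod_Icc_succ_top (by omega)]; rfl
      have hw : (weight (n + 1) t θ)⁻¹ = (weight n t θ)⁻¹ *
          (√|Real.cos θ - Real.cos (t (2 * (n + 1) - 1))| *
            √|Real.cos θ - Real.cos (t (2 * (n + 1)))|) := by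
        rw [weight, show 2 * (n + 1) = 2 * n + 1 + 1 by ring, Finset.prod_Icc_succ_top (by omega),
          Finset.prod_Icc_succ_top (by omega), ← weight, mul_inv, mul_inv, inv_inv, inv_inv,
          mul_assoc]
        rfl
      rw [hR, ih (by omega), (h.Rhat_pair hη (by rw [Finset.mem_Icc]; omega) hi hθ).1, hw]
      have hp : I ^ (min i (2 * (n + 1))) =
          -(I ^ (min i (2 * n)) * arcPhase (t (2 * (n + 1) - 1)) (t (2 * (n + 1))) θ) := by
        unfold arcPhase
        rw [show 2 * (n + 1) - 1 = 2 * n + 1 by omega]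
        rcases Nat.lt_or_ge i (2 * n + 1) with h1 | h1
        · have := h.le_of_le (show i + 1 ≤ 2 * n + 1 by omega) (by omega)
          rw [if_pos (by linarith [hθ.2]), min_eq_left (by omega), min_eq_left (by omega)]
          ring
        · have h2 := h.le_of_le h1 (by omega)
          rw [if_neg (by linarith [hθ.1]), min_eq_right (show 2 * n ≤ i by omega)]
          rcases Nat.lt_or_ge i (2 * (n + 1)) with h3 | h3
          · have := h.le_of_le (show i + 1 ≤ 2 * (n + 1) by omega) (by omega)
            rw [if_pos (by linarith [hθ.2]), min_eq_left (by omega),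
              show i = 2 * n + 1 by omega]
            ring
          · have := h.le_of_le h3 (by omega)
            rw [if_neg (by linarith [hθ.1]), min_eq_right (by omega), mul_add, pow_add]
            simp
      rw [hp]
      push_cast
      ring
  rw [key ℓ le_rfl, min_eq_left hi]

lemma IsNodes.Rhat_exp_neg {ℓ : ℕ} {t : ℕ → ℝ} (h : IsNodes ℓ t) {η : ℕ → ℂ}
    (hη : ∀ j ∈ Icc 1 (2 * ℓ), η j = exp (t j * I)) {i : ℕ}
    (hi : i ≤ 2 * ℓ) {θ : ℝ} (hθ : θ ∈ Set.Ioo (t i) (t (i + 1))) :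
    Rhat η ℓ (exp ((-θ : ℝ) * I)) = starRingEnd ℂ (Rhat η ℓ (exp (θ * I))) := by
  rw [Rhat, Rhat, map_prod]
  exact Finset.prod_congr rfl fun k hk => (h.Rhat_pair hη hk hi hθ).2

end DarkGas

/-! ### Integrability of the weight -/

namespace DarkGas

open Finset MeasureTheory

/-- At least one of the two distances is at least |a - b|/2, so only one of the two singularities is
active at a time. -/
lemma inv_sqrt_mul_inv_sqrt_le {a b x : ℝ} (hab : a ≠ b) :
    (√|x - a|)⁻¹ * (√|x - b|)⁻¹ ≤ (√(|a - b| / 2))⁻¹ * ((√|x - a|)⁻¹ + (√|x - b|)⁻¹) := by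
  have hd : 0 < |a - b| := abs_pos.2 (sub_ne_zero.2 hab)
  have htri : |a - b| ≤ |x - a| + |x - b| := by
    rw [← abs_neg (x - a)]
    refine le_trans (le_of_eq ?_) (abs_add_le _ _)
    congr 1; ring
  have hA : 0 ≤ (√|x - a|)⁻¹ := by positivity
  have hB : 0 ≤ (√|x - b|)⁻¹ := by positivity
  have hD : 0 ≤ (√(|a - b| / 2))⁻¹ := by positivity
  rcases le_total (|a - b| / 2) |x - a| with h | h
  · have : (√|x - a|)⁻¹ ≤ (√(|a - b| / 2))⁻¹ :=
      inv_anti₀ (Real.sqrt_pos.2 (by positivity)) (Real.sqrt_le_sqrt h)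
    nlinarith [mul_le_mul_of_nonneg_right this hB, mul_nonneg hD hA]
  · have : (√|x - b|)⁻¹ ≤ (√(|a - b| / 2))⁻¹ :=
      inv_anti₀ (Real.sqrt_pos.2 (by positivity)) (Real.sqrt_le_sqrt (by linarith))
    nlinarith [mul_le_mul_of_nonneg_left this hA, mul_nonneg hD hB]

/-- Singularities at distinct points do not reinforce each other: up to a constant, their product is
dominated by 1 plus their sum, whose integrability can be checked term by term. -/
lemma prod_inv_sqrt_le {ι : Type*} [DecidableEq ι] (s : Finset ι) {c : ι → ℝ}
    (hc : Set.InjOn c s) :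
    ∃ K, 0 ≤ K ∧ ∀ x, ∏ j ∈ s, (√|x - c j|)⁻¹ ≤ K * (1 + ∑ j ∈ s, (√|x - c j|)⁻¹) := by
  induction s using Finset.induction_on with
  | empty => exact ⟨1, by simp⟩
  | insert a s ha ih =>
    obtain ⟨K, hK, hs⟩ := ih (hc.mono (by simp))
    have hne : ∀ j ∈ s, c a ≠ c j := fun j hj h =>
      ha (by
        have := hc (by simp) (by simp [hj]) h
        rwa [this])
    have hD : ∀ j, 0 ≤ (√(|c a - c j| / 2))⁻¹ := fun j => by positivity
    set D := ∑ j ∈ s, (√(|c a - c j| / 2))⁻¹ with hDdef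
    have hD0 : 0 ≤ D := Finset.sum_nonneg fun j _ => hD j
    refine ⟨K * (1 + D), by positivity, fun x => ?_⟩
    rw [Finset.prod_insert ha, Finset.sum_insert ha]
    set A := (√|x - c a|)⁻¹ with hA
    have hA0 : 0 ≤ A := by positivity
    set T := ∑ j ∈ s, (√|x - c j|)⁻¹ with hT
    have hT0 : 0 ≤ T := Finset.sum_nonneg fun j _ => by positivity
    have h1 : A * T ≤ D * (A + T) := by
      rw [hT, Finset.mul_sum, hDdef, Finset.sum_mul]
      refine Finset.sum_le_sum fun j hj => (inv_sqrt_mul_inv_sqrt_le (hne j hj)).trans ?_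
      refine mul_le_mul_of_nonneg_left ?_ (hD j)
      have : (√|x - c j|)⁻¹ ≤ T :=
        Finset.single_le_sum (f := fun j => (√|x - c j|)⁻¹) (fun i _ => by positivity) hj
      linarith
    calc A * ∏ j ∈ s, (√|x - c j|)⁻¹ ≤ A * (K * (1 + T)) :=
          mul_le_mul_of_nonneg_left (hs x) hA0
      _ = K * (A + A * T) := by ring
      _ ≤ K * (A + D * (A + T)) := by gcongr
      _ ≤ K * ((1 + D) * (1 + (A + T))) := by
          refine mul_le_mul_of_nonneg_left ?_ hK
          nlinarith [mul_nonneg hD0 hA0, mul_nonneg hD0 hT0]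
      _ = K * (1 + D) * (1 + (A + T)) := by ring

/-- A real power of a negative base x is |x|^r cos(πr), which vanishes for r = -1/2. Thus each
summand lives on one half line; at 0 all terms are 0 by convention. -/
lemma inv_sqrt_abs_eq (x : ℝ) :
    (√|x|)⁻¹ = x ^ (-(1 / 2) : ℝ) + (-x) ^ (-(1 / 2) : ℝ) := by
  have h : ∀ y : ℝ, 0 < y → (√|y|)⁻¹ = y ^ (-(1 / 2) : ℝ) + (-y) ^ (-(1 / 2) : ℝ) := by
    intro y hy
    rw [Real.rpow_def_of_neg (by linarith : -y < 0), abs_of_pos hy, Real.rpow_neg hy.le,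
      ← Real.sqrt_eq_rpow, show -(1 / 2) * Real.pi = -(Real.pi / 2) by ring, Real.cos_neg,
      Real.cos_pi_div_two]
    simp
  rcases lt_trichotomy x 0 with hx | hx | hx
  · have := h (-x) (by linarith)
    rw [abs_neg, neg_neg] at this
    rw [this, add_comm]
  · subst hx
    rw [neg_zero, Real.zero_rpow (by norm_num)]
    simp
  · exact h x hx

lemma intervalIntegrable_inv_sqrt_abs_sub (α a b : ℝ) :
    IntervalIntegrable (fun x => (√|x - α|)⁻¹) volume a b := by
  have h1 : ∀ a b : ℝ, IntervalIntegrable (fun x : ℝ => (√|x|)⁻¹) volume a b := by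
    intro a b
    simp_rw [inv_sqrt_abs_eq]
    refine (intervalIntegral.intervalIntegrable_rpow' (by norm_num)).add ?_
    have := (intervalIntegral.intervalIntegrable_rpow' (a := -a) (b := -b)
      (r := -(1 / 2)) (by norm_num)).comp_sub_left 0
    simpa using this
  simpa using (h1 (a - α) (b - α)).comp_sub_right α

/-- The difference is 2 sin((θ+α)/2)|sin((θ-α)/2)|. Jordan's inequality bounds the second factor
below, and the first stays away from 0 because α is interior. -/
lemma abs_cos_sub_cos_ge {α θ : ℝ} (hα : α ∈ Set.Ioo 0 Real.pi) (hθ : θ ∈ Set.Icc 0 Real.pi) :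
    2 / Real.pi * min (Real.sin (α / 2)) (Real.cos (α / 2)) * |θ - α| ≤
      |Real.cos θ - Real.cos α| := by
  obtain ⟨a1, a2⟩ := hα
  obtain ⟨b1, b2⟩ := hθ
  have hπ := Real.pi_pos
  set m := min (Real.sin (α / 2)) (Real.cos (α / 2)) with hm
  have m1 : m ≤ Real.sin (α / 2) := min_le_left _ _
  have m2 : m ≤ Real.cos (α / 2) := min_le_right _ _
  have m0 : 0 < m := lt_min (Real.sin_pos_of_pos_of_lt_pi (by linarith) (by linarith))
    (Real.cos_pos_of_mem_Ioo ⟨by linarith, by linarith⟩)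
  have s0 : 0 ≤ Real.sin (θ / 2) := Real.sin_nonneg_of_nonneg_of_le_pi (by linarith) (by linarith)
  have c0 : 0 ≤ Real.cos (θ / 2) := Real.cos_nonneg_of_mem_Icc ⟨by linarith, by linarith⟩
  have h1 : m ≤ Real.sin ((θ + α) / 2) := by
    rw [show (θ + α) / 2 = θ / 2 + α / 2 by ring, Real.sin_add]
    -- For sine and cosine in [0, 1] each is at least its square, so the sum is at least 1.
    have : 1 ≤ Real.sin (θ / 2) + Real.cos (θ / 2) := by
      nlinarith [Real.sin_sq_add_cos_sq (θ / 2), Real.sin_le_one (θ / 2), Real.cos_le_one (θ / 2)]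
    nlinarith [mul_le_mul_of_nonneg_left m2 s0, mul_le_mul_of_nonneg_left m1 c0]
  have h2 : 2 / Real.pi * |(θ - α) / 2| ≤ |Real.sin ((θ - α) / 2)| :=
    Real.mul_abs_le_abs_sin (by rw [abs_le]; constructor <;> linarith)
  rw [Real.cos_sub_cos, abs_mul, abs_mul, abs_of_pos (m0.trans_le h1)]
  rw [abs_div, abs_two] at h2
  rw [abs_neg, abs_two]
  have h3 := mul_le_mul h1 h2 (by positivity) (m0.le.trans h1)
  calc 2 / Real.pi * m * |θ - α| = 2 * (m * (2 / Real.pi * (|θ - α| / 2))) := by ring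
    _ ≤ 2 * (Real.sin ((θ + α) / 2) * |Real.sin ((θ - α) / 2)|) := by gcongr
    _ = _ := by ring

lemma intervalIntegrable_inv_sqrt_cos_sub {α : ℝ} (hα : α ∈ Set.Ioo 0 Real.pi) :
    IntervalIntegrable (fun θ => (√|Real.cos θ - Real.cos α|)⁻¹) volume 0 Real.pi := by
  set K := 2 / Real.pi * min (Real.sin (α / 2)) (Real.cos (α / 2)) with hKdef
  have hK : 0 < K := by
    have := Real.pi_pos
    exact mul_pos (by positivity) (lt_min
      (Real.sin_pos_of_pos_of_lt_pi (by linarith [hα.1]) (by linarith [hα.2]))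
      (Real.cos_pos_of_mem_Ioo ⟨by linarith [hα.1], by linarith [hα.2]⟩))
  refine ((intervalIntegrable_inv_sqrt_abs_sub α 0 Real.pi).const_mul (√K)⁻¹).mono_fun
    (Measurable.aestronglyMeasurable (by fun_prop)) ?_
  refine (ae_restrict_mem measurableSet_uIoc).mono fun θ hθ => ?_
  rw [Set.uIoc_of_le Real.pi_pos.le] at hθ
  have h := abs_cos_sub_cos_ge hα ⟨hθ.1.le, hθ.2⟩
  beta_reduce
  rw [Real.norm_of_nonneg (by positivity), Real.norm_of_nonneg (by positivity), ← mul_inv,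
    ← Real.sqrt_mul hK.le]
  rcases eq_or_ne θ α with rfl | hne
  · simp
  · exact inv_anti₀ (Real.sqrt_pos.2 (mul_pos hK (abs_pos.2 (sub_ne_zero.2 hne))))
      (Real.sqrt_le_sqrt h)

lemma measurable_weight (ℓ : ℕ) (t : ℕ → ℝ) : Measurable (weight ℓ t) :=
  Finset.measurable_fun_prod _ fun _ _ => by fun_prop

lemma weight_nonneg (ℓ : ℕ) (t : ℕ → ℝ) (θ : ℝ) : 0 ≤ weight ℓ t θ :=
  Finset.prod_nonneg fun _ _ => by positivity

lemma IsNodes.intervalIntegrable_weight {ℓ : ℕ} {t : ℕ → ℝ} (h : IsNodes ℓ t) :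
    IntervalIntegrable (weight ℓ t) volume 0 Real.pi := by
  obtain ⟨K, hK, hle⟩ := prod_inv_sqrt_le (Icc 1 (2 * ℓ)) (c := fun j => Real.cos (t j)) (by
    intro i hi j hj hij
    simp only [coe_Icc, Set.mem_Icc] at hi hj
    refine h.strictMonoOn.injOn (by simp; omega) (by simp; omega) ?_
    exact Real.injOn_cos ⟨h.nonneg (by omega), h.le_pi (by omega)⟩
      ⟨h.nonneg (by omega), h.le_pi (by omega)⟩ hij)
  have hsum : IntervalIntegrable
      (fun θ => K * (1 + ∑ j ∈ Icc 1 (2 * ℓ), (√|Real.cos θ - Real.cos (t j)|)⁻¹))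
      volume 0 Real.pi := by
    refine IntervalIntegrable.const_mul (intervalIntegrable_const.add ?_) K
    have := IntervalIntegrable.sum (μ := volume) (a := 0) (b := Real.pi) (Icc 1 (2 * ℓ))
      (f := fun j θ => (√|Real.cos θ - Real.cos (t j)|)⁻¹) (fun j hj => by
        rw [Finset.mem_Icc] at hj
        exact intervalIntegrable_inv_sqrt_cos_sub ⟨h.pos hj.1 (by omega), h.lt_pi hj.2⟩)
    simpa only [Finset.sum_apply, Finset.sum_fn] using this
  refine hsum.mono_fun (measurable_weight ℓ t).aestronglyMeasurable
    (Filter.Eventually.of_forall fun θ => ?_)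
  beta_reduce
  rw [Real.norm_of_nonneg (weight_nonneg _ _ _)]
  exact (hle (Real.cos θ)).trans (le_abs_self _)

lemma weight_two_pi_sub (ℓ : ℕ) (t : ℕ → ℝ) (θ : ℝ) :
    weight ℓ t (2 * Real.pi - θ) = weight ℓ t θ := by
  simp [weight, Real.cos_two_pi_sub]

lemma IsNodes.intervalIntegrable_weight_two_pi {ℓ : ℕ} {t : ℕ → ℝ} (h : IsNodes ℓ t) :
    IntervalIntegrable (weight ℓ t) volume 0 (2 * Real.pi) := by
  refine h.intervalIntegrable_weight.trans ?_
  have := (h.intervalIntegrable_weight.comp_sub_left (2 * Real.pi)).symm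
  simp only [weight_two_pi_sub, sub_zero] at this
  convert this using 1
  ring

lemma IsNodes.intervalIntegrable_mul_weight {ℓ : ℕ} {t : ℕ → ℝ} (h : IsNodes ℓ t) {g : ℝ → ℝ}
    (hg : Continuous g) {a b : ℝ} (ha : a ∈ Set.Icc 0 Real.pi) (hb : b ∈ Set.Icc 0 Real.pi) :
    IntervalIntegrable (fun θ => g θ * weight ℓ t θ) volume a b := by
  have hI := h.intervalIntegrable_weight.continuousOn_mul hg.continuousOn
  refine hI.mono_set ?_
  rw [Set.uIcc_of_le Real.pi_pos.le]
  exact Set.uIcc_subset_Icc ha hb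

end DarkGas

/-! ### The branch of the square root inside the unit disc -/

namespace DarkGas

open Finset MeasureTheory Complex Filter Topology

/-- The branch of `√(1 - 2u cos τ + u²)` on the unit disc with value `1` at `0`. -/
noncomputable def sqrtFactor (τ : ℝ) (u : ℂ) : ℂ :=
  (1 - u * exp (τ * I)) ^ (2⁻¹ : ℂ) * (1 - u * exp ((-τ : ℝ) * I)) ^ (2⁻¹ : ℂ)

/-- The branch of `∏ √(1 - 2u cos t_j + u²)` on the unit disc with value `1` at `0`. -/
noncomputable def sqrtProd (ℓ : ℕ) (t : ℕ → ℝ) (u : ℂ) : ℂ :=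
  ∏ j ∈ Icc 1 (2 * ℓ), sqrtFactor (t j) u

lemma one_sub_mul_one_sub (τ : ℝ) (u : ℂ) :
    (1 - u * exp (τ * I)) * (1 - u * exp ((-τ : ℝ) * I)) = 1 - 2 * Real.cos τ * u + u ^ 2 := by
  have h1 : exp (τ * I) * exp ((-τ : ℝ) * I) = 1 := by
    rw [← Complex.exp_add]; simp
  have h2 : (2 : ℂ) * Real.cos τ = exp (τ * I) + exp ((-τ : ℝ) * I) := by
    rw [ofReal_cos, Complex.cos]; push_cast; ring
  rw [h2]
  linear_combination u ^ 2 * h1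

lemma sqrtFactor_sq (τ : ℝ) (u : ℂ) :
    sqrtFactor τ u ^ 2 = 1 - 2 * Real.cos τ * u + u ^ 2 := by
  rw [sqrtFactor, mul_pow, cpow_ofNat_inv_pow, cpow_ofNat_inv_pow, one_sub_mul_one_sub]

lemma sqrtProd_sq (ℓ : ℕ) (t : ℕ → ℝ) (u : ℂ) :
    sqrtProd ℓ t u ^ 2 = ∏ j ∈ Icc 1 (2 * ℓ), (1 - 2 * Real.cos (t j) * u + u ^ 2) := by
  rw [sqrtProd, ← Finset.prod_pow]
  simp_rw [sqrtFactor_sq]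

/-- For |w| ≤ 1 and w ≠ 1 the real part of 1 - w is positive. Hence a product of principal roots of
such factors is holomorphic in the disc and extends through the circle away from the endpoints. -/
lemma one_sub_mem_slitPlane {w : ℂ} (hw : ‖w‖ ≤ 1) (h1 : w ≠ 1) : 1 - w ∈ slitPlane := by
  refine Or.inl ?_
  rw [sub_re, one_re, sub_pos]
  refine lt_of_le_of_ne ((re_le_norm w).trans hw) fun hre => h1 ?_
  have h2 : ‖w‖ ^ 2 = w.re ^ 2 + w.im ^ 2 := by rw [← normSq_eq_norm_sq, normSq_apply]; ring
  have h3 : ‖w‖ ^ 2 ≤ 1 := by nlinarith [norm_nonneg w]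
  refine Complex.ext (by simpa using hre) ?_
  rw [hre] at h2
  have : w.im ^ 2 ≤ 0 := by nlinarith
  simpa using pow_eq_zero_iff (two_ne_zero) |>.1 (le_antisymm this (sq_nonneg _))

lemma norm_mul_exp (u : ℂ) (x : ℝ) : ‖u * exp (x * I)‖ = ‖u‖ := by
  rw [norm_mul, norm_exp_ofReal_mul_I, mul_one]

lemma factors_mem_slitPlane {τ : ℝ} {u : ℂ} (hu : ‖u‖ ≤ 1)
    (h : 1 - 2 * Real.cos τ * u + u ^ 2 ≠ 0) :
    1 - u * exp (τ * I) ∈ slitPlane ∧ 1 - u * exp ((-τ : ℝ) * I) ∈ slitPlane := by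
  rw [← one_sub_mul_one_sub, mul_ne_zero_iff, sub_ne_zero, sub_ne_zero] at h
  exact ⟨one_sub_mem_slitPlane ((norm_mul_exp _ _).trans_le hu) h.1.symm,
    one_sub_mem_slitPlane ((norm_mul_exp _ _).trans_le hu) h.2.symm⟩

lemma quadratic_ne_zero_of_norm_lt {τ : ℝ} {u : ℂ} (hu : ‖u‖ < 1) :
    1 - 2 * Real.cos τ * u + u ^ 2 ≠ 0 := by
  rw [← one_sub_mul_one_sub, mul_ne_zero_iff, sub_ne_zero, sub_ne_zero]
  constructor <;> intro h <;> have := congrArg norm h <;> rw [norm_mul_exp, norm_one] at this <;>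
    linarith

lemma sqrtProd_ne_zero {ℓ : ℕ} {t : ℕ → ℝ} {u : ℂ}
    (h : ∀ j ∈ Icc 1 (2 * ℓ), 1 - 2 * Real.cos (t j) * u + u ^ 2 ≠ 0) : sqrtProd ℓ t u ≠ 0 := by
  intro h0
  have := sqrtProd_sq ℓ t u
  rw [h0, zero_pow two_ne_zero] at this
  exact Finset.prod_ne_zero_iff.2 h this.symm

lemma differentiableAt_sqrtProd {ℓ : ℕ} {t : ℕ → ℝ} {u : ℂ} (hu : ‖u‖ ≤ 1)
    (h : ∀ j ∈ Icc 1 (2 * ℓ), 1 - 2 * Real.cos (t j) * u + u ^ 2 ≠ 0) :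
    DifferentiableAt ℂ (sqrtProd ℓ t) u := by
  have : sqrtProd ℓ t = fun u => ∏ j ∈ Icc 1 (2 * ℓ), sqrtFactor (t j) u := rfl
  rw [this]
  refine DifferentiableAt.fun_finsetProd fun j hj => ?_
  obtain ⟨h1, h2⟩ := factors_mem_slitPlane hu (h j hj)
  have d : ∀ x : ℝ, DifferentiableAt ℂ (fun u : ℂ => 1 - u * exp (x * I)) u :=
    fun x => by fun_prop
  exact ((d (t j)).cpow (differentiableAt_const _) h1).mul
    ((d (-t j)).cpow (differentiableAt_const _) h2)

lemma sqrtProd_zero (ℓ : ℕ) (t : ℕ → ℝ) : sqrtProd ℓ t 0 = 1 := by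
  simp [sqrtProd, sqrtFactor]

lemma conj_one_sub_cpow {w : ℂ} (hw : ‖w‖ ≤ 1) :
    starRingEnd ℂ ((1 - w) ^ (2⁻¹ : ℂ)) = (1 - starRingEnd ℂ w) ^ (2⁻¹ : ℂ) := by
  have harg : (1 - w).arg ≠ Real.pi := by
    rw [Ne, arg_eq_pi_iff]
    rintro ⟨h, -⟩
    rw [sub_re, one_re] at h
    linarith [re_le_norm w]
  have := conj_cpow (1 - w) (2⁻¹ : ℂ) harg
  simp only [map_sub, map_one, map_inv₀, map_ofNat] at this
  exact this.symm

lemma conj_sqrtProd (ℓ : ℕ) (t : ℕ → ℝ) {u : ℂ} (hu : ‖u‖ ≤ 1) :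
    starRingEnd ℂ (sqrtProd ℓ t u) = sqrtProd ℓ t (starRingEnd ℂ u) := by
  rw [sqrtProd, sqrtProd, map_prod]
  refine Finset.prod_congr rfl fun j _ => ?_
  rw [sqrtFactor, sqrtFactor, map_mul, conj_one_sub_cpow ((norm_mul_exp _ _).trans_le hu),
    conj_one_sub_cpow ((norm_mul_exp _ _).trans_le hu), map_mul, map_mul, conj_exp_mul_I,
    conj_exp_mul_I, neg_neg, mul_comm]

lemma conj_palindrome (m : ℕ) (B : Fin (m + 1) → ℝ) (z : ℂ) :
    starRingEnd ℂ (palindrome m B z) = palindrome m B (starRingEnd ℂ z) := by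
  simp [palindrome]

lemma quadratic_exp (τ θ : ℝ) :
    1 - 2 * Real.cos τ * exp (θ * I) + exp (θ * I) ^ 2 =
      exp (θ * I) * ((2 * (Real.cos θ - Real.cos τ) : ℝ) : ℂ) := by
  have h1 : exp (θ * I) * exp ((-θ : ℝ) * I) = 1 := by
    rw [← Complex.exp_add]; simp
  have h2 : (2 : ℂ) * Real.cos θ = exp (θ * I) + exp ((-θ : ℝ) * I) := by
    rw [ofReal_cos, Complex.cos]; push_cast; ring
  push_cast at h1 h2 ⊢
  linear_combination (-1 : ℂ) * h1 - exp (θ * I) * h2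

lemma quadratic_exp_ne_zero {τ θ : ℝ} (h : Real.cos θ ≠ Real.cos τ) :
    1 - 2 * Real.cos τ * exp (θ * I) + exp (θ * I) ^ 2 ≠ 0 := by
  rw [quadratic_exp]
  exact mul_ne_zero (Complex.exp_ne_zero _) (ofReal_ne_zero.2
    (mul_ne_zero two_ne_zero (sub_ne_zero.2 h)))

/-- Here 1 - e^{iψ} = 2 sin(ψ/2) e^{i(ψ-π)/2}, and the halved angle (ψ-π)/4 lies in (-π/4, π/4),
which identifies the principal root. -/
lemma one_sub_exp_cpow {ψ : ℝ} (h0 : 0 < ψ) (h1 : ψ < 2 * Real.pi) :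
    (1 - exp (ψ * I)) ^ (2⁻¹ : ℂ) =
      (√(2 * Real.sin (ψ / 2)) : ℝ) * exp (((ψ - Real.pi) / 4 : ℝ) * I) := by
  have hs : 0 < Real.sin (ψ / 2) := Real.sin_pos_of_pos_of_lt_pi (by linarith) (by linarith)
  have hre : 0 < ((√(2 * Real.sin (ψ / 2)) : ℝ) * exp (((ψ - Real.pi) / 4 : ℝ) * I)).re := by
    rw [re_ofReal_mul, exp_ofReal_mul_I_re]
    exact mul_pos (Real.sqrt_pos.2 (by positivity))
      (Real.cos_pos_of_mem_Ioo ⟨by linarith, by linarith⟩)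
  rw [← sq_cpow_two_inv hre]
  congr 1
  have e1 : (1 : ℂ) = exp ((0 : ℝ) * I) := by simp
  have e2 : exp (((ψ - Real.pi) / 4 : ℝ) * I) ^ 2 = -I * exp (((0 + ψ) / 2 : ℝ) * I) := by
    rw [← Complex.exp_nat_mul, ← exp_neg_pi_div_two_mul_I, ← Complex.exp_add]
    congr 1
    push_cast
    ring
  rw [e1, exp_sub_exp, mul_pow, e2, ← ofReal_pow, Real.sq_sqrt (by positivity), zero_sub, neg_div,
    Real.sin_neg]
  push_cast
  ring

lemma sqrtFactor_exp {τ θ : ℝ} (hτ : τ ∈ Set.Ioo 0 Real.pi) (hθ : θ ∈ Set.Ioo 0 Real.pi)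
    (hne : θ ≠ τ) :
    sqrtFactor τ (exp (θ * I)) = exp ((θ / 2 : ℝ) * I) * (if τ < θ then -I else 1) *
      ((√2 * √|Real.cos θ - Real.cos τ| : ℝ) : ℂ) := by
  have e1 : exp (θ * I) * exp (τ * I) = exp ((θ + τ : ℝ) * I) := by
    rw [← Complex.exp_add]; congr 1; push_cast; ring
  have hcos : Real.cos θ - Real.cos τ =
      -2 * Real.sin ((θ + τ) / 2) * Real.sin ((θ - τ) / 2) := Real.cos_sub_cos θ τ
  have hs1 : 0 < Real.sin ((θ + τ) / 2) :=
    Real.sin_pos_of_pos_of_lt_pi (by linarith [hτ.1, hθ.1]) (by linarith [hτ.2, hθ.2])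
  rw [sqrtFactor, e1, one_sub_exp_cpow (by linarith [hτ.1, hθ.1]) (by linarith [hτ.2, hθ.2])]
  rcases lt_or_gt_of_ne hne with h | h
  · have hs2 : 0 < Real.sin ((θ - τ + 2 * Real.pi) / 2) :=
      Real.sin_pos_of_pos_of_lt_pi (by linarith [hτ.2, hθ.1, Real.pi_pos]) (by linarith)
    have hs3 : Real.sin ((θ - τ + 2 * Real.pi) / 2) = -Real.sin ((θ - τ) / 2) := by
      rw [show (θ - τ + 2 * Real.pi) / 2 = (θ - τ) / 2 + Real.pi by ring, Real.sin_add_pi]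
    -- Before τ the angle θ - τ is negative; adding 2π puts it into the range of `one_sub_exp_cpow`,
    -- and this shift is the source of the phase difference between the two cases.
    have e2 : exp (θ * I) * exp ((-τ : ℝ) * I) = exp ((θ - τ + 2 * Real.pi : ℝ) * I) := by
      rw [← Complex.exp_add]
      push_cast
      rw [show ((θ : ℂ) - τ + 2 * Real.pi) * I = (θ - τ) * I + 2 * Real.pi * I by ring,
        Complex.exp_add _ (2 * Real.pi * I), exp_two_pi_mul_I, mul_one]
      congr 1; ring
    rw [e2, one_sub_exp_cpow (by linarith [hτ.2, hθ.1, Real.pi_pos]) (by linarith),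
      if_neg h.not_gt]
    have e3 : exp ((θ / 2 : ℝ) * I) = exp (((θ + τ - Real.pi) / 4 : ℝ) * I) *
        exp (((θ - τ + 2 * Real.pi - Real.pi) / 4 : ℝ) * I) := by
      rw [← Complex.exp_add]; congr 1; push_cast; ring
    have e4 : √2 * √|Real.cos θ - Real.cos τ| = √(2 * Real.sin ((θ + τ) / 2)) *
        √(2 * Real.sin ((θ - τ + 2 * Real.pi) / 2)) := by
      rw [← Real.sqrt_mul (by positivity), ← Real.sqrt_mul (by positivity), hcos, hs3]
      rw [hs3] at hs2
      rw [abs_of_nonneg (by nlinarith)]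
      congr 1; ring
    rw [e3, e4]
    push_cast
    ring
  · have hs2 : 0 < Real.sin ((θ - τ) / 2) :=
      Real.sin_pos_of_pos_of_lt_pi (by linarith) (by linarith [hθ.2, hτ.1])
    have e2 : exp (θ * I) * exp ((-τ : ℝ) * I) = exp ((θ - τ : ℝ) * I) := by
      rw [← Complex.exp_add]; congr 1; push_cast; ring
    rw [e2, one_sub_exp_cpow (by linarith) (by linarith [hθ.2, hτ.1, Real.pi_pos]), if_pos h]
    have e3 : exp ((θ / 2 : ℝ) * I) * -I = exp (((θ + τ - Real.pi) / 4 : ℝ) * I) *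
        exp (((θ - τ - Real.pi) / 4 : ℝ) * I) := by
      rw [← Complex.exp_add, ← exp_neg_pi_div_two_mul_I, ← Complex.exp_add]
      congr 1; push_cast; ring
    have e4 : √2 * √|Real.cos θ - Real.cos τ| = √(2 * Real.sin ((θ + τ) / 2)) *
        √(2 * Real.sin ((θ - τ) / 2)) := by
      rw [← Real.sqrt_mul (by positivity), ← Real.sqrt_mul (by positivity), hcos,
        abs_of_nonpos (by nlinarith [mul_pos hs1 hs2])]
      congr 1; ring
    rw [e3, e4]
    push_cast
    ring

/-- The interior branch picks up -i at each endpoint where R̂_ℓ, taken from outside, picks up i. The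
two agree on gaps and are opposite on bands, so Cauchy's theorem inside the disc gives information
on the gap integrals of the exterior branch. -/
lemma IsNodes.sqrtProd_exp {ℓ : ℕ} {t : ℕ → ℝ} (h : IsNodes ℓ t) {i : ℕ}
    (hi : i ≤ 2 * ℓ) {θ : ℝ} (hθ : θ ∈ Set.Ioo (t i) (t (i + 1))) :
    sqrtProd ℓ t (exp (θ * I)) =
      2 ^ ℓ * exp (θ * I) ^ ℓ * (-I) ^ i * ((weight ℓ t θ)⁻¹ : ℝ) := by
  have hθ' : θ ∈ Set.Ioo 0 Real.pi :=
    ⟨(h.nonneg (by omega)).trans_lt hθ.1, hθ.2.trans_le (h.le_pi (by omega))⟩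
  have key : ∀ n ≤ 2 * ℓ, ∏ j ∈ Icc 1 n, sqrtFactor (t j) (exp (θ * I)) =
      (exp ((θ / 2 : ℝ) * I) * (√2 : ℝ)) ^ n * (-I) ^ (min i n) *
        ((∏ j ∈ Icc 1 n, √|Real.cos θ - Real.cos (t j)| : ℝ) : ℂ) := by
    intro n
    induction n with
    | zero => intro _; simp
    | succ n ih =>
      intro hn
      have hm : n + 1 ∈ Icc 1 (2 * ℓ) := by rw [Finset.mem_Icc]; omega
      rw [Finset.prod_Icc_succ_top (by omega), Finset.prod_Icc_succ_top (by omega),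
        ih (by omega), sqrtFactor_exp ⟨h.pos (by omega) (by omega), h.lt_pi hn⟩ hθ'
          (fun e => h.cos_ne hi hm hθ (by rw [e]))]
      have hp : (-I) ^ (min i (n + 1)) =
          (-I) ^ (min i n) * (if t (n + 1) < θ then -I else 1) := by
        rcases Nat.lt_or_ge i (n + 1) with h1 | h1
        · have := h.le_of_le (show i + 1 ≤ n + 1 by omega) (by omega)
          rw [if_neg (by linarith [hθ.2]), min_eq_left (by omega), min_eq_left (by omega), mul_one]
        · have := h.le_of_le h1 (by omega)
          rw [if_pos (by linarith [hθ.1]), min_eq_right h1, min_eq_right (by omega), pow_succ]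
      rw [hp]
      push_cast
      ring
  rw [sqrtProd, key _ le_rfl, min_eq_left hi, weight, Finset.prod_inv_distrib, inv_inv]
  congr 2
  rw [mul_pow, pow_mul, pow_mul, ← ofReal_pow, Real.sq_sqrt (by norm_num), ← Complex.exp_nat_mul,
    mul_comm]
  congr 2
  congr 1
  push_cast
  ring

lemma norm_cpow_two_inv (z : ℂ) : ‖z ^ (2⁻¹ : ℂ)‖ = √‖z‖ := by
  rw [eq_comm, Real.sqrt_eq_iff_mul_self_eq (norm_nonneg _) (norm_nonneg _), ← norm_mul, ← sq,
    cpow_ofNat_inv_pow]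

/-- Both |1 - w| ≤ |1 - rw| + (1 - r) and 1 - r ≤ |1 - rw| are triangle inequalities. The point is
uniformity in r, which yields a dominating function as r → 1. -/
lemma norm_one_sub_exp_le {r : ℝ} (hr : r ∈ Set.Icc 0 1) {w : ℂ} (hw : ‖w‖ = 1) :
    ‖1 - w‖ ≤ 2 * ‖1 - r * w‖ := by
  have h1 : ‖1 - w‖ ≤ ‖1 - r * w‖ + (1 - r) := by
    have : ‖((r - 1 : ℝ) : ℂ) * w‖ = 1 - r := by
      rw [norm_mul, hw, mul_one, norm_real, Real.norm_eq_abs, abs_of_nonpos (by linarith [hr.2])]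
      ring
    rw [← this]
    refine le_trans (le_of_eq ?_) (norm_add_le _ _)
    congr 1; push_cast; ring
  have h2 : 1 - r ≤ ‖1 - r * w‖ := by
    have := norm_sub_norm_le (1 : ℂ) (r * w)
    rw [norm_one, norm_mul, hw, mul_one, norm_real, Real.norm_of_nonneg hr.1] at this
    exact this
  linarith

lemma norm_inv_sqrtFactor_le {r : ℝ} (hr : r ∈ Set.Icc 0 1) {τ θ : ℝ}
    (h : Real.cos θ ≠ Real.cos τ) :
    ‖(sqrtFactor τ (r * exp (θ * I)))⁻¹‖ ≤ √2 * (√|Real.cos θ - Real.cos τ|)⁻¹ := by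
  have hpos : 0 < |Real.cos θ - Real.cos τ| := abs_pos.2 (sub_ne_zero.2 h)
  have h1 := norm_one_sub_exp_le hr (w := exp (θ * I) * exp (τ * I))
    (by rw [norm_mul_exp, norm_exp_ofReal_mul_I])
  have h2 := norm_one_sub_exp_le hr (w := exp (θ * I) * exp ((-τ : ℝ) * I))
    (by rw [norm_mul_exp, norm_exp_ofReal_mul_I])
  have h3 : ‖1 - exp (θ * I) * exp (τ * I)‖ * ‖1 - exp (θ * I) * exp ((-τ : ℝ) * I)‖ =
      2 * |Real.cos θ - Real.cos τ| := by
    rw [← norm_mul, one_sub_mul_one_sub, quadratic_exp, norm_mul, norm_exp_ofReal_mul_I, one_mul,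
      norm_real, Real.norm_eq_abs, abs_mul, abs_two]
  have h4 := mul_le_mul h1 h2 (norm_nonneg _) (by positivity)
  rw [h3] at h4
  rw [sqrtFactor, norm_inv, norm_mul, norm_cpow_two_inv, norm_cpow_two_inv,
    ← Real.sqrt_mul (norm_nonneg _), mul_assoc, mul_assoc]
  rw [show √2 * (√|Real.cos θ - Real.cos τ|)⁻¹ = (√(|Real.cos θ - Real.cos τ| / 2))⁻¹ by
    rw [Real.sqrt_div hpos.le, inv_div, div_eq_mul_inv]]
  exact inv_anti₀ (Real.sqrt_pos.2 (by positivity)) (Real.sqrt_le_sqrt (by linarith))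

lemma norm_inv_sqrtProd_le {ℓ : ℕ} {t : ℕ → ℝ} {r : ℝ} (hr : r ∈ Set.Icc 0 1) {θ : ℝ}
    (h : ∀ j ∈ Icc 1 (2 * ℓ), Real.cos θ ≠ Real.cos (t j)) :
    ‖(sqrtProd ℓ t (r * exp (θ * I)))⁻¹‖ ≤ 2 ^ ℓ * weight ℓ t θ := by
  rw [sqrtProd, ← Finset.prod_inv_distrib, norm_prod]
  refine (Finset.prod_le_prod (fun j _ => norm_nonneg _)
    fun j hj => norm_inv_sqrtFactor_le hr (h j hj)).trans (le_of_eq ?_)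
  rw [Finset.prod_mul_distrib, Finset.prod_const, Nat.card_Icc, Nat.add_sub_cancel, pow_mul,
    Real.sq_sqrt (by norm_num), weight]

lemma ae_cos_ne (ℓ : ℕ) (t : ℕ → ℝ) :
    ∀ᵐ θ : ℝ, ∀ j ∈ Icc 1 (2 * ℓ), Real.cos θ ≠ Real.cos (t j) := by
  have hc : (⋃ j ∈ Icc 1 (2 * ℓ), {θ : ℝ | Real.cos θ = Real.cos (t j)}).Countable := by
    refine Set.Countable.biUnion (Finset.countable_toSet _) fun j _ => ?_
    refine ((Set.countable_range fun k : ℤ => t j - 2 * k * Real.pi).union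
      (Set.countable_range fun k : ℤ => 2 * k * Real.pi - t j)).mono ?_
    intro θ hθ
    obtain ⟨k, hk | hk⟩ := Real.cos_eq_cos_iff.1 hθ
    · exact Or.inl ⟨k, by simp only; linarith⟩
    · exact Or.inr ⟨k, by simp only; linarith⟩
  filter_upwards [compl_mem_ae_iff.2 (hc.measure_zero volume)] with θ hθ j hj h
  exact hθ (Set.mem_biUnion hj h)

end DarkGas

/-! ### Cauchy's theorem up to the boundary of the disc -/

namespace DarkGas

open Finset MeasureTheory Complex Filter Topology

lemma differentiable_palindrome (m : ℕ) (B : Fin (m + 1) → ℝ) :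
    Differentiable ℂ (palindrome m B) := by
  unfold palindrome; fun_prop

lemma differentiableAt_div_sqrtProd {ℓ : ℕ} {t : ℕ → ℝ} {f : ℂ → ℂ} (hf : Differentiable ℂ f)
    {u : ℂ} (hu : ‖u‖ < 1) : DifferentiableAt ℂ (fun u => f u / sqrtProd ℓ t u) u :=
  (hf u).div (differentiableAt_sqrtProd hu.le fun _ _ => quadratic_ne_zero_of_norm_lt hu)
    (sqrtProd_ne_zero fun _ _ => quadratic_ne_zero_of_norm_lt hu)

/-- If `f² - ∏ (1 - 2u cos t_j + u²)` vanishes to order `n + 1` at `0` and `f 0 = 1`, then the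
coefficient of `uⁿ` in `f / sqrtProd` vanishes. -/
lemma circleIntegral_div_sqrtProd_eq_zero {ℓ : ℕ} {t : ℕ → ℝ} {f N : ℂ → ℂ}
    (hf : Differentiable ℂ f) (hN : Differentiable ℂ N) (hf0 : f 0 = 1) {n : ℕ} (hn : 1 ≤ n)
    (hfN : ∀ u, f u ^ 2 - ∏ j ∈ Icc 1 (2 * ℓ), (1 - 2 * Real.cos (t j) * u + u ^ 2) =
      u ^ (n + 1) * N u) {r : ℝ} (hr : r ∈ Set.Ioo 0 1) :
    (∮ u in C(0, r), f u / sqrtProd ℓ t u / u ^ (n + 1)) = 0 := by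
  set G : ℂ → ℂ := fun u => f u / sqrtProd ℓ t u with hG
  have hGd : ∀ u : ℂ, ‖u‖ < 1 → DifferentiableAt ℂ G u := fun u hu =>
    differentiableAt_div_sqrtProd hf hu
  have hG0 : G 0 = 1 := by simp [hG, hf0, sqrtProd_zero]
  have hev : ∀ᶠ u in 𝓝 (0 : ℂ), G u + 1 ≠ 0 := by
    have : ContinuousAt (fun u => G u + 1) 0 :=
      (hGd 0 (by simp)).continuousAt.add continuousAt_const
    exact this.eventually_ne (by rw [hG0]; norm_num)
  obtain ⟨ε, hε, hball⟩ := Metric.eventually_nhds_iff_ball.1 hev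
  -- The denominator G + 1 below is known to be nonzero only near 0, so the circle is first shrunk
  -- through the annulus.
  set δ := min (ε / 2) r with hδ
  have hδ0 : 0 < δ := lt_min (by linarith) hr.1
  have hδr : δ ≤ r := min_le_right _ _
  have hδε : δ < ε := (min_le_left _ _).trans_lt (by linarith)
  have hD : ∀ u : ℂ, u ≠ 0 → ‖u‖ < 1 → DifferentiableAt ℂ (fun u => G u / u ^ (n + 1)) u :=
    fun u h0 hu => (hGd u hu).div (by fun_prop) (pow_ne_zero _ h0)
  rw [circleIntegral_eq_of_differentiable_on_annulus_off_countable hδ0 hδr Set.countable_empty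
    (f := fun u => G u / u ^ (n + 1))]
  · have hle : ∀ u : ℂ, u ∈ Metric.closedBall (0 : ℂ) δ → ‖u‖ < 1 ∧ G u + 1 ≠ 0 := by
      intro u hu
      rw [mem_closedBall_zero_iff] at hu
      exact ⟨by linarith [hr.2], hball u (by rw [mem_ball_zero_iff]; linarith)⟩
    -- With S the interior square root and G = f/S, the identity G - 1 = (f² - S²)/(S²(G + 1)) gives
    -- G/u^{n+1} = u^{-(n+1)} + L with L holomorphic near 0; the pure power integrates to 0 because
    -- n ≥ 1.
    set L : ℂ → ℂ := fun u => N u / (sqrtProd ℓ t u ^ 2 * (G u + 1)) with hL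
    have hLd : ∀ u ∈ Metric.closedBall (0 : ℂ) δ, DifferentiableAt ℂ L u := by
      intro u hu
      obtain ⟨h1, h2⟩ := hle u hu
      refine (hN u).div (((differentiableAt_sqrtProd h1.le
        fun _ _ => quadratic_ne_zero_of_norm_lt h1).pow 2).mul ((hGd u h1).add_const 1)) ?_
      exact mul_ne_zero (pow_ne_zero _ (sqrtProd_ne_zero fun _ _ =>
        quadratic_ne_zero_of_norm_lt h1)) h2
    have hLc : ContinuousOn L (Metric.closedBall 0 δ) := fun u hu =>
      (hLd u hu).continuousAt.continuousWithinAt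
    have hL0 : (∮ u in C(0, δ), L u) = 0 :=
      circleIntegral_eq_zero_of_differentiable_on_off_countable hδ0.le Set.countable_empty hLc
        fun u hu => hLd u (Metric.ball_subset_closedBall hu.1)
    have hpow : (∮ u in C(0, δ), (u - 0) ^ (-((n : ℤ) + 1))) = 0 :=
      circleIntegral.integral_sub_zpow_of_ne (by omega) _ _ _
    have heq : Set.EqOn (fun u => G u / u ^ (n + 1))
        (fun u => (u - 0) ^ (-((n : ℤ) + 1)) + L u) (Metric.sphere 0 δ) := by
      intro u hu
      obtain ⟨h1, h2⟩ := hle u (Metric.sphere_subset_closedBall hu)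
      have hu0 : u ≠ 0 := by
        rintro rfl
        rw [mem_sphere_zero_iff_norm, norm_zero] at hu
        linarith
      have hS : sqrtProd ℓ t u ≠ 0 := sqrtProd_ne_zero fun _ _ => quadratic_ne_zero_of_norm_lt h1
      have hk := hfN u
      rw [← sqrtProd_sq] at hk
      have hGS : G u * sqrtProd ℓ t u = f u := div_mul_cancel₀ _ hS
      have hz : (u - 0) ^ (-((n : ℤ) + 1)) = (u ^ (n + 1))⁻¹ := by
        rw [sub_zero, zpow_neg]; norm_cast
      simp only [hz, hL]
      rw [← hGS] at hk
      have hup : u ^ (n + 1) ≠ 0 := pow_ne_zero _ hu0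
      field_simp
      linear_combination hk
    rw [circleIntegral.integral_congr hδ0.le heq, circleIntegral.integral_add _ _, hpow, hL0,
      add_zero]
    · refine ContinuousOn.circleIntegrable hδ0.le fun u hu => ?_
      refine ContinuousAt.continuousWithinAt (ContinuousAt.zpow₀ (by fun_prop) _ (Or.inl ?_))
      intro h0
      rw [sub_zero] at h0
      rw [h0, mem_sphere_zero_iff_norm, norm_zero] at hu
      linarith
    · exact (hLc.mono Metric.sphere_subset_closedBall).circleIntegrable hδ0.le
  · intro u hu
    refine (hD u ?_ ?_).continuousAt.continuousWithinAt
    · rintro rfl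
      exact hu.2 (Metric.mem_ball_self hδ0)
    · have := hu.1
      rw [mem_closedBall_zero_iff] at this
      linarith [hr.2]
  · intro u hu
    refine hD u ?_ ?_
    · rintro rfl
      exact hu.1.2 (Metric.mem_closedBall_self hδ0.le)
    · have := hu.1.1
      rw [mem_ball_zero_iff] at this
      linarith [hr.2]

/-- The integrals over circles of radius r < 1 vanish; let r → 1 by dominated convergence, a
multiple of the weight being the majorant. -/
lemma IsNodes.integral_div_sqrtProd_eq_zero {ℓ : ℕ} {t : ℕ → ℝ} (h : IsNodes ℓ t) {f N : ℂ → ℂ}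
    (hf : Differentiable ℂ f) (hN : Differentiable ℂ N) (hf0 : f 0 = 1) {n : ℕ} (hn : 1 ≤ n)
    (hfN : ∀ u, f u ^ 2 - ∏ j ∈ Icc 1 (2 * ℓ), (1 - 2 * Real.cos (t j) * u + u ^ 2) =
      u ^ (n + 1) * N u) :
    IntervalIntegrable (fun θ : ℝ => f (exp (θ * I)) / sqrtProd ℓ t (exp (θ * I)) /
      exp (θ * I) ^ n) volume 0 (2 * Real.pi) ∧
    ∫ θ in (0 : ℝ)..2 * Real.pi, f (exp (θ * I)) / sqrtProd ℓ t (exp (θ * I)) /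
      exp (θ * I) ^ n = 0 := by
  obtain ⟨M, hM⟩ := (isCompact_closedBall (0 : ℂ) 1).exists_bound_of_continuousOn
    hf.continuous.continuousOn
  have hM0 : 0 ≤ M := (norm_nonneg _).trans (hM 0 (by simp))
  set F : ℝ → ℝ → ℂ := fun r θ => f (r * exp (θ * I)) / sqrtProd ℓ t (r * exp (θ * I)) /
      (r * exp (θ * I)) ^ n with hF
  -- The restriction r ≥ 1/2 is needed only for the pole: it bounds r^{-n} by 2^n.
  have hbound : ∀ r ∈ Set.Icc (1 / 2 : ℝ) 1, ∀ᵐ θ : ℝ,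
      ‖F r θ‖ ≤ 2 ^ n * M * 2 ^ ℓ * weight ℓ t θ := by
    intro r hr
    filter_upwards [ae_cos_ne ℓ t] with θ hθ
    have hr0 : 0 < r := by linarith [hr.1]
    have hnorm : ‖(r : ℂ) * exp (θ * I)‖ = r := by
      rw [norm_mul_exp, norm_real, Real.norm_of_nonneg hr0.le]
    have h1 : ‖f (r * exp (θ * I))‖ ≤ M := hM _ (by
      rw [mem_closedBall_zero_iff, hnorm]; exact hr.2)
    have h2 := norm_inv_sqrtProd_le (t := t) (ℓ := ℓ) ⟨hr0.le, hr.2⟩ hθ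
    have h3 : (r ^ n)⁻¹ ≤ 2 ^ n := by
      rw [← inv_pow]
      refine pow_le_pow_left₀ (by positivity) ?_ n
      rw [inv_le_comm₀ hr0 (by norm_num)]
      linarith [hr.1]
    simp only [hF]
    rw [div_eq_mul_inv, div_eq_mul_inv, norm_mul, norm_mul, norm_inv (_ ^ n), norm_pow, hnorm]
    calc _ ≤ M * (2 ^ ℓ * weight ℓ t θ) * 2 ^ n := by
          have hw := weight_nonneg ℓ t θ
          gcongr
      _ = _ := by ring
  have hbi : IntervalIntegrable (fun θ => 2 ^ n * M * 2 ^ ℓ * weight ℓ t θ) volume 0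
      (2 * Real.pi) := h.intervalIntegrable_weight_two_pi.const_mul _
  have hcont : ∀ r ∈ Set.Ioo (0 : ℝ) 1, Continuous (F r) := by
    intro r hr
    have hnorm : ∀ θ : ℝ, ‖(r : ℂ) * exp (θ * I)‖ < 1 := fun θ => by
      rw [norm_mul_exp, norm_real, Real.norm_of_nonneg hr.1.le]; exact hr.2
    refine Continuous.div ?_ (by fun_prop) fun θ => pow_ne_zero _
      (mul_ne_zero (ofReal_ne_zero.2 hr.1.ne') (Complex.exp_ne_zero _))
    rw [continuous_iff_continuousAt]
    intro θ
    exact ContinuousAt.comp (f := fun θ : ℝ => (r : ℂ) * exp (θ * I))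
      (g := fun u => f u / sqrtProd ℓ t u)
      (differentiableAt_div_sqrtProd hf (hnorm θ)).continuousAt (by fun_prop)
  have hlim : ∀ᵐ θ : ℝ, Tendsto (fun r => F r θ) (𝓝[<] 1) (𝓝 (F 1 θ)) := by
    filter_upwards [ae_cos_ne ℓ t] with θ hθ
    refine tendsto_nhdsWithin_of_tendsto_nhds ?_
    have hq : ∀ j ∈ Icc 1 (2 * ℓ), 1 - 2 * Real.cos (t j) * (((1 : ℝ) : ℂ) * exp (θ * I)) +
        (((1 : ℝ) : ℂ) * exp (θ * I)) ^ 2 ≠ 0 := fun j hj => by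
      rw [ofReal_one, one_mul]; exact quadratic_exp_ne_zero (hθ j hj)
    have hG : ContinuousAt (fun u => f u / sqrtProd ℓ t u / u ^ n)
        (((1 : ℝ) : ℂ) * exp (θ * I)) :=
      ((hf.continuous.continuousAt).div (differentiableAt_sqrtProd (by simp [norm_exp_ofReal_mul_I])
        hq).continuousAt (sqrtProd_ne_zero hq)).div (by fun_prop)
        (pow_ne_zero _ (by simp [Complex.exp_ne_zero]))
    exact ContinuousAt.comp (f := fun r : ℝ => (r : ℂ) * exp (θ * I))
      (g := fun u => f u / sqrtProd ℓ t u / u ^ n) hG (by fun_prop)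
  have hmem : ∀ᶠ r : ℝ in 𝓝[<] 1, r ∈ Set.Ioo (1 / 2 : ℝ) 1 :=
    Ioo_mem_nhdsLT (by norm_num)
  have hzero : ∀ r ∈ Set.Ioo (0 : ℝ) 1, ∫ θ in (0 : ℝ)..2 * Real.pi, F r θ = 0 := by
    intro r hr
    have := circleIntegral_div_sqrtProd_eq_zero hf hN hf0 hn hfN hr
    rw [circleIntegral] at this
    have hE : (fun θ : ℝ => deriv (circleMap 0 r) θ • (f (circleMap 0 r θ) /
        sqrtProd ℓ t (circleMap 0 r θ) / circleMap 0 r θ ^ (n + 1))) = fun θ => I * F r θ := by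
      funext θ
      have hc : circleMap 0 r θ = r * exp (θ * I) := by simp [circleMap]
      rw [deriv_circleMap, hc, smul_eq_mul]
      simp only [hF]
      have : (r : ℂ) * exp (θ * I) ≠ 0 :=
        mul_ne_zero (ofReal_ne_zero.2 hr.1.ne') (Complex.exp_ne_zero _)
      generalize (r : ℂ) * exp (θ * I) = u at *
      rw [pow_succ]
      field_simp
    rw [hE, intervalIntegral.integral_const_mul] at this
    exact (mul_eq_zero.1 this).resolve_left I_ne_zero
  have hF1 : F 1 = fun θ : ℝ => f (exp (θ * I)) / sqrtProd ℓ t (exp (θ * I)) /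
      exp (θ * I) ^ n := by
    funext θ; simp [hF]
  rw [← hF1]
  constructor
  · have hae : AEStronglyMeasurable (F 1) volume := by
      refine aestronglyMeasurable_of_tendsto_ae (𝓝[<] (1 : ℝ))
        (f := fun r θ => if r ∈ Set.Ioo (0 : ℝ) 1 then F r θ else 0) (fun r => ?_) ?_
      · by_cases hr : r ∈ Set.Ioo (0 : ℝ) 1
        · simpa [hr] using (hcont r hr).aestronglyMeasurable
        · simp [hr, aestronglyMeasurable_const]
      · filter_upwards [hlim] with θ hθ
        refine hθ.congr' ?_
        filter_upwards [hmem] with r hr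
        rw [if_pos ⟨by linarith [hr.1], hr.2⟩]
    refine hbi.mono_fun hae.restrict (ae_restrict_of_ae ?_)
    filter_upwards [hbound 1 ⟨by norm_num, le_rfl⟩] with θ hθ
    exact hθ.trans (le_abs_self _)
  · have hT := intervalIntegral.tendsto_integral_filter_of_dominated_convergence
      (μ := volume) (a := 0) (b := 2 * Real.pi) (l := 𝓝[<] (1 : ℝ)) (F := F) (f := F 1)
      (fun θ => 2 ^ n * M * 2 ^ ℓ * weight ℓ t θ)
      (by
        filter_upwards [hmem] with r hr
        exact (hcont r ⟨by linarith [hr.1], hr.2⟩).aestronglyMeasurable)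
      (by
        filter_upwards [hmem] with r hr
        filter_upwards [hbound r ⟨hr.1.le, hr.2.le⟩] with θ hθ _ using hθ)
      hbi (by filter_upwards [hlim] with θ hθ _ using hθ)
    refine tendsto_nhds_unique hT (tendsto_const_nhds.congr' ?_)
    filter_upwards [hmem] with r hr
    exact (hzero r ⟨by linarith [hr.1], hr.2⟩).symm

end DarkGas

/-! ### The additional gap through the point 1 -/

namespace DarkGas

open Finset MeasureTheory Complex Filter Topology

lemma IsNodes.mem_Icc {ℓ : ℕ} {t : ℕ → ℝ} (h : IsNodes ℓ t) {j : ℕ} (hj : j ≤ 2 * ℓ + 1) :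
    t j ∈ Set.Icc 0 Real.pi := ⟨h.nonneg hj, h.le_pi hj⟩

lemma continuous_eval_cos (p : Polynomial ℝ) : Continuous fun θ => p.eval (Real.cos θ) :=
  p.continuous.comp Real.continuous_cos

/-- This is the real part of the vanishing circle integral, folded onto the upper half circle by
conjugation symmetry. The sign is (-1)^k on the k-th gap, and bands have weight 0 since their
contributions are imaginary. -/
lemma IsNodes.sum_integral_eq_zero {ℓ : ℕ} {t : ℕ → ℝ} (h : IsNodes ℓ t) {n : ℕ} (hn : 1 ≤ n)
    {B : Fin (ℓ + n + 1) → ℝ} (hB : palindrome (ℓ + n) B 0 = 1) {N : ℂ → ℂ}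
    (hN : Differentiable ℂ N)
    (hBN : ∀ u, palindrome (ℓ + n) B u ^ 2 -
      ∏ j ∈ Icc 1 (2 * ℓ), (1 - 2 * Real.cos (t j) * u + u ^ 2) = u ^ (n + 1) * N u) :
    ∑ i ∈ range (2 * ℓ + 1), (I ^ i).re *
      ∫ θ in t i..t (i + 1), (chebPoly (ℓ + n) B).eval (Real.cos θ) * weight ℓ t θ = 0 := by
  obtain ⟨hInt, hzero⟩ := h.integral_div_sqrtProd_eq_zero
    (differentiable_palindrome (ℓ + n) B) hN hB hn hBN
  set G : ℝ → ℂ := fun θ => palindrome (ℓ + n) B (exp (θ * I)) / sqrtProd ℓ t (exp (θ * I)) /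
      exp (θ * I) ^ n with hG
  have hsymm : ∀ θ : ℝ, (G (2 * Real.pi - θ)).re = (G θ).re := by
    intro θ
    have he : exp ((2 * Real.pi - θ : ℝ) * I) = starRingEnd ℂ (exp (θ * I)) := by
      rw [conj_exp_mul_I]
      push_cast
      rw [sub_mul, sub_eq_add_neg, Complex.exp_add, exp_two_pi_mul_I, one_mul, neg_mul]
    have : G (2 * Real.pi - θ) = starRingEnd ℂ (G θ) := by
      simp only [hG]
      rw [he, map_div₀, map_div₀, map_pow, conj_palindrome,
        conj_sqrtProd _ _ (norm_exp_ofReal_mul_I θ).le]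
    rw [this, conj_re]
  have hInt' : IntervalIntegrable (fun θ => (G θ).re) volume 0 (2 * Real.pi) :=
    ⟨hInt.1.re, hInt.2.re⟩
  have hre : ∫ θ in (0 : ℝ)..2 * Real.pi, (G θ).re = 0 := by
    have := Complex.reCLM.intervalIntegral_comp_comm hInt
    simp only [Complex.reCLM_apply] at this
    rw [this, hzero, zero_re]
  have hsub : ∀ a b : ℝ, a ∈ Set.Icc 0 (2 * Real.pi) → b ∈ Set.Icc 0 (2 * Real.pi) →
      IntervalIntegrable (fun θ => (G θ).re) volume a b := by
    intro a b ha hb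
    refine hInt'.mono_set ?_
    rw [Set.uIcc_of_le Real.two_pi_pos.le]
    exact Set.uIcc_subset_Icc ha hb
  have hπ := Real.pi_pos
  have hhalf : ∫ θ in (0 : ℝ)..Real.pi, (G θ).re = 0 := by
    rw [← intervalIntegral.integral_add_adjacent_intervals (b := Real.pi)
      (hsub _ _ ⟨le_rfl, by linarith⟩ ⟨by linarith, by linarith⟩)
      (hsub _ _ ⟨by linarith, by linarith⟩ ⟨by linarith, by linarith⟩)] at hre
    have h2 : ∫ θ in Real.pi..2 * Real.pi, (G θ).re = ∫ θ in (0 : ℝ)..Real.pi, (G θ).re := by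
      have := intervalIntegral.integral_comp_sub_left (a := 0) (b := Real.pi)
        (fun θ => (G θ).re) (2 * Real.pi)
      simp only [hsymm] at this
      rw [this]
      congr 1 <;> ring
    rw [h2] at hre
    linarith
  have hmem : ∀ i ≤ 2 * ℓ + 1, t i ∈ Set.Icc 0 (2 * Real.pi) := fun i hi =>
    ⟨h.nonneg hi, (h.le_pi hi).trans (by linarith)⟩
  have hsum := intervalIntegral.sum_integral_adjacent_intervals (μ := volume) (a := t)
    (n := 2 * ℓ + 1) (f := fun θ => (G θ).re)
    (fun k hk => hsub _ _ (hmem k (by omega)) (hmem (k + 1) (by omega)))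
  rw [h.zero, h.last, hhalf] at hsum
  have hterm : ∀ i ∈ range (2 * ℓ + 1), ∫ θ in t i..t (i + 1), (G θ).re =
      (2 ^ ℓ)⁻¹ * ((I ^ i).re * ∫ θ in t i..t (i + 1),
        (chebPoly (ℓ + n) B).eval (Real.cos θ) * weight ℓ t θ) := by
    intro i hi
    rw [Finset.mem_range] at hi
    have hi' : i ≤ 2 * ℓ := by omega
    rw [← mul_assoc, ← intervalIntegral.integral_const_mul]
    refine intervalIntegral.integral_congr_Ioo_of_le (h.lt i hi').le fun θ hθ => ?_
    have hw := (h.weight_pos hi' hθ).ne'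
    have hw' : (weight ℓ t θ : ℂ) ≠ 0 := ofReal_ne_zero.2 hw
    have hGe : G θ = I ^ i * (((2 ^ ℓ)⁻¹ * ((chebPoly (ℓ + n) B).eval (Real.cos θ) *
        weight ℓ t θ) : ℝ) : ℂ) := by
      simp only [hG]
      rw [exp_mul_chebPoly, h.sqrtProd_exp hi' hθ]
      have he := Complex.exp_ne_zero (θ * I)
      have hI : (-I) ^ i * I ^ i = 1 := by
        rw [← mul_pow]; simp
      have hI0 : (-I) ^ i ≠ 0 := pow_ne_zero _ (neg_ne_zero.2 I_ne_zero)
      push_cast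
      generalize exp (θ * I) = E at *
      generalize (weight ℓ t θ : ℂ) = W at *
      generalize (-I) ^ i = J at *
      rw [pow_add]
      field_simp
      linear_combination (-(((chebPoly (ℓ + n) B).eval (Real.cos θ) : ℝ) : ℂ)) * hI
    simp only [hGe]
    rw [mul_comm (I ^ i), re_ofReal_mul]
    ring
  rw [Finset.sum_congr rfl hterm, ← Finset.mul_sum] at hsum
  exact (mul_eq_zero.1 hsum).resolve_left (by positivity)

/-- The descending half of the palindrome starts at order k + 3 ≥ 3, so only the ascending half
reaches the first three Taylor coefficients. -/
lemma palindrome_expansion (k : ℕ) (B : Fin (k + 2 + 1) → ℝ) :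
    ∃ N : ℂ → ℂ, Differentiable ℂ N ∧ ∀ u, palindrome (k + 2) B u =
      B 0 + B 1 * u + B 2 * u ^ 2 + u ^ 3 * N u := by
  -- The truncated exponent `2 * (k + 2) - j - 3` is a true difference because j ≤ k + 1.
  refine ⟨fun u => ∑ j : Fin (k + 2), (B j.castSucc : ℂ) * u ^ (2 * (k + 2) - (j : ℕ) - 3) +
    ∑ i : Fin k, (B i.succ.succ.succ : ℂ) * u ^ (i : ℕ), by fun_prop, fun u => ?_⟩
  have h1 : ∑ j : Fin (k + 2), (B j.castSucc : ℂ) * u ^ (2 * (k + 2) - (j : ℕ)) =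
      u ^ 3 * ∑ j : Fin (k + 2), (B j.castSucc : ℂ) * u ^ (2 * (k + 2) - (j : ℕ) - 3) := by
    rw [Finset.mul_sum]
    refine Finset.sum_congr rfl fun j _ => ?_
    have : 2 * (k + 2) - (j : ℕ) = (2 * (k + 2) - (j : ℕ) - 3) + 3 := by
      have := j.2; omega
    nth_rw 1 [this]
    rw [pow_add]
    ring
  have h2 : ∑ j : Fin (k + 2), (B j.castSucc : ℂ) * u ^ (j : ℕ) +
      (B (Fin.last (k + 2)) : ℂ) * u ^ (k + 2) =
      B 0 + B 1 * u + B 2 * u ^ 2 +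
        u ^ 3 * ∑ i : Fin k, (B i.succ.succ.succ : ℂ) * u ^ (i : ℕ) := by
    have e := Fin.sum_univ_castSucc (fun i : Fin (k + 2 + 1) => (B i : ℂ) * u ^ (i : ℕ))
    simp only [Fin.val_castSucc, Fin.val_last] at e
    rw [← e, Fin.sum_univ_succ, Fin.sum_univ_succ, Fin.sum_univ_succ, Finset.mul_sum]
    have s1 : (Fin.succ 0 : Fin (k + 2 + 1)) = 1 := rfl
    have s2 : (Fin.succ (Fin.succ 0) : Fin (k + 2 + 1)) = 2 := rfl
    rw [s2, s1]
    simp only [Fin.val_succ]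
    have : ∀ i : Fin k, (B i.succ.succ.succ : ℂ) * u ^ ((i : ℕ) + 1 + 1 + 1) =
        u ^ 3 * ((B i.succ.succ.succ : ℂ) * u ^ (i : ℕ)) := fun i => by ring
    simp_rw [this]
    have v2 : ((2 : Fin (k + 2 + 1)) : ℕ) = 2 := rfl
    have v1 : ((1 : Fin (k + 2 + 1)) : ℕ) = 1 := rfl
    rw [v1, v2, Fin.val_zero]
    ring
  rw [palindrome, add_assoc, h2, h1]
  ring

lemma prod_quadratic_expansion (c : ℕ → ℝ) (n : ℕ) :
    ∃ N : ℂ → ℂ, Differentiable ℂ N ∧ ∀ u : ℂ, ∏ j ∈ Icc 1 n, (1 - 2 * (c j : ℂ) * u + u ^ 2) =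
      1 - 2 * ((∑ j ∈ Icc 1 n, c j : ℝ) : ℂ) * u +
        ((n + 2 * ((∑ j ∈ Icc 1 n, c j) ^ 2 - ∑ j ∈ Icc 1 n, c j ^ 2) : ℝ) : ℂ) * u ^ 2 +
        u ^ 3 * N u := by
  induction n with
  | zero => exact ⟨0, by fun_prop, by simp⟩
  | succ n ih =>
    obtain ⟨N, hN, h⟩ := ih
    set S := ∑ j ∈ Icc 1 n, c j
    set Q := ∑ j ∈ Icc 1 n, c j ^ 2
    refine ⟨fun u => N u * (1 - 2 * c (n + 1) * u + u ^ 2) - 2 * S +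
      (n + 2 * (S ^ 2 - Q)) * (-2 * c (n + 1) + u), by fun_prop, fun u => ?_⟩
    have e1 : ∑ j ∈ Icc 1 (n + 1), c j = S + c (n + 1) := Finset.sum_Icc_succ_top (by omega) _
    have e2 : ∑ j ∈ Icc 1 (n + 1), c j ^ 2 = Q + c (n + 1) ^ 2 :=
      Finset.sum_Icc_succ_top (by omega) _
    rw [Finset.prod_Icc_succ_top (by omega), e1, e2, h]
    clear_value S Q
    push_cast
    ring

/-- In the alternating sum every term but the one for the arc from 1 to the first endpoint is
already zero. -/
lemma IsNodes.integral_first_gap {ℓ : ℕ} {t : ℕ → ℝ} {g : ℝ → ℝ}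
    (hsum : ∑ i ∈ range (2 * ℓ + 1), (I ^ i).re * ∫ θ in t i..t (i + 1), g θ = 0)
    (hgap : ∀ k ∈ Set.Icc 1 ℓ, ∫ θ in t (2 * k)..t (2 * k + 1), g θ = 0) :
    ∀ k ≤ ℓ, ∫ θ in t (2 * k)..t (2 * k + 1), g θ = 0 := by
  intro k hk
  rcases Nat.eq_zero_or_pos k with rfl | hk0
  · rw [Finset.sum_eq_single 0] at hsum
    · simpa using hsum
    · intro i hi hi0
      rw [Finset.mem_range] at hi
      rcases Nat.even_or_odd' i with ⟨j, rfl | rfl⟩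
      · rw [hgap j ⟨by omega, by omega⟩, mul_zero]
      · have : (I ^ (2 * j + 1)).re = 0 := by
          rw [pow_succ, pow_mul, I_sq]
          rcases neg_one_pow_eq_or ℂ j with h | h <;> simp [h]
        rw [this, zero_mul]
    · simp
  · exact hgap k ⟨hk0, hk⟩

/-- The residue condition for the first differential makes the remaining gap integral vanish. -/
lemma IsNodes.gap_integrals_first {ℓ : ℕ} (hℓ : 1 ≤ ℓ) {t : ℕ → ℝ} (h : IsNodes ℓ t)
    {B : Fin (ℓ + 1 + 1) → ℝ} (h0 : B 0 = 1) (h1 : B 1 = -∑ j ∈ Icc 1 (2 * ℓ), Real.cos (t j))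
    (hgap : ∀ k ∈ Set.Icc 1 ℓ, ∫ θ in t (2 * k)..t (2 * k + 1),
      (chebPoly (ℓ + 1) B).eval (Real.cos θ) * weight ℓ t θ = 0) :
    ∀ k ≤ ℓ, ∫ θ in t (2 * k)..t (2 * k + 1),
      (chebPoly (ℓ + 1) B).eval (Real.cos θ) * weight ℓ t θ = 0 := by
  refine IsNodes.integral_first_gap ?_ hgap
  obtain ⟨k, rfl⟩ : ∃ k, ℓ = k + 1 := ⟨ℓ - 1, by omega⟩
  obtain ⟨N₁, hN₁, e₁⟩ := palindrome_expansion k B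
  obtain ⟨N₂, hN₂, e₂⟩ := prod_quadratic_expansion (fun j => Real.cos (t j)) (2 * (k + 1))
  set S := ∑ j ∈ Icc 1 (2 * (k + 1)), Real.cos (t j)
  set Q := ∑ j ∈ Icc 1 (2 * (k + 1)), Real.cos (t j) ^ 2
  have h1' : (B 1 : ℂ) = -(S : ℂ) := by rw [h1]; push_cast; rfl
  have h0' : (B 0 : ℂ) = 1 := by rw [h0]; simp
  -- The witness is the square of the expansion minus the product, divided by u². The terms of order
  -- 0 and 1 cancel: `B 1 = -S` matches -2S in the product.
  refine h.sum_integral_eq_zero le_rfl (B := B) (N := fun u =>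
    S ^ 2 + 2 * B 2 - (((2 * (k + 1) : ℕ) + 2 * (S ^ 2 - Q) : ℝ) : ℂ) +
      u * (2 * N₁ u - 2 * S * B 2 + B 2 ^ 2 * u - 2 * S * u * N₁ u + 2 * B 2 * u ^ 2 * N₁ u +
        u ^ 3 * N₁ u ^ 2 - N₂ u)) ?_ (by fun_prop) fun u => ?_
  · exact (e₁ 0).trans (by simp [h0'])
  · rw [e₂ u, show palindrome (k + 1 + 1) B u = _ from e₁ u, h0', h1']
    push_cast
    ring

/-- The residue condition for the second differential makes the remaining gap integral vanish. -/
lemma IsNodes.gap_integrals_second {ℓ : ℕ} {t : ℕ → ℝ} (h : IsNodes ℓ t)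
    {B : Fin (ℓ + 2 + 1) → ℝ} (h0 : B 0 = 1) (h1 : B 1 = -∑ j ∈ Icc 1 (2 * ℓ), Real.cos (t j))
    (h2 : B 2 = (∑ j ∈ Icc 1 (2 * ℓ), Real.cos (t j)) ^ 2 / 2 -
      ∑ j ∈ Icc 1 (2 * ℓ), Real.cos (t j) ^ 2 + ℓ)
    (hgap : ∀ k ∈ Set.Icc 1 ℓ, ∫ θ in t (2 * k)..t (2 * k + 1),
      (chebPoly (ℓ + 2) B).eval (Real.cos θ) * weight ℓ t θ = 0) :
    ∀ k ≤ ℓ, ∫ θ in t (2 * k)..t (2 * k + 1),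
      (chebPoly (ℓ + 2) B).eval (Real.cos θ) * weight ℓ t θ = 0 := by
  refine IsNodes.integral_first_gap ?_ hgap
  obtain ⟨N₁, hN₁, e₁⟩ := palindrome_expansion ℓ B
  obtain ⟨N₂, hN₂, e₂⟩ := prod_quadratic_expansion (fun j => Real.cos (t j)) (2 * ℓ)
  set S := ∑ j ∈ Icc 1 (2 * ℓ), Real.cos (t j)
  set Q := ∑ j ∈ Icc 1 (2 * ℓ), Real.cos (t j) ^ 2
  have h1' : (B 1 : ℂ) = -(S : ℂ) := by rw [h1]; push_cast; rfl
  have h0' : (B 0 : ℂ) = 1 := by rw [h0]; simp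
  have h2' : (B 2 : ℂ) = (S : ℂ) ^ 2 / 2 - Q + ℓ := by rw [h2]; push_cast; rfl
  -- Here the division is by u³: the value of `B 2` is the one for which the terms of order 2 cancel
  -- as well.
  refine h.sum_integral_eq_zero one_le_two (B := B) (N := fun u =>
      (2 * N₁ u - 2 * S * B 2 + B 2 ^ 2 * u - 2 * S * u * N₁ u + 2 * B 2 * u ^ 2 * N₁ u +
        u ^ 3 * N₁ u ^ 2 - N₂ u)) ?_ (by fun_prop) fun u => ?_
  · exact (e₁ 0).trans (by simp [h0'])
  · rw [e₂ u, e₁ u, h0', h1', h2']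
    push_cast
    ring

end DarkGas

/-! ### Vanishing gap integrals and root counting -/

namespace DarkGas

open Finset MeasureTheory Filter Topology Polynomial

/-- The integral of `p(cos θ)` over the `k`-th gap against `weight`. -/
noncomputable def gapIntegral (ℓ : ℕ) (t : ℕ → ℝ) (p : ℝ[X]) (k : ℕ) : ℝ :=
  ∫ θ in t (2 * k)..t (2 * k + 1), p.eval (Real.cos θ) * weight ℓ t θ

/-- The image of the `k`-th open gap under `cos`. -/
def cosGap (t : ℕ → ℝ) (k : ℕ) : Set ℝ :=
  Set.Ioo (Real.cos (t (2 * k + 1))) (Real.cos (t (2 * k)))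

lemma pos_or_neg_of_ne_zero {g : ℝ → ℝ} (hg : Continuous g) {a b : ℝ}
    (hne : ∀ x ∈ Set.Ioo a b, g x ≠ 0) :
    (∀ x ∈ Set.Ioo a b, 0 < g x) ∨ ∀ x ∈ Set.Ioo a b, g x < 0 := by
  by_contra! hcon
  obtain ⟨⟨x, hx, hgx⟩, ⟨y, hy, hgy⟩⟩ := hcon
  obtain ⟨z, hz, h0⟩ := isPreconnected_Ioo.intermediate_value hx hy hg.continuousOn ⟨hgx, hgy⟩
  exact hne z hz h0

lemma card_le_natDegree {p : ℝ[X]} (hp : p ≠ 0) {s : Finset ℝ} (hs : ∀ x ∈ s, p.eval x = 0) :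
    s.card ≤ p.natDegree :=
  card_le_degree_of_subset_roots fun x hx => (mem_roots hp).2 (hs x hx)

namespace IsNodes

variable {ℓ : ℕ} {t : ℕ → ℝ}

lemma cos_mem_cosGap (h : IsNodes ℓ t) {k : ℕ} (hk : k ≤ ℓ) {θ : ℝ}
    (hθ : θ ∈ Set.Ioo (t (2 * k)) (t (2 * k + 1))) : Real.cos θ ∈ cosGap t k := by
  have h1 := h.nonneg (show 2 * k ≤ 2 * ℓ + 1 by omega)
  have h2 := h.le_pi (show 2 * k + 1 ≤ 2 * ℓ + 1 by omega)
  exact ⟨Real.cos_lt_cos_of_nonneg_of_le_pi (h1.trans hθ.1.le) h2 hθ.2,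
    Real.cos_lt_cos_of_nonneg_of_le_pi h1 (hθ.2.le.trans h2) hθ.1⟩

lemma exists_angle (h : IsNodes ℓ t) {k : ℕ} (hk : k ≤ ℓ) {x : ℝ} (hx : x ∈ cosGap t k) :
    ∃ θ ∈ Set.Ioo (t (2 * k)) (t (2 * k + 1)), Real.cos θ = x :=
  intermediate_value_Ioo' (h.lt _ (by omega)).le Real.continuous_cos.continuousOn hx

lemma integral_pos (h : IsNodes ℓ t) {g : ℝ → ℝ} (hg : Continuous g) {k : ℕ} (hk : k ≤ ℓ) {a b : ℝ}
    (ha : t (2 * k) ≤ a) (hab : a < b) (hb : b ≤ t (2 * k + 1))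
    (hpos : ∀ θ ∈ Set.Ioo a b, 0 < g θ) : 0 < ∫ θ in a..b, g θ * weight ℓ t θ := by
  have h1 := h.nonneg (show 2 * k ≤ 2 * ℓ + 1 by omega)
  have h2 := h.le_pi (show 2 * k + 1 ≤ 2 * ℓ + 1 by omega)
  refine intervalIntegral.intervalIntegral_pos_of_pos_on
    (h.intervalIntegrable_mul_weight hg ⟨by linarith, by linarith⟩ ⟨by linarith, by linarith⟩)
    (fun θ hθ => mul_pos (hpos θ hθ) (h.weight_pos (i := 2 * k) (by omega)
      ⟨by linarith [hθ.1], by linarith [hθ.2]⟩)) hab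

/-- The weight is positive on the open gap, so an integrand without zeros there could not integrate
to 0. -/
lemma exists_root (h : IsNodes ℓ t) {p : ℝ[X]} {k : ℕ} (hk : k ≤ ℓ) (h0 : gapIntegral ℓ t p k = 0) :
    ∃ x ∈ cosGap t k, p.eval x = 0 := by
  by_contra! hcon
  have hlt := h.lt (2 * k) (by omega)
  rcases pos_or_neg_of_ne_zero (continuous_eval_cos p) (a := t (2 * k)) (b := t (2 * k + 1))
    (fun θ hθ => hcon _ (h.cos_mem_cosGap hk hθ)) with hs | hs
  · exact (h.integral_pos (continuous_eval_cos p) hk le_rfl hlt le_rfl hs).ne' h0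
  · have := h.integral_pos (g := fun θ => -p.eval (Real.cos θ))
      (continuous_eval_cos p).neg hk le_rfl hlt le_rfl
      (fun θ hθ => neg_pos.2 (hs θ hθ))
    simp only [neg_mul, intervalIntegral.integral_neg] at this
    rw [gapIntegral] at h0
    linarith

/-- A squared factor does not change sign, so the sign argument of `exists_root` applies to the
cofactor. The integral is split at the root of the square, where strict positivity fails. -/
lemma exists_root_of_double (h : IsNodes ℓ t)
    {g : ℝ[X]} {k : ℕ} (hk : k ≤ ℓ) {x₀ : ℝ} (hx₀ : x₀ ∈ cosGap t k)
    (h0 : gapIntegral ℓ t ((X - C x₀) ^ 2 * g) k = 0) : ∃ x ∈ cosGap t k, g.eval x = 0 := by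
  by_contra! hcon
  obtain ⟨θ₀, hθ₀, rfl⟩ := h.exists_angle hk hx₀
  have h1 := h.nonneg (show 2 * k ≤ 2 * ℓ + 1 by omega)
  have h2 := h.le_pi (show 2 * k + 1 ≤ 2 * ℓ + 1 by omega)
  have hpos : ∀ g : ℝ[X], (∀ θ ∈ Set.Ioo (t (2 * k)) (t (2 * k + 1)), 0 < g.eval (Real.cos θ)) →
      0 < gapIntegral ℓ t ((X - C (Real.cos θ₀)) ^ 2 * g) k := by
    intro g hg
    have hc := continuous_eval_cos ((X - C (Real.cos θ₀)) ^ 2 * g)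
    have hp : ∀ θ ∈ Set.Ioo (t (2 * k)) (t (2 * k + 1)), θ ≠ θ₀ →
        0 < ((X - C (Real.cos θ₀)) ^ 2 * g).eval (Real.cos θ) := by
      intro θ hθ hne
      rw [eval_mul, eval_pow, eval_sub, eval_X, eval_C]
      refine mul_pos (sq_pos_of_ne_zero ?_) (hg θ hθ)
      rw [sub_ne_zero]
      exact fun e => hne (Real.injOn_cos ⟨h1.trans hθ.1.le, hθ.2.le.trans h2⟩
        ⟨h1.trans hθ₀.1.le, hθ₀.2.le.trans h2⟩ e)
    have i1 := h.integral_pos hc hk le_rfl hθ₀.1 hθ₀.2.le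
      (fun θ hθ => hp θ ⟨hθ.1, hθ.2.trans hθ₀.2⟩ hθ.2.ne)
    have i2 := h.integral_pos hc hk hθ₀.1.le hθ₀.2 le_rfl
      (fun θ hθ => hp θ ⟨hθ₀.1.trans hθ.1, hθ.2⟩ hθ.1.ne')
    rw [gapIntegral, ← intervalIntegral.integral_add_adjacent_intervals (b := θ₀)]
    · exact add_pos i1 i2
    · exact h.intervalIntegrable_mul_weight hc (h.mem_Icc (by omega))
        ⟨by linarith [hθ₀.1], by linarith [hθ₀.2]⟩
    · exact h.intervalIntegrable_mul_weight hc
        ⟨by linarith [hθ₀.1], by linarith [hθ₀.2]⟩ (h.mem_Icc (by omega))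
  rcases pos_or_neg_of_ne_zero (continuous_eval_cos g) (a := t (2 * k)) (b := t (2 * k + 1))
    (fun θ hθ => hcon _ (h.cos_mem_cosGap hk hθ)) with hs | hs
  · exact (hpos g hs).ne' h0
  · have := hpos (-g) (fun θ hθ => by rw [eval_neg]; exact neg_pos.2 (hs θ hθ))
    rw [gapIntegral] at h0 this
    simp only [mul_neg, eval_neg, neg_mul, intervalIntegral.integral_neg] at this
    linarith

lemma cosGap_lt (h : IsNodes ℓ t)
    {j k : ℕ} (hjk : j < k) (hk : k ≤ ℓ) {x y : ℝ} (hx : x ∈ cosGap t j)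
    (hy : y ∈ cosGap t k) : y < x := by
  have h1 := h.le_of_le (show 2 * j + 1 ≤ 2 * k by omega) (by omega)
  have h2 := Real.cos_le_cos_of_nonneg_of_le_pi (h.nonneg (show 2 * j + 1 ≤ 2 * ℓ + 1 by omega))
    (h.le_pi (show 2 * k ≤ 2 * ℓ + 1 by omega)) h1
  linarith [hx.1, hy.2]

lemma exists_roots_finset (h : IsNodes ℓ t) {p : ℝ[X]} {K : Finset ℕ} (hK : ∀ k ∈ K, k ≤ ℓ)
    (hr : ∀ k ∈ K, ∃ x ∈ cosGap t k, p.eval x = 0) :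
    ∃ s : Finset ℝ, s.card = K.card ∧ ∀ x ∈ s, p.eval x = 0 ∧ ∃ k ∈ K, x ∈ cosGap t k := by
  choose! x hx using hr
  refine ⟨K.image x, Finset.card_image_of_injOn ?_, ?_⟩
  · intro i hi j hj hij
    rcases lt_trichotomy i j with hlt | heq | hlt
    · exact absurd hij (h.cosGap_lt hlt (hK j hj) (hx i hi).1 (hx j hj).1).ne'
    · exact heq
    · exact absurd hij (h.cosGap_lt hlt (hK i hi) (hx j hj).1 (hx i hi).1).ne
  · intro y hy
    obtain ⟨k, hk, rfl⟩ := Finset.mem_image.1 hy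
    exact ⟨(hx k hk).2, k, hk, (hx k hk).1⟩

/-- The ℓ gaps have disjoint images under cos, which forces ℓ distinct roots on a polynomial of
degree less than ℓ. -/
lemma eq_zero_of_gapIntegral (h : IsNodes ℓ t) {p : ℝ[X]} (hd : p.natDegree < ℓ)
    (h0 : ∀ k ∈ Finset.Icc 1 ℓ, gapIntegral ℓ t p k = 0) : p = 0 := by
  by_contra hp
  obtain ⟨s, hs, hroot⟩ := h.exists_roots_finset (p := p) (K := Finset.Icc 1 ℓ)
    (fun k hk => (Finset.mem_Icc.1 hk).2)
    (fun k hk => h.exists_root (Finset.mem_Icc.1 hk).2 (h0 k hk))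
  have := card_le_natDegree hp fun x hx => (hroot x hx).1
  rw [hs, Nat.card_Icc] at this
  omega

/-- Dividing out a double root leaves degree at most ℓ, yet the quotient still has a root in each of
the ℓ + 1 gaps, including the gap of the double root. The additional gap is what makes this count
succeed. -/
lemma derivative_ne_zero_of_root (h : IsNodes ℓ t)
    {f : ℝ[X]} (hf : f ≠ 0) (hd : f.natDegree ≤ ℓ + 2)
    (h0 : ∀ k ≤ ℓ, gapIntegral ℓ t f k = 0) {k : ℕ} (hk : k ≤ ℓ) {x₀ : ℝ} (hx₀ : x₀ ∈ cosGap t k)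
    (hr : f.eval x₀ = 0) : (derivative f).eval x₀ ≠ 0 := by
  intro hr'
  have hm : 1 < f.rootMultiplicity x₀ := (one_lt_rootMultiplicity_iff_isRoot hf).2 ⟨hr, hr'⟩
  obtain ⟨g, hg⟩ := (le_rootMultiplicity_iff hf).1 (show 2 ≤ f.rootMultiplicity x₀ from hm)
  have hg0 : g ≠ 0 := by rintro rfl; exact hf (by rw [hg, mul_zero])
  have hdeg : f.natDegree = 2 + g.natDegree := by
    rw [hg, natDegree_mul (pow_ne_zero _ (X_sub_C_ne_zero _)) hg0, natDegree_pow, natDegree_X_sub_C]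
  obtain ⟨s, hs, hroot⟩ := h.exists_roots_finset (p := g) (K := Finset.range (ℓ + 1))
    (fun j hj => by rw [Finset.mem_range] at hj; omega) (fun j hj => by
      have hj' : j ≤ ℓ := by rw [Finset.mem_range] at hj; omega
      rcases eq_or_ne j k with rfl | hjk
      · exact h.exists_root_of_double hj' hx₀ (by rw [← hg]; exact h0 _ hj')
      · obtain ⟨x, hx, hxr⟩ := h.exists_root hj' (h0 j hj')
        refine ⟨x, hx, ?_⟩
        rw [hg, eval_mul, eval_pow, eval_sub, eval_X, eval_C] at hxr
        refine (mul_eq_zero.1 hxr).resolve_left (pow_ne_zero _ (sub_ne_zero.2 ?_))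
        rintro rfl
        rcases lt_or_gt_of_ne hjk with hlt | hlt
        · exact (h.cosGap_lt hlt hk hx hx₀).ne rfl
        · exact (h.cosGap_lt hlt hj' hx₀ hx).ne rfl)
  have := card_le_natDegree hg0 fun x hx => (hroot x hx).1
  rw [hs, Finset.card_range] at this
  omega

end IsNodes

lemma hasDerivAt_div {P Q : ℝ[X]} {x : ℝ} (hP : P.eval x ≠ 0) :
    HasDerivAt (fun x => Q.eval x / P.eval x)
      (((derivative Q).eval x * P.eval x - Q.eval x * (derivative P).eval x) / P.eval x ^ 2) x :=
  (Q.hasDerivAt x).div (P.hasDerivAt x) hP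

lemma strictMonoOn_div {P Q : ℝ[X]} {s : Set ℝ} (hs : Convex ℝ s) (hP : ∀ x ∈ s, P.eval x ≠ 0)
    (hW : ∀ x ∈ interior s,
      0 < (derivative Q).eval x * P.eval x - Q.eval x * (derivative P).eval x) :
    StrictMonoOn (fun x => Q.eval x / P.eval x) s := by
  refine strictMonoOn_of_deriv_pos hs
    (fun x hx => (hasDerivAt_div (hP x hx)).continuousAt.continuousWithinAt) fun x hx => ?_
  have hPx := hP x (interior_subset hx)
  rw [(hasDerivAt_div hPx).deriv]
  exact div_pos (hW x hx) (sq_pos_of_ne_zero hPx)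

end DarkGas

/-! ### The pencil spanned by p and q, and its Wronskian -/

namespace DarkGas

open Finset MeasureTheory Filter Topology Polynomial

lemma gapIntegral_mul_add_mul {ℓ : ℕ} {t : ℕ → ℝ} (h : IsNodes ℓ t) (a b : ℝ) (p q : ℝ[X]) {k : ℕ}
    (hk : k ≤ ℓ) : gapIntegral ℓ t (C a * p + C b * q) k =
      a * gapIntegral ℓ t p k + b * gapIntegral ℓ t q k := by
  have hi : ∀ p : ℝ[X], IntervalIntegrable (fun θ => p.eval (Real.cos θ) * weight ℓ t θ) volume
      (t (2 * k)) (t (2 * k + 1)) := fun p =>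
    h.intervalIntegrable_mul_weight (continuous_eval_cos p) (h.mem_Icc (by omega))
      (h.mem_Icc (by omega))
  simp only [gapIntegral]
  rw [← intervalIntegral.integral_const_mul, ← intervalIntegral.integral_const_mul,
    ← intervalIntegral.integral_add ((hi p).const_mul a) ((hi q).const_mul b)]
  congr 1
  funext θ
  simp only [eval_add, eval_mul, eval_C]
  ring

/-- The numerators of the two differentials, as polynomials in `cos θ`. -/
structure IsPencil (ℓ : ℕ) (t : ℕ → ℝ) (p q : ℝ[X]) : Prop where
  nodes : IsNodes ℓ t
  natDegree_left : p.natDegree = ℓ + 1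
  natDegree_right : q.natDegree = ℓ + 2
  leadingCoeff_left : 0 < p.leadingCoeff
  leadingCoeff_right : 0 < q.leadingCoeff
  gap_left : ∀ k ≤ ℓ, gapIntegral ℓ t p k = 0
  gap_right : ∀ k ≤ ℓ, gapIntegral ℓ t q k = 0

namespace IsPencil

variable {ℓ : ℕ} {t : ℕ → ℝ} {p q : ℝ[X]}

lemma coeff_left (H : IsPencil ℓ t p q) : 0 < p.coeff (ℓ + 1) := by
  have := H.leadingCoeff_left
  rwa [leadingCoeff, H.natDegree_left] at this

lemma coeff_right (H : IsPencil ℓ t p q) : 0 < q.coeff (ℓ + 2) := by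
  have := H.leadingCoeff_right
  rwa [leadingCoeff, H.natDegree_right] at this

lemma coeff_comb (H : IsPencil ℓ t p q)
    (a b : ℝ) : (C a * p + C b * q).coeff (ℓ + 2) = b * q.coeff (ℓ + 2) := by
  rw [coeff_add, coeff_C_mul, coeff_C_mul, coeff_eq_zero_of_natDegree_lt (p := p)
    (by rw [H.natDegree_left]; omega)]
  ring

lemma comb_ne_zero (H : IsPencil ℓ t p q)
    {a b : ℝ} (hab : a ≠ 0 ∨ b ≠ 0) : C a * p + C b * q ≠ 0 := by
  intro h0
  have h2 := H.coeff_comb a b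
  rw [h0, coeff_zero] at h2
  have hb : b = 0 := by
    rcases mul_eq_zero.1 h2.symm with h | h
    · exact h
    · exact absurd h H.coeff_right.ne'
  subst hb
  have h1 := congrArg (fun f => f.coeff (ℓ + 1)) h0
  simp only [map_zero, zero_mul, add_zero, coeff_C_mul, coeff_zero] at h1
  rcases mul_eq_zero.1 h1 with h | h
  · simp [h] at hab
  · exact H.coeff_left.ne' h

lemma natDegree_comb_le (H : IsPencil ℓ t p q)
    (a b : ℝ) : (C a * p + C b * q).natDegree ≤ ℓ + 2 := by
  refine natDegree_add_le_of_degree_le ((natDegree_C_mul_le _ _).trans ?_)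
    ((natDegree_C_mul_le _ _).trans H.natDegree_right.le)
  rw [H.natDegree_left]; omega

lemma gap_comb (H : IsPencil ℓ t p q)
    (a b : ℝ) : ∀ k ≤ ℓ, gapIntegral ℓ t (C a * p + C b * q) k = 0 := fun k hk => by
  rw [gapIntegral_mul_add_mul H.nodes a b p q hk, H.gap_left k hk, H.gap_right k hk]; simp

/-- A zero of the Wronskian at x gives a nontrivial combination of p and q that vanishes at x
together with its derivative, contrary to the simplicity of roots in gaps. -/
lemma wronskian_ne_zero (H : IsPencil ℓ t p q) {x : ℝ} (hx : x ∈ cosGap t ℓ) :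
    (derivative q).eval x * p.eval x - q.eval x * (derivative p).eval x ≠ 0 := by
  have key : ∀ a b : ℝ, (a ≠ 0 ∨ b ≠ 0) → a * p.eval x + b * q.eval x = 0 →
      a * (derivative p).eval x + b * (derivative q).eval x ≠ 0 := by
    intro a b hab h0
    have := H.nodes.derivative_ne_zero_of_root (H.comb_ne_zero hab) (H.natDegree_comb_le a b)
      (H.gap_comb a b) le_rfl hx (by simpa using h0)
    simpa using this
  intro hW
  -- The combination q(x)p - p(x)q serves unless both values vanish; then every combination vanishes
  -- at x, and q'(x)p - p'(x)q serves, since p'(x) ≠ 0.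
  by_cases hpq : q.eval x ≠ 0 ∨ -p.eval x ≠ 0
  · exact key _ _ hpq (by ring) (by linear_combination -hW)
  · push Not at hpq
    have hp : p.eval x = 0 := neg_eq_zero.1 hpq.2
    have hd : (derivative p).eval x ≠ 0 := by
      simpa using key 1 0 (Or.inl one_ne_zero) (by simp [hp])
    exact key ((derivative q).eval x) (-(derivative p).eval x)
      (Or.inr (neg_ne_zero.2 hd)) (by rw [hp, hpq.1]; ring) (by ring)

lemma cos_last (H : IsPencil ℓ t p q) : cosGap t ℓ = Set.Ioo (-1) (Real.cos (t (2 * ℓ))) := by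
  rw [cosGap, H.nodes.last, Real.cos_pi]

/-- The polynomial `(-1)^ℓ p` changes sign exactly once on `(-∞, cos t_{2ℓ}]`. -/
lemma exists_factor (H : IsPencil ℓ t p q) : ∃ x₀ ∈ cosGap t ℓ, ∃ D : ℝ[X],
    (∀ y ≤ Real.cos (t (2 * ℓ)), 0 < D.eval y) ∧ C ((-1) ^ ℓ) * p = D * (X - C x₀) := by
  have hr : ∀ k, ∃ x, k ≤ ℓ → x ∈ cosGap t k ∧ p.eval x = 0 := fun k => by
    by_cases hk : k ≤ ℓ
    · obtain ⟨x, hx⟩ := H.nodes.exists_root hk (H.gap_left k hk)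
      exact ⟨x, fun _ => hx⟩
    · exact ⟨0, fun h => absurd h hk⟩
  choose x hx using hr
  have hp0 : p ≠ 0 := by
    intro h0
    have := H.coeff_left
    rw [h0, coeff_zero] at this
    exact lt_irrefl _ this
  have hinj : Set.InjOn x (range (ℓ + 1)) := by
    intro i hi j hj hij
    have hi' : i ≤ ℓ := by simpa [Nat.lt_succ_iff] using hi
    have hj' : j ≤ ℓ := by simpa [Nat.lt_succ_iff] using hj
    rcases lt_trichotomy i j with hlt | heq | hlt
    · exact absurd hij (H.nodes.cosGap_lt hlt hj' (hx i hi').1 (hx j hj').1).ne'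
    · exact heq
    · exact absurd hij (H.nodes.cosGap_lt hlt hi' (hx j hj').1 (hx i hi').1).ne
  -- One root per gap already exhausts the degree ℓ + 1, so there are no other roots and all are
  -- simple.
  have hZ : ((range (ℓ + 1)).image x).val = p.roots := by
    refine Multiset.eq_of_le_of_card_le ?_ ?_
    · refine (Multiset.le_iff_subset (Finset.nodup _)).2 fun y hy => ?_
      obtain ⟨k, hk, rfl⟩ := Finset.mem_image.1 (show y ∈ (range (ℓ + 1)).image x from hy)
      exact (mem_roots hp0).2 (hx k (by rw [Finset.mem_range] at hk; omega)).2
    · refine (card_roots' p).trans ?_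
      rw [H.natDegree_left, Finset.card_val, Finset.card_image_of_injOn hinj, Finset.card_range]
  have hfac : p = C p.leadingCoeff * ∏ k ∈ range (ℓ + 1), (X - C (x k)) := by
    have := C_leadingCoeff_mul_prod_multiset_X_sub_C (p := p) (by
      rw [← hZ, H.natDegree_left, Finset.card_val, Finset.card_image_of_injOn hinj,
        Finset.card_range])
    rw [← hZ] at this
    rw [← Finset.prod_image (s := range (ℓ + 1)) (g := x) (f := fun y => X - C y) hinj]
    exact this.symm
  -- The cofactor is written with factors x_k - y for k < ℓ, each positive because the earlier gaps
  -- lie to the right of cos t_{2ℓ}; reversing the ℓ signs accounts for (-1)^ℓ.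
  refine ⟨x ℓ, (hx ℓ le_rfl).1, C p.leadingCoeff * ∏ k ∈ range ℓ, (C (x k) - X), ?_, ?_⟩
  · intro y hy
    rw [eval_mul, eval_C, eval_prod]
    refine mul_pos H.leadingCoeff_left (Finset.prod_pos fun k hk => ?_)
    rw [Finset.mem_range] at hk
    have h1 := (hx k hk.le).1.1
    have h2 := Real.cos_le_cos_of_nonneg_of_le_pi
      (H.nodes.nonneg (show 2 * k + 1 ≤ 2 * ℓ + 1 by omega))
      (H.nodes.le_pi (show 2 * ℓ ≤ 2 * ℓ + 1 by omega))
      (H.nodes.le_of_le (show 2 * k + 1 ≤ 2 * ℓ by omega) (by omega))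
    rw [eval_sub, eval_C, eval_X, sub_pos]
    linarith
  · nth_rw 1 [hfac]
    rw [Finset.prod_range_succ]
    have : ∏ k ∈ range ℓ, (C (x k) - X) = C ((-1) ^ ℓ) * ∏ k ∈ range ℓ, (X - C (x k)) := by
      have e : ∀ k ∈ range ℓ, C (x k) - X = C (-1) * (X - C (x k)) := fun k _ => by
        rw [map_neg, map_one]; ring
      rw [Finset.prod_congr rfl e, Finset.prod_mul_distrib, Finset.prod_const, Finset.card_range,
        ← C_pow]
    rw [this]
    ring

/-- If `(-1)^ℓ (a p - q)` is positive at `-1`, then it has a root to the left of `-1`. -/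
lemma exists_root_lt_neg_one (H : IsPencil ℓ t p q) {a : ℝ}
    (ha : 0 < (-1) ^ ℓ * (C a * p + C (-1) * q).eval (-1)) :
    ∃ y < -1, (C a * p + C (-1) * q).eval y = 0 := by
  set f := C a * p + C (-1) * q with hf
  -- Reflection turns the behaviour at -∞ into that at +∞; the signs combine so that the leading
  -- coefficient is minus that of q, whatever the parity of ℓ.
  set g := C ((-1) ^ ℓ) * f.comp (-X) with hg
  have hfc : f.coeff (ℓ + 2) = -q.coeff (ℓ + 2) := by rw [hf, H.coeff_comb]; ring
  have hfd : f.natDegree = ℓ + 2 := le_antisymm (H.natDegree_comb_le _ _)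
    (le_natDegree_of_ne_zero (by rw [hfc]; exact neg_ne_zero.2 H.coeff_right.ne'))
  have hσ : ((-1 : ℝ)) ^ ℓ ≠ 0 := pow_ne_zero _ (by norm_num)
  have hsq : ((-1 : ℝ)) ^ ℓ * (-1) ^ ℓ = 1 := by rw [← mul_pow]; norm_num
  have hgl : g.leadingCoeff < 0 := by
    rw [hg, leadingCoeff_mul, leadingCoeff_C, leadingCoeff_comp (by simp), leadingCoeff, hfd, hfc]
    simp only [leadingCoeff_neg, leadingCoeff_X]
    have := H.coeff_right
    rw [pow_add]
    nlinarith
  have hgd : 0 < g.degree := by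
    rw [hg, degree_C_mul hσ]
    refine natDegree_pos_iff_degree_pos.1 ?_
    rw [natDegree_comp, hfd]; simp
  have hlim := g.tendsto_atBot_of_leadingCoeff_nonpos hgd hgl.le
  obtain ⟨M, hM1, hM2⟩ := ((hlim.eventually (eventually_lt_atBot 0)).and
    (eventually_gt_atTop 1)).exists
  have hg1 : 0 < g.eval 1 := by simpa [hg, eval_comp] using ha
  obtain ⟨z, hz, hz0⟩ := intermediate_value_Ioo' hM2.le g.continuous.continuousOn ⟨hM1, hg1⟩
  refine ⟨-z, by linarith [hz.1], ?_⟩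
  have : (-1) ^ ℓ * f.eval (-z) = 0 := by simpa [hg, eval_comp] using hz0
  exact (mul_eq_zero.1 this).resolve_left hσ

/-- The derivative of `q / p` is positive on the last gap, and `q / p` is smaller at its left
end than at its right end. -/
lemma wronskian_pos (H : IsPencil ℓ t p q) {x₀ : ℝ} (hx₀ : x₀ ∈ cosGap t ℓ) {D : ℝ[X]}
    (hD : ∀ y ≤ Real.cos (t (2 * ℓ)), 0 < D.eval y) (hp : C ((-1) ^ ℓ) * p = D * (X - C x₀)) :
    (∀ x ∈ cosGap t ℓ, 0 < (derivative q).eval x * p.eval x - q.eval x * (derivative p).eval x) ∧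
    q.eval (-1) / p.eval (-1) < q.eval (Real.cos (t (2 * ℓ))) / p.eval (Real.cos (t (2 * ℓ))) := by
  set c := Real.cos (t (2 * ℓ)) with hc
  have hgap : cosGap t ℓ = Set.Ioo (-1) c := H.cos_last
  have hσ : ((-1 : ℝ)) ^ ℓ ≠ 0 := pow_ne_zero _ (by norm_num)
  have hpe : ∀ y, (-1) ^ ℓ * p.eval y = D.eval y * (y - x₀) := fun y => by
    have := congrArg (fun f => f.eval y) hp
    simpa using this
  have hx₀' := hx₀
  rw [hgap] at hx₀'
  have hne : ∀ y ≤ c, y ≠ x₀ → p.eval y ≠ 0 := by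
    intro y hy hyx h0
    have := hpe y
    rw [h0, mul_zero] at this
    rcases mul_eq_zero.1 this.symm with h | h
    · exact (hD y hy).ne' h
    · exact hyx (by linarith)
  have hpx₀ : p.eval x₀ = 0 := by
    have := hpe x₀
    rw [sub_self, mul_zero] at this
    exact (mul_eq_zero.1 this).resolve_left hσ
  set v := q.eval c / p.eval c with hv
  have hpc : p.eval c ≠ 0 := hne c le_rfl hx₀'.2.ne'
  -- With v the value of q/p at the endpoint c, this member of the pencil vanishes at c in addition
  -- to its root z inside the gap, so q/p takes the value v at both points.
  set f := C v * p + C (-1) * q with hf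
  have hfe : ∀ y, f.eval y = v * p.eval y - q.eval y := fun y => by simp [hf]; ring
  have hfc : f.eval c = 0 := by rw [hfe, hv, div_mul_cancel₀ _ hpc, sub_self]
  have hf0 : f ≠ 0 := H.comb_ne_zero (Or.inr (by norm_num))
  obtain ⟨z, hz, hzr⟩ := H.nodes.exists_root le_rfl (H.gap_comb v (-1) ℓ le_rfl)
  rw [hgap] at hz
  have hzr' : v * p.eval z - q.eval z = 0 := by rw [← hfe]; exact hzr
  -- Otherwise p and q would vanish together at x₀, and so would the Wronskian.
  have hzx : z ≠ x₀ := by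
    rintro rfl
    have h1 := H.wronskian_ne_zero hx₀
    rw [hpx₀] at hzr' h1
    exact h1 (by linear_combination (derivative p).eval z * hzr')
  have hrz : q.eval z / p.eval z = v := by
    rw [div_eq_iff (hne z hz.2.le hzx)]; linarith
  have hright : ∀ x ∈ Set.Ioc x₀ c, p.eval x ≠ 0 := fun x hx => hne x hx.2 hx.1.ne'
  have hleft : ∀ x ∈ Set.Ico (-1) x₀, p.eval x ≠ 0 := fun x hx =>
    hne x (hx.2.le.trans hx₀'.2.le) hx.2.ne
  rcases pos_or_neg_of_ne_zero (g := fun x => (derivative q).eval x * p.eval x -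
      q.eval x * (derivative p).eval x) (by fun_prop) (a := -1) (b := c)
      (fun x hx => H.wronskian_ne_zero (by rw [hgap]; exact hx)) with hW | hW
  -- Strict monotonicity on (x₀, c] excludes a second point with value v there, so z lies to the
  -- left of x₀ and is compared with -1.
  · refine ⟨fun x hx => hW x (by rw [← hgap]; exact hx), ?_⟩
    rcases lt_or_gt_of_ne hzx with hlt | hlt
    · have := strictMonoOn_div (convex_Ico (-1) x₀) hleft (Q := q) (fun x hx => by
        rw [interior_Ico] at hx
        exact hW x ⟨hx.1, hx.2.trans hx₀'.2⟩) ⟨le_rfl, hx₀'.1⟩ ⟨hz.1.le, hlt⟩ hz.1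
      simpa only [hrz] using this
    · have := strictMonoOn_div (convex_Ioc x₀ c) hright (Q := q) (fun x hx => by
        rw [interior_Ioc] at hx
        exact hW x ⟨hx₀'.1.trans hx.1, hx.2⟩) ⟨hlt, hz.2.le⟩ ⟨hx₀'.2, le_rfl⟩ hz.2
      simp only [hrz] at this
      exact absurd this (lt_irrefl _)
  -- A decreasing q/p would give `f` the sign at -1 that forces a root below -1. With c and one root
  -- in each of the ℓ + 1 gaps, this makes ℓ + 3 distinct roots.
  · exfalso
    have hW' : ∀ x ∈ Set.Ioo (-1) c, 0 < (derivative (-q)).eval x * p.eval x -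
        (-q).eval x * (derivative p).eval x := fun x hx => by
      have := hW x hx
      simp only [derivative_neg, eval_neg]
      linarith
    rcases lt_or_gt_of_ne hzx with hlt | hlt
    · have h1 := strictMonoOn_div (convex_Ico (-1) x₀) hleft (Q := -q) (fun x hx => by
        rw [interior_Ico] at hx
        exact hW' x ⟨hx.1, hx.2.trans hx₀'.2⟩) ⟨le_rfl, hx₀'.1⟩ ⟨hz.1.le, hlt⟩ hz.1
      simp only [eval_neg, neg_div, hrz, neg_lt_neg_iff] at h1
      have hp1 : p.eval (-1) ≠ 0 := hleft _ ⟨le_rfl, hx₀'.1⟩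
      have hpos : 0 < (-1) ^ ℓ * f.eval (-1) := by
        have e : (-1) ^ ℓ * f.eval (-1) =
            ((-1) ^ ℓ * p.eval (-1)) * (v - q.eval (-1) / p.eval (-1)) := by
          rw [hfe]; field_simp
        rw [e, hpe]
        exact mul_pos_of_neg_of_neg
          (mul_neg_of_pos_of_neg (hD _ (hx₀'.1.trans hx₀'.2).le) (by linarith [hx₀'.1]))
          (by linarith)
      obtain ⟨y, hy, hyr⟩ := H.exists_root_lt_neg_one hpos
      obtain ⟨s, hs, hroot⟩ := H.nodes.exists_roots_finset (p := f) (K := range (ℓ + 1))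
        (fun j hj => by rw [Finset.mem_range] at hj; omega)
        (fun j hj => H.nodes.exists_root (by rw [Finset.mem_range] at hj; omega)
          (H.gap_comb v (-1) j (by rw [Finset.mem_range] at hj; omega)))
      have hbd : ∀ k ∈ range (ℓ + 1), ∀ x ∈ cosGap t k, x ≠ c ∧ -1 < x := by
        intro k hk x hx
        rw [Finset.mem_range] at hk
        refine ⟨?_, lt_of_le_of_lt (Real.neg_one_le_cos _) hx.1⟩
        rcases Nat.lt_or_ge k ℓ with hkl | hkl
        · have := Real.cos_le_cos_of_nonneg_of_le_pi
            (H.nodes.nonneg (show 2 * k + 1 ≤ 2 * ℓ + 1 by omega))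
            (H.nodes.le_pi (show 2 * ℓ ≤ 2 * ℓ + 1 by omega))
            (H.nodes.le_of_le (show 2 * k + 1 ≤ 2 * ℓ by omega) (by omega))
          exact (this.trans_lt hx.1).ne'
        · obtain rfl : k = ℓ := by omega
          exact hx.2.ne
      have hcs : c ∉ s := fun hm => by
        obtain ⟨k, hk, hx⟩ := (hroot c hm).2
        exact (hbd k hk c hx).1 rfl
      have hys : y ∉ insert c s := fun hm => by
        rcases Finset.mem_insert.1 hm with rfl | hm
        · linarith [hx₀'.1, hx₀'.2]
        · obtain ⟨k, hk, hx⟩ := (hroot y hm).2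
          linarith [(hbd k hk y hx).2]
      have hcard := card_le_natDegree hf0 (s := insert y (insert c s)) (fun x hx => by
        rcases Finset.mem_insert.1 hx with rfl | hx
        · exact hyr
        · rcases Finset.mem_insert.1 hx with rfl | hx
          · exact hfc
          · exact (hroot x hx).1)
      rw [Finset.card_insert_of_notMem hys, Finset.card_insert_of_notMem hcs, hs,
        Finset.card_range] at hcard
      have hfd : f.natDegree ≤ ℓ + 2 := H.natDegree_comb_le v (-1)
      omega
    · have := strictMonoOn_div (convex_Ioc x₀ c) hright (Q := -q) (fun x hx => by
        rw [interior_Ioc] at hx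
        exact hW' x ⟨hx₀'.1.trans hx.1, hx.2⟩) ⟨hlt, hz.2.le⟩ ⟨hx₀'.2, le_rfl⟩ hz.2
      simp only [eval_neg, neg_div, hrz] at this
      exact absurd this (lt_irrefl _)

end IsPencil

end DarkGas

/-! ### Zeros and signs of the slope on the last gap -/

namespace DarkGas

open Finset MeasureTheory Filter Topology Polynomial

/-- Up to a positive factor, the `θ`-derivative of `Im V` on the last gap. -/
noncomputable def slope (ℓ : ℕ) (p q : ℝ[X]) (lam θ : ℝ) : ℝ :=
  (-1) ^ ℓ * (lam * p.eval (Real.cos θ) - q.eval (Real.cos θ))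

lemma hasDerivAt_slope (ℓ : ℕ) (p q : ℝ[X]) (lam θ : ℝ) :
    HasDerivAt (slope ℓ p q lam) ((-1) ^ ℓ * (lam * (derivative p).eval (Real.cos θ) -
      (derivative q).eval (Real.cos θ)) * -Real.sin θ) θ := by
  have hp := (p.hasDerivAt (Real.cos θ)).comp θ (Real.hasDerivAt_cos θ)
  have hq := (q.hasDerivAt (Real.cos θ)).comp θ (Real.hasDerivAt_cos θ)
  refine (((hp.const_mul lam).sub hq).const_mul ((-1) ^ ℓ)).congr_deriv ?_
  ring

lemma continuous_slope (ℓ : ℕ) (p q : ℝ[X]) (lam : ℝ) : Continuous (slope ℓ p q lam) :=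
  continuous_iff_continuousAt.2 fun θ => (hasDerivAt_slope ℓ p q lam θ).continuousAt

/-- The signs of `slope` on the last gap `(a, π)`: the zero of `p` is at the angle `m`, the
zeros of the slope before and after `m` are at `β` and `s`, and `v₀`, `v₁` are the values of the
parameter at which `s` and `β` leave the gap. -/
structure SlopeSigns (ℓ : ℕ) (p q : ℝ[X]) (a v₀ v₁ m : ℝ) (β s : ℝ → ℝ) : Prop where
  v_lt : v₀ < v₁
  m_mem : m ∈ Set.Ioo a Real.pi
  β_mem : ∀ x < v₁, β x ∈ Set.Ioo a m
  slope_β : ∀ x < v₁, slope ℓ p q x (β x) = 0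
  slope_lt_β : ∀ x < v₁, ∀ θ ∈ Set.Ioo a (β x), slope ℓ p q x θ < 0
  slope_β_m : ∀ x < v₁, ∀ θ ∈ Set.Ioc (β x) m, 0 < slope ℓ p q x θ
  s_mem : ∀ x > v₀, s x ∈ Set.Ioo m Real.pi
  slope_s : ∀ x > v₀, slope ℓ p q x (s x) = 0
  slope_m_s : ∀ x > v₀, ∀ θ ∈ Set.Ico m (s x), 0 < slope ℓ p q x θ
  slope_gt_s : ∀ x > v₀, ∀ θ ∈ Set.Ioo (s x) Real.pi, slope ℓ p q x θ < 0
  slope_of_le : ∀ x ≤ v₀, ∀ θ ∈ Set.Ico m Real.pi, 0 < slope ℓ p q x θ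
  slope_v₁ : ∀ θ ∈ Set.Ioc a m, 0 < slope ℓ p q v₁ θ
  anti_β : StrictAntiOn β (Set.Iio v₁)
  anti_s : StrictAntiOn s (Set.Ioi v₀)
  deriv_pos : ∀ x, ∀ θ ∈ Set.Ioo a m, slope ℓ p q x θ = 0 → 0 < deriv (slope ℓ p q x) θ
  deriv_neg : ∀ x, ∀ θ ∈ Set.Ioo m Real.pi, slope ℓ p q x θ = 0 → deriv (slope ℓ p q x) θ < 0
  pos : ∀ θ ∈ Set.Ioo a m, 0 < (-1) ^ ℓ * p.eval (Real.cos θ)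
  neg : ∀ θ ∈ Set.Ioo m Real.pi, (-1) ^ ℓ * p.eval (Real.cos θ) < 0

/-- Away from m the slope is (-1)^ℓ p(cos θ)(x - R(θ)) with R = q/p. The first factor changes sign
only at m, from positive to negative, and R is strictly decreasing on each side; the two monotone
branches of R locate β and s. -/
lemma IsPencil.exists_slopeSigns {ℓ : ℕ} {t : ℕ → ℝ} {p q : ℝ[X]} (H : IsPencil ℓ t p q) :
    p.eval (Real.cos (t (2 * ℓ))) ≠ 0 ∧
    ∃ m β s, SlopeSigns ℓ p q (t (2 * ℓ)) (q.eval (-1) / p.eval (-1))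
      (q.eval (Real.cos (t (2 * ℓ))) / p.eval (Real.cos (t (2 * ℓ)))) m β s := by
  obtain ⟨x₀, hx₀, D, hD, hp⟩ := H.exists_factor
  obtain ⟨hW, hv⟩ := H.wronskian_pos hx₀ hD hp
  have hlast := H.nodes.last
  obtain ⟨m, hm, rfl⟩ := H.nodes.exists_angle le_rfl hx₀
  have ha0 : 0 ≤ t (2 * ℓ) := H.nodes.nonneg (by omega)
  rw [hlast] at hm
  rw [H.cos_last] at hW hx₀
  set a := t (2 * ℓ) with ha
  set v₀ := q.eval (-1) / p.eval (-1) with hv₀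
  set v₁ := q.eval (Real.cos a) / p.eval (Real.cos a) with hv₁
  have haπ : a < Real.pi := hm.1.trans hm.2
  have hcos : ∀ {x y : ℝ}, a ≤ x → x < y → y ≤ Real.pi → Real.cos y < Real.cos x :=
    fun hx hxy hy => Real.cos_lt_cos_of_nonneg_of_le_pi (ha0.trans hx) hy hxy
  have hcosle : ∀ {x : ℝ}, a ≤ x → x ≤ Real.pi → Real.cos x ≤ Real.cos a :=
    fun hx hy => Real.cos_le_cos_of_nonneg_of_le_pi ha0 hy hx
  have hσ : ((-1 : ℝ)) ^ ℓ ≠ 0 := pow_ne_zero _ (by norm_num)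
  have hpe : ∀ y, (-1) ^ ℓ * p.eval y = D.eval y * (y - Real.cos m) := fun y => by
    have := congrArg (fun f => f.eval y) hp
    simpa using this
  have hA1 : ∀ θ ∈ Set.Ico a m, 0 < (-1) ^ ℓ * p.eval (Real.cos θ) := fun θ hθ => by
    rw [hpe]
    exact mul_pos (hD _ (hcosle hθ.1 (hθ.2.trans hm.2).le))
      (sub_pos.2 (hcos hθ.1 hθ.2 hm.2.le))
  have hA2 : ∀ θ ∈ Set.Ioc m Real.pi, (-1) ^ ℓ * p.eval (Real.cos θ) < 0 := fun θ hθ => by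
    rw [hpe]
    exact mul_neg_of_pos_of_neg (hD _ (hcosle (hm.1.trans hθ.1).le hθ.2))
      (sub_neg.2 (hcos hm.1.le hθ.1 hθ.2))
  have hne1 : ∀ θ ∈ Set.Ico a m, p.eval (Real.cos θ) ≠ 0 := fun θ hθ h => by
    have := hA1 θ hθ; rw [h, mul_zero] at this; exact lt_irrefl _ this
  have hne2 : ∀ θ ∈ Set.Ioc m Real.pi, p.eval (Real.cos θ) ≠ 0 := fun θ hθ h => by
    have := hA2 θ hθ; rw [h, mul_zero] at this; exact lt_irrefl _ this
  set R : ℝ → ℝ := fun θ => q.eval (Real.cos θ) / p.eval (Real.cos θ) with hR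
  have hslope : ∀ x θ, p.eval (Real.cos θ) ≠ 0 →
      slope ℓ p q x θ = (-1) ^ ℓ * p.eval (Real.cos θ) * (x - R θ) := fun x θ h0 => by
    simp only [slope, hR]; field_simp
  have hderivR : ∀ θ ∈ Set.Ioo a Real.pi, p.eval (Real.cos θ) ≠ 0 → deriv R θ < 0 := by
    intro θ hθ h0
    have h1 := (hasDerivAt_div (Q := q) h0).comp θ (Real.hasDerivAt_cos θ)
    have h2 : deriv R θ = _ := h1.deriv
    rw [h2, mul_neg, neg_lt_zero]
    have hx : Real.cos θ ∈ Set.Ioo (-1) (Real.cos a) :=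
      ⟨by rw [← Real.cos_pi]; exact hcos hθ.1.le hθ.2 le_rfl, hcos le_rfl hθ.1 hθ.2.le⟩
    exact mul_pos (div_pos (hW _ hx) (sq_pos_of_ne_zero h0))
      (Real.sin_pos_of_pos_of_lt_pi (ha0.trans_lt hθ.1) hθ.2)
  have hcR : ∀ θ, p.eval (Real.cos θ) ≠ 0 → ContinuousAt R θ := fun θ h0 =>
    ContinuousAt.div (continuous_eval_cos q).continuousAt (continuous_eval_cos p).continuousAt h0
  have hR1 : StrictAntiOn R (Set.Ico a m) := by
    refine strictAntiOn_of_deriv_neg (convex_Ico _ _)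
      (fun θ hθ => (hcR θ (hne1 θ hθ)).continuousWithinAt) fun θ hθ => ?_
    rw [interior_Ico] at hθ
    exact hderivR θ ⟨hθ.1, hθ.2.trans hm.2⟩ (hne1 θ ⟨hθ.1.le, hθ.2⟩)
  have hR2 : StrictAntiOn R (Set.Ioc m Real.pi) := by
    refine strictAntiOn_of_deriv_neg (convex_Ioc _ _)
      (fun θ hθ => (hcR θ (hne2 θ hθ)).continuousWithinAt) fun θ hθ => ?_
    rw [interior_Ioc] at hθ
    exact hderivR θ ⟨hm.1.trans hθ.1, hθ.2⟩ (hne2 θ ⟨hθ.1, hθ.2.le⟩)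
  have hRa : R a = v₁ := rfl
  have hRπ : R Real.pi = v₀ := by simp only [hR, Real.cos_pi]; rfl
  -- At m the slope does not depend on x: it is -(-1)^ℓ q, and its product with `D` equals the
  -- Wronskian -qp', which is positive.
  have hsm : ∀ x, 0 < slope ℓ p q x m := by
    intro x
    have h0 : p.eval (Real.cos m) = 0 := by
      have := hpe (Real.cos m)
      rw [sub_self, mul_zero] at this
      exact (mul_eq_zero.1 this).resolve_left hσ
    have hd : (-1) ^ ℓ * (derivative p).eval (Real.cos m) = D.eval (Real.cos m) := by
      have := congrArg (fun f => (derivative f).eval (Real.cos m)) hp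
      simpa [derivative_mul, h0] using this
    have h1 := hW _ hx₀
    have h2 := hD _ hx₀.2.le
    have hsq : ((-1 : ℝ)) ^ ℓ * (-1) ^ ℓ = 1 := by rw [← mul_pow]; norm_num
    rw [h0, mul_zero, zero_sub] at h1
    simp only [slope]
    rw [h0, mul_zero, zero_sub]
    refine pos_of_mul_pos_left (b := D.eval (Real.cos m)) ?_ h2.le
    rw [← hd]
    calc 0 < -(q.eval (Real.cos m) * (derivative p).eval (Real.cos m)) := h1
      _ = _ := by linear_combination (q.eval (Real.cos m) * (derivative p).eval (Real.cos m)) * hsq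
  have hβ : ∀ x, ∃ b, x < v₁ → b ∈ Set.Ioo a m ∧ slope ℓ p q x b = 0 := by
    intro x
    by_cases hx : x < v₁
    · have h1 : slope ℓ p q x a < 0 := by
        rw [hslope x a (hne1 a ⟨le_rfl, hm.1⟩), hRa]
        exact mul_neg_of_pos_of_neg (hA1 a ⟨le_rfl, hm.1⟩) (by linarith)
      obtain ⟨b, hb, hb0⟩ := intermediate_value_Ioo hm.1.le
        (continuous_slope ℓ p q x).continuousOn ⟨h1, hsm x⟩
      exact ⟨b, fun _ => ⟨hb, hb0⟩⟩
    · exact ⟨0, fun h => absurd h hx⟩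
  have hs : ∀ x, ∃ b, v₀ < x → b ∈ Set.Ioo m Real.pi ∧ slope ℓ p q x b = 0 := by
    intro x
    by_cases hx : v₀ < x
    · have h1 : slope ℓ p q x Real.pi < 0 := by
        rw [hslope x _ (hne2 _ ⟨hm.2, le_rfl⟩), hRπ]
        exact mul_neg_of_neg_of_pos (hA2 _ ⟨hm.2, le_rfl⟩) (by linarith)
      obtain ⟨b, hb, hb0⟩ := intermediate_value_Ioo' hm.2.le
        (continuous_slope ℓ p q x).continuousOn ⟨h1, hsm x⟩
      exact ⟨b, fun _ => ⟨hb, hb0⟩⟩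
    · exact ⟨0, fun h => absurd h hx⟩
  choose β hβ using hβ
  choose s hs using hs
  have hRz : ∀ x θ, p.eval (Real.cos θ) ≠ 0 → slope ℓ p q x θ = 0 → R θ = x := by
    intro x θ h0 h1
    rw [hslope x θ h0] at h1
    have := (mul_eq_zero.1 h1).resolve_left (mul_ne_zero hσ h0)
    linarith
  have hRβ : ∀ x < v₁, R (β x) = x := fun x hx =>
    hRz x _ (hne1 _ ⟨(hβ x hx).1.1.le, (hβ x hx).1.2⟩) (hβ x hx).2
  have hRs : ∀ x > v₀, R (s x) = x := fun x hx =>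
    hRz x _ (hne2 _ ⟨(hs x hx).1.1, (hs x hx).1.2.le⟩) (hs x hx).2
  -- At a zero x equals q/p, so the derivative of the slope becomes (-1)^ℓ p times the Wronskian
  -- over p² times sin θ. Its sign is that of (-1)^ℓ p, whence nondegeneracy.
  have hders : ∀ x, ∀ θ ∈ Set.Ioo a Real.pi, p.eval (Real.cos θ) ≠ 0 → slope ℓ p q x θ = 0 →
      ∃ y > 0, deriv (slope ℓ p q x) θ = (-1) ^ ℓ * p.eval (Real.cos θ) * y := by
    intro x θ hθ h0 h1
    have hx : Real.cos θ ∈ Set.Ioo (-1) (Real.cos a) :=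
      ⟨by rw [← Real.cos_pi]; exact hcos hθ.1.le hθ.2 le_rfl, hcos le_rfl hθ.1 hθ.2.le⟩
    refine ⟨_, mul_pos (div_pos (hW _ hx) (sq_pos_of_ne_zero h0))
      (Real.sin_pos_of_pos_of_lt_pi (ha0.trans_lt hθ.1) hθ.2), ?_⟩
    rw [(hasDerivAt_slope ℓ p q x θ).deriv, ← hRz x θ h0 h1]
    simp only [hR]
    field_simp
    ring
  refine ⟨hne1 a ⟨le_rfl, hm.1⟩, m, β, s, ?_⟩
  constructor
  · exact hv
  · exact hm
  · exact fun x hx => (hβ x hx).1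
  · exact fun x hx => (hβ x hx).2
  · intro x hx θ hθ
    have hb := (hβ x hx).1
    have hθ' : θ ∈ Set.Ico a m := ⟨hθ.1.le, hθ.2.trans hb.2⟩
    rw [hslope x θ (hne1 θ hθ')]
    have := hR1 hθ' ⟨hb.1.le, hb.2⟩ hθ.2
    rw [hRβ x hx] at this
    exact mul_neg_of_pos_of_neg (hA1 θ hθ') (by linarith)
  · intro x hx θ hθ
    have hb := (hβ x hx).1
    rcases hθ.2.eq_or_lt with rfl | hlt
    · exact hsm x
    · have hθ' : θ ∈ Set.Ico a m := ⟨(hb.1.trans hθ.1).le, hlt⟩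
      rw [hslope x θ (hne1 θ hθ')]
      have := hR1 ⟨hb.1.le, hb.2⟩ hθ' hθ.1
      rw [hRβ x hx] at this
      exact mul_pos (hA1 θ hθ') (by linarith)
  · exact fun x hx => (hs x hx).1
  · exact fun x hx => (hs x hx).2
  · intro x hx θ hθ
    have hb := (hs x hx).1
    rcases hθ.1.eq_or_lt with rfl | hlt
    · exact hsm x
    · have hθ' : θ ∈ Set.Ioc m Real.pi := ⟨hlt, (hθ.2.trans hb.2).le⟩
      rw [hslope x θ (hne2 θ hθ')]
      have := hR2 hθ' ⟨hb.1, hb.2.le⟩ hθ.2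
      rw [hRs x hx] at this
      exact mul_pos_of_neg_of_neg (hA2 θ hθ') (by linarith)
  · intro x hx θ hθ
    have hb := (hs x hx).1
    have hθ' : θ ∈ Set.Ioc m Real.pi := ⟨hb.1.trans hθ.1, hθ.2.le⟩
    rw [hslope x θ (hne2 θ hθ')]
    have := hR2 ⟨hb.1, hb.2.le⟩ hθ' hθ.1
    rw [hRs x hx] at this
    exact mul_neg_of_neg_of_pos (hA2 θ hθ') (by linarith)
  · intro x hx θ hθ
    rcases hθ.1.eq_or_lt with rfl | hlt
    · exact hsm x
    · have hθ' : θ ∈ Set.Ioc m Real.pi := ⟨hlt, hθ.2.le⟩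
      rw [hslope x θ (hne2 θ hθ')]
      have := hR2 hθ' ⟨hm.2, le_rfl⟩ hθ.2
      rw [hRπ] at this
      exact mul_pos_of_neg_of_neg (hA2 θ hθ') (by linarith)
  · intro θ hθ
    rcases hθ.2.eq_or_lt with rfl | hlt
    · exact hsm _
    · have hθ' : θ ∈ Set.Ico a m := ⟨hθ.1.le, hlt⟩
      rw [hslope _ θ (hne1 θ hθ')]
      have := hR1 ⟨le_rfl, hm.1⟩ hθ' hθ.1
      rw [hRa] at this
      exact mul_pos (hA1 θ hθ') (by linarith)
  · intro x hx y hy hxy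
    have hbx := (hβ x hx).1
    have hby := (hβ y hy).1
    rw [← hR1.lt_iff_gt ⟨hbx.1.le, hbx.2⟩ ⟨hby.1.le, hby.2⟩, hRβ x hx, hRβ y hy]
    exact hxy
  · intro x hx y hy hxy
    have hbx := (hs x hx).1
    have hby := (hs y hy).1
    rw [← hR2.lt_iff_gt ⟨hbx.1, hbx.2.le⟩ ⟨hby.1, hby.2.le⟩, hRs x hx, hRs y hy]
    exact hxy
  · intro x θ hθ h0
    have hθ' : θ ∈ Set.Ico a m := ⟨hθ.1.le, hθ.2⟩
    obtain ⟨y, hy, e⟩ := hders x θ ⟨hθ.1, hθ.2.trans hm.2⟩ (hne1 θ hθ') h0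
    rw [e]
    exact mul_pos (hA1 θ hθ') hy
  · intro x θ hθ h0
    have hθ' : θ ∈ Set.Ioc m Real.pi := ⟨hθ.1, hθ.2.le⟩
    obtain ⟨y, hy, e⟩ := hders x θ ⟨hm.1.trans hθ.1, hθ.2⟩ (hne2 θ hθ') h0
    rw [e]
    exact mul_neg_of_neg_of_pos (hA2 θ hθ') hy
  · exact fun θ hθ => hA1 θ ⟨hθ.1.le, hθ.2⟩
  · exact fun θ hθ => hA2 θ ⟨hθ.1, hθ.2.le⟩

end DarkGas

/-! ### The imaginary part of V on the last gap -/

namespace DarkGas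

open Finset MeasureTheory Filter Topology Polynomial

/-- The primitive of `g * weight` on the last gap which vanishes at its first endpoint. -/
noncomputable def gapPrimitive (ℓ : ℕ) (t : ℕ → ℝ) (g : ℝ → ℝ) (θ : ℝ) : ℝ :=
  (2 ^ ℓ)⁻¹ * ∫ φ in t (2 * ℓ)..θ, g φ * weight ℓ t φ

lemma gapPrimitive_left (ℓ : ℕ) (t : ℕ → ℝ) (g : ℝ → ℝ) :
    gapPrimitive ℓ t g (t (2 * ℓ)) = 0 := by
  simp [gapPrimitive]

lemma gapPrimitive_neg (ℓ : ℕ) (t : ℕ → ℝ) (g : ℝ → ℝ) (θ : ℝ) :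
    gapPrimitive ℓ t (fun φ => -g φ) θ = -gapPrimitive ℓ t g θ := by
  simp [gapPrimitive]

namespace IsNodes

variable {ℓ : ℕ} {t : ℕ → ℝ} {g : ℝ → ℝ}

lemma left_lt_pi (h : IsNodes ℓ t) : t (2 * ℓ) < Real.pi := h.lt_pi le_rfl

lemma mem_Ioo_iff (h : IsNodes ℓ t) {θ : ℝ} : θ ∈ Set.Ioo (t (2 * ℓ)) Real.pi ↔
    θ ∈ Set.Ioo (t (2 * ℓ)) (t (2 * ℓ + 1)) := by rw [h.last]

lemma weight_pos_last (h : IsNodes ℓ t)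
    {θ : ℝ} (hθ : θ ∈ Set.Ioo (t (2 * ℓ)) Real.pi) : 0 < weight ℓ t θ :=
  h.weight_pos le_rfl (h.mem_Ioo_iff.1 hθ)

lemma contDiffAt_weight (h : IsNodes ℓ t) {n : ℕ∞} {θ : ℝ} (hθ : θ ∈ Set.Ioo (t (2 * ℓ)) Real.pi) :
    ContDiffAt ℝ n (weight ℓ t) θ := by
  unfold weight
  refine contDiffAt_prod fun j hj => ?_
  have hne : Real.cos θ - Real.cos (t j) ≠ 0 :=
    sub_ne_zero.2 (h.cos_ne le_rfl hj (h.mem_Ioo_iff.1 hθ))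
  have h1 : ContDiffAt ℝ n (fun θ => Real.cos θ - Real.cos (t j)) θ :=
    Real.contDiff_cos.contDiffAt.sub contDiffAt_const
  exact ((h1.abs hne).sqrt (abs_ne_zero.2 hne)).inv (Real.sqrt_ne_zero'.2 (abs_pos.2 hne))

lemma intervalIntegrable_last (h : IsNodes ℓ t) (hg : Continuous g)
    {x y : ℝ} (hx : x ∈ Set.Icc (t (2 * ℓ)) Real.pi)
    (hy : y ∈ Set.Icc (t (2 * ℓ)) Real.pi) :
    IntervalIntegrable (fun φ => g φ * weight ℓ t φ) volume x y := by
  have h0 := h.nonneg (show 2 * ℓ ≤ 2 * ℓ + 1 by omega)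
  exact h.intervalIntegrable_mul_weight hg ⟨h0.trans hx.1, hx.2⟩ ⟨h0.trans hy.1, hy.2⟩

lemma continuousOn_gapPrimitive (h : IsNodes ℓ t) (hg : Continuous g) :
    ContinuousOn (gapPrimitive ℓ t g) (Set.Icc (t (2 * ℓ)) Real.pi) := by
  have hle := h.left_lt_pi.le
  have hI := h.intervalIntegrable_last hg ⟨le_rfl, hle⟩ ⟨hle, le_rfl⟩
  have := intervalIntegral.continuousOn_primitive_interval' hI
    (Set.left_mem_uIcc)
  rw [Set.uIcc_of_le hle] at this
  exact continuousOn_const.mul this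

lemma hasDerivAt_gapPrimitive (h : IsNodes ℓ t) (hg : Continuous g)
    {θ : ℝ} (hθ : θ ∈ Set.Ioo (t (2 * ℓ)) Real.pi) :
    HasDerivAt (gapPrimitive ℓ t g) ((2 ^ ℓ)⁻¹ * (g θ * weight ℓ t θ)) θ := by
  have hI := h.intervalIntegrable_last hg ⟨le_rfl, h.left_lt_pi.le⟩ ⟨hθ.1.le, hθ.2.le⟩
  refine (intervalIntegral.integral_hasDerivAt_right hI ?_ ?_).const_mul _
  · exact (hg.measurable.mul (measurable_weight ℓ t)).stronglyMeasurable.stronglyMeasurableAtFilter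
  · exact hg.continuousAt.mul (h.contDiffAt_weight (n := 0) hθ).continuousAt

lemma gapPrimitive_lt (h : IsNodes ℓ t) (hg : Continuous g)
    {x y : ℝ} (hx : t (2 * ℓ) ≤ x) (hxy : x < y) (hy : y ≤ Real.pi)
    (hpos : ∀ θ ∈ Set.Ioo x y, 0 < g θ) : gapPrimitive ℓ t g x < gapPrimitive ℓ t g y := by
  have hle := h.left_lt_pi.le
  have h1 := h.integral_pos hg le_rfl hx hxy (by rw [h.last]; exact hy) hpos
  have h2 := intervalIntegral.integral_add_adjacent_intervals
    (h.intervalIntegrable_last hg ⟨le_rfl, hle⟩ ⟨hx, hxy.le.trans hy⟩)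
    (h.intervalIntegrable_last hg ⟨hx, hxy.le.trans hy⟩ ⟨hx.trans hxy.le, hy⟩)
  rw [gapPrimitive, gapPrimitive, ← h2]
  exact mul_lt_mul_of_pos_left (by linarith) (by positivity)

lemma gapPrimitive_gt (h : IsNodes ℓ t) (hg : Continuous g)
    {x y : ℝ} (hx : t (2 * ℓ) ≤ x) (hxy : x < y) (hy : y ≤ Real.pi)
    (hneg : ∀ θ ∈ Set.Ioo x y, g θ < 0) : gapPrimitive ℓ t g y < gapPrimitive ℓ t g x := by
  have := h.gapPrimitive_lt (g := fun θ => -g θ) hg.neg hx hxy hy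
    (fun θ hθ => neg_pos.2 (hneg θ hθ))
  rw [gapPrimitive_neg, gapPrimitive_neg] at this
  linarith

end IsNodes

/-- `Im V(e^{iθ}; 2x)` on the last gap. -/
noncomputable def gapV (ℓ : ℕ) (t : ℕ → ℝ) (p q : ℝ[X]) (x θ : ℝ) : ℝ :=
  gapPrimitive ℓ t (slope ℓ p q x) θ

namespace IsPencil

variable {ℓ : ℕ} {t : ℕ → ℝ} {p q : ℝ[X]}

lemma gapV_eq (H : IsPencil ℓ t p q) (x : ℝ) {θ : ℝ} (hθ : θ ∈ Set.Icc (t (2 * ℓ)) Real.pi) :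
    gapV ℓ t p q x θ = x * gapPrimitive ℓ t (fun φ => (-1) ^ ℓ * p.eval (Real.cos φ)) θ -
      gapPrimitive ℓ t (fun φ => (-1) ^ ℓ * q.eval (Real.cos φ)) θ := by
  have hle := H.nodes.left_lt_pi.le
  have hi : ∀ p : ℝ[X], IntervalIntegrable
      (fun φ => (-1) ^ ℓ * p.eval (Real.cos φ) * weight ℓ t φ) volume (t (2 * ℓ)) θ := fun p =>
    H.nodes.intervalIntegrable_last (continuous_const.mul (continuous_eval_cos p)) ⟨le_rfl, hle⟩ hθ
  simp only [gapV, gapPrimitive]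
  rw [mul_left_comm, ← mul_sub, ← intervalIntegral.integral_const_mul x,
    ← intervalIntegral.integral_sub ((hi p).const_mul x) (hi q)]
  congr 2
  funext φ
  simp only [slope]
  ring

lemma gapV_left (x : ℝ) : gapV ℓ t p q x (t (2 * ℓ)) = 0 := gapPrimitive_left _ _ _

lemma gapPrimitive_pi (H : IsPencil ℓ t p q) {p : ℝ[X]} (hp : gapIntegral ℓ t p ℓ = 0) :
    gapPrimitive ℓ t (fun φ => (-1) ^ ℓ * p.eval (Real.cos φ)) Real.pi = 0 := by
  rw [gapIntegral, H.nodes.last] at hp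
  simp only [gapPrimitive, mul_assoc, intervalIntegral.integral_const_mul, hp, mul_zero]

lemma gapV_pi (H : IsPencil ℓ t p q) (x : ℝ) : gapV ℓ t p q x Real.pi = 0 := by
  rw [H.gapV_eq x ⟨H.nodes.left_lt_pi.le, le_rfl⟩, H.gapPrimitive_pi (H.gap_left ℓ le_rfl),
    H.gapPrimitive_pi (H.gap_right ℓ le_rfl)]
  simp

lemma hasDerivAt_gapV (H : IsPencil ℓ t p q)
    (x : ℝ) {θ : ℝ} (hθ : θ ∈ Set.Ioo (t (2 * ℓ)) Real.pi) :
    HasDerivAt (gapV ℓ t p q x) ((2 ^ ℓ)⁻¹ * (slope ℓ p q x θ * weight ℓ t θ)) θ :=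
  H.nodes.hasDerivAt_gapPrimitive (continuous_slope ℓ p q x) hθ

lemma deriv_gapV_eq_zero_iff (H : IsPencil ℓ t p q)
    (x : ℝ) {θ : ℝ} (hθ : θ ∈ Set.Ioo (t (2 * ℓ)) Real.pi) :
    deriv (gapV ℓ t p q x) θ = 0 ↔ slope ℓ p q x θ = 0 := by
  rw [(H.hasDerivAt_gapV x hθ).deriv]
  have := (H.nodes.weight_pos_last hθ).ne'
  simp [this]

/-- At a zero of the slope the term with the derivative of the weight drops out, so the second
derivative has the sign of the derivative of the slope. -/
lemma deriv_deriv_gapV (H : IsPencil ℓ t p q) (x : ℝ) {θ : ℝ} (hθ : θ ∈ Set.Ioo (t (2 * ℓ)) Real.pi)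
    (h0 : slope ℓ p q x θ = 0) : deriv (deriv (gapV ℓ t p q x)) θ =
      (2 ^ ℓ)⁻¹ * (deriv (slope ℓ p q x) θ * weight ℓ t θ) := by
  have he : deriv (gapV ℓ t p q x) =ᶠ[𝓝 θ]
      fun θ => (2 ^ ℓ)⁻¹ * (slope ℓ p q x θ * weight ℓ t θ) := by
    filter_upwards [isOpen_Ioo.mem_nhds hθ] with φ hφ using (H.hasDerivAt_gapV x hφ).deriv
  rw [he.deriv_eq]
  have hw := ((H.nodes.contDiffAt_weight (n := 1) hθ).differentiableAt one_ne_zero).hasDerivAt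
  have := (((hasDerivAt_slope ℓ p q x θ).differentiableAt.hasDerivAt.mul hw).const_mul
    (2 ^ ℓ : ℝ)⁻¹).deriv
  simp only [h0, zero_mul, add_zero] at this
  exact this

lemma contDiffOn_gapV (H : IsPencil ℓ t p q) (x : ℝ) :
    ContDiffOn ℝ 2 (gapV ℓ t p q x) (Set.Ioo (t (2 * ℓ)) Real.pi) := by
  rw [show (2 : WithTop ℕ∞) = 1 + 1 by norm_num, contDiffOn_succ_iff_deriv_of_isOpen isOpen_Ioo]
  refine ⟨fun θ hθ => (H.hasDerivAt_gapV x hθ).differentiableAt.differentiableWithinAt,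
    by simp, ?_⟩
  have : ContDiffOn ℝ 1 (fun θ => (2 ^ ℓ : ℝ)⁻¹ * (slope ℓ p q x θ * weight ℓ t θ))
      (Set.Ioo (t (2 * ℓ)) Real.pi) := by
    intro θ hθ
    refine ContDiffAt.contDiffWithinAt (contDiffAt_const.mul (ContDiffAt.mul ?_
      (H.nodes.contDiffAt_weight hθ)))
    have hc : ∀ p : ℝ[X], ContDiffAt ℝ 1 (fun θ => p.eval (Real.cos θ)) θ := fun p =>
      ((by simpa using p.contDiff_aeval (𝕜 := ℝ) (n := 1) : ContDiff ℝ 1 fun x => p.eval x).comp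
        Real.contDiff_cos).contDiffAt
    exact contDiffAt_const.mul ((contDiffAt_const.mul (hc p)).sub (hc q))
  exact this.congr fun θ hθ => (H.hasDerivAt_gapV x hθ).deriv

variable {v₀ v₁ m : ℝ} {β s : ℝ → ℝ}

/-- The primitive vanishes at both ends of the gap, rises up to m and falls after it. It is the
coefficient of x in `gapV`, so its positivity governs all monotonicity in the parameter at a fixed
angle. -/
lemma gapPrimitive_pos (H : IsPencil ℓ t p q) (S : SlopeSigns ℓ p q (t (2 * ℓ)) v₀ v₁ m β s)
    {θ : ℝ} (hθ : θ ∈ Set.Ioo (t (2 * ℓ)) Real.pi) :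
    0 < gapPrimitive ℓ t (fun φ => (-1) ^ ℓ * p.eval (Real.cos φ)) θ := by
  have hc : Continuous fun φ => (-1) ^ ℓ * p.eval (Real.cos φ) :=
    continuous_const.mul (continuous_eval_cos p)
  rcases le_or_gt θ m with hm | hm
  · have := H.nodes.gapPrimitive_lt hc le_rfl hθ.1 hθ.2.le
      (fun φ hφ => S.pos φ ⟨hφ.1, hφ.2.trans_le hm⟩)
    rwa [gapPrimitive_left] at this
  · have := H.nodes.gapPrimitive_gt hc hθ.1.le hθ.2 le_rfl
      (fun φ hφ => S.neg φ ⟨hm.trans hφ.1, hφ.2⟩)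
    rwa [H.gapPrimitive_pi (H.gap_left ℓ le_rfl)] at this

lemma gapV_strictMono (H : IsPencil ℓ t p q) (S : SlopeSigns ℓ p q (t (2 * ℓ)) v₀ v₁ m β s)
    {θ : ℝ} (hθ : θ ∈ Set.Ioo (t (2 * ℓ)) Real.pi) :
    StrictMono fun x => gapV ℓ t p q x θ := by
  intro x y hxy
  simp only
  rw [H.gapV_eq x ⟨hθ.1.le, hθ.2.le⟩, H.gapV_eq y ⟨hθ.1.le, hθ.2.le⟩]
  nlinarith [mul_lt_mul_of_pos_right hxy (H.gapPrimitive_pos S hθ)]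

lemma continuous_gapV (H : IsPencil ℓ t p q) {θ : ℝ} (hθ : θ ∈ Set.Ioo (t (2 * ℓ)) Real.pi) :
    Continuous fun x => gapV ℓ t p q x θ := by
  simp_rw [fun x => H.gapV_eq x (θ := θ) ⟨hθ.1.le, hθ.2.le⟩]
  fun_prop

lemma gapV_lt_of_le_β (H : IsPencil ℓ t p q) (S : SlopeSigns ℓ p q (t (2 * ℓ)) v₀ v₁ m β s)
    {x : ℝ} (hx : x < v₁) {y z : ℝ} (hy : t (2 * ℓ) ≤ y) (hyz : y < z)
    (hz : z ≤ β x) : gapV ℓ t p q x z < gapV ℓ t p q x y := by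
  have hb := S.β_mem x hx
  exact H.nodes.gapPrimitive_gt (continuous_slope ℓ p q x) hy hyz
    (hz.trans (hb.2.trans S.m_mem.2).le)
    fun θ hθ => S.slope_lt_β x hx θ ⟨hy.trans_lt hθ.1, hθ.2.trans_le hz⟩

lemma gapV_lt_of_mem (H : IsPencil ℓ t p q) (S : SlopeSigns ℓ p q (t (2 * ℓ)) v₀ v₁ m β s)
    {x : ℝ} (hx₁ : x < v₁) (hx₀ : v₀ < x) {y z : ℝ} (hy : β x ≤ y) (hyz : y < z)
    (hz : z ≤ s x) : gapV ℓ t p q x y < gapV ℓ t p q x z := by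
  have hb := S.β_mem x hx₁
  have hs := S.s_mem x hx₀
  refine H.nodes.gapPrimitive_lt (continuous_slope ℓ p q x) (hb.1.le.trans hy) hyz
    (hz.trans hs.2.le) fun θ hθ => ?_
  rcases le_or_gt θ m with hm | hm
  · exact S.slope_β_m x hx₁ θ ⟨hy.trans_lt hθ.1, hm⟩
  · exact S.slope_m_s x hx₀ θ ⟨hm.le, hθ.2.trans_le hz⟩

lemma gapV_lt_of_s_le (H : IsPencil ℓ t p q) (S : SlopeSigns ℓ p q (t (2 * ℓ)) v₀ v₁ m β s)
    {x : ℝ} (hx₀ : v₀ < x) {y z : ℝ} (hy : s x ≤ y) (hyz : y < z)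
    (hz : z ≤ Real.pi) : gapV ℓ t p q x z < gapV ℓ t p q x y := by
  have hs := S.s_mem x hx₀
  exact H.nodes.gapPrimitive_gt (continuous_slope ℓ p q x)
    ((S.m_mem.1.trans hs.1).le.trans hy) hyz hz
    fun θ hθ => S.slope_gt_s x hx₀ θ ⟨hy.trans_lt hθ.1, hθ.2.trans_le hz⟩

lemma gapV_lt_of_le_v₀ (H : IsPencil ℓ t p q) (S : SlopeSigns ℓ p q (t (2 * ℓ)) v₀ v₁ m β s)
    {x : ℝ} (hx₀ : x ≤ v₀) {y z : ℝ} (hy : β x ≤ y) (hyz : y < z)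
    (hz : z ≤ Real.pi) : gapV ℓ t p q x y < gapV ℓ t p q x z := by
  have hx₁ := hx₀.trans_lt S.v_lt
  have hb := S.β_mem x hx₁
  refine H.nodes.gapPrimitive_lt (continuous_slope ℓ p q x) (hb.1.le.trans hy) hyz hz
    fun θ hθ => ?_
  rcases le_or_gt θ m with hm | hm
  · exact S.slope_β_m x hx₁ θ ⟨hy.trans_lt hθ.1, hm⟩
  · exact S.slope_of_le x hx₀ θ ⟨hm.le, hθ.2.trans_le hz⟩

lemma gapV_β_neg (H : IsPencil ℓ t p q) (S : SlopeSigns ℓ p q (t (2 * ℓ)) v₀ v₁ m β s)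
    {x : ℝ} (hx : x < v₁) : gapV ℓ t p q x (β x) < 0 := by
  have := H.gapV_lt_of_le_β S hx le_rfl (S.β_mem x hx).1 le_rfl
  rwa [gapV_left] at this

lemma gapV_s_pos (H : IsPencil ℓ t p q) (S : SlopeSigns ℓ p q (t (2 * ℓ)) v₀ v₁ m β s)
    {x : ℝ} (hx : v₀ < x) : 0 < gapV ℓ t p q x (s x) := by
  have := H.gapV_lt_of_s_le S hx le_rfl (S.s_mem x hx).2 le_rfl
  rwa [H.gapV_pi] at this

lemma gapV_pos_of_s_le (H : IsPencil ℓ t p q) (S : SlopeSigns ℓ p q (t (2 * ℓ)) v₀ v₁ m β s)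
    {x : ℝ} (hx : v₀ < x) {θ : ℝ} (hs : s x ≤ θ) (hθ : θ < Real.pi) :
    0 < gapV ℓ t p q x θ := by
  have := H.gapV_lt_of_s_le S hx hs hθ le_rfl
  rwa [H.gapV_pi] at this

lemma gapV_neg_of_le_β (H : IsPencil ℓ t p q) (S : SlopeSigns ℓ p q (t (2 * ℓ)) v₀ v₁ m β s)
    {x : ℝ} (hx : x < v₁) {θ : ℝ} (hθ : t (2 * ℓ) < θ) (hb : θ ≤ β x) :
    gapV ℓ t p q x θ < 0 := by
  have := H.gapV_lt_of_le_β S hx le_rfl hθ hb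
  rwa [gapV_left] at this

lemma gapV_neg_of_le_v₀ (H : IsPencil ℓ t p q) (S : SlopeSigns ℓ p q (t (2 * ℓ)) v₀ v₁ m β s)
    {x : ℝ} (hx : x ≤ v₀) {θ : ℝ} (hθ : θ ∈ Set.Ioo (t (2 * ℓ)) Real.pi) :
    gapV ℓ t p q x θ < 0 := by
  rcases le_or_gt θ (β x) with hb | hb
  · exact H.gapV_neg_of_le_β S (hx.trans_lt S.v_lt) hθ.1 hb
  · have := H.gapV_lt_of_le_v₀ S hx hb.le hθ.2 le_rfl
    rwa [H.gapV_pi] at this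

/-- Beyond s the function decreases again, so monotonicity alone does not compare it with the
minimum; there it is positive while the minimum is negative. -/
lemma gapV_β_lt (H : IsPencil ℓ t p q) (S : SlopeSigns ℓ p q (t (2 * ℓ)) v₀ v₁ m β s)
    {x : ℝ} (hx : x < v₁) {θ : ℝ} (hθ : θ ∈ Set.Ioo (t (2 * ℓ)) Real.pi)
    (hne : θ ≠ β x) : gapV ℓ t p q x (β x) < gapV ℓ t p q x θ := by
  rcases lt_or_gt_of_ne hne with hlt | hlt
  · exact H.gapV_lt_of_le_β S hx hθ.1.le hlt le_rfl
  · rcases le_or_gt x v₀ with hx₀ | hx₀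
    · exact H.gapV_lt_of_le_v₀ S hx₀ le_rfl hlt hθ.2.le
    · rcases le_or_gt θ (s x) with hs | hs
      · exact H.gapV_lt_of_mem S hx hx₀ le_rfl hlt hs
      · exact (H.gapV_β_neg S hx).trans (H.gapV_pos_of_s_le S hx₀ hs.le hθ.2)

lemma gapV_lt_s (H : IsPencil ℓ t p q) (S : SlopeSigns ℓ p q (t (2 * ℓ)) v₀ v₁ m β s)
    {x : ℝ} (hx₁ : x < v₁) (hx₀ : v₀ < x) {θ : ℝ}
    (hθ : θ ∈ Set.Ioo (t (2 * ℓ)) Real.pi) (hne : θ ≠ s x) :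
    gapV ℓ t p q x θ < gapV ℓ t p q x (s x) := by
  rcases lt_or_gt_of_ne hne with hlt | hlt
  · rcases le_or_gt θ (β x) with hb | hb
    · exact (H.gapV_neg_of_le_β S hx₁ hθ.1 hb).trans (H.gapV_s_pos S hx₀)
    · exact H.gapV_lt_of_mem S hx₁ hx₀ hb.le hlt le_rfl
  · exact H.gapV_lt_of_s_le S hx₀ le_rfl hlt hθ.2.le

lemma eq_β_or_eq_s (S : SlopeSigns ℓ p q (t (2 * ℓ)) v₀ v₁ m β s)
    {x : ℝ} (hx₁ : x < v₁) (hx₀ : v₀ < x) {θ : ℝ}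
    (hθ : θ ∈ Set.Ioo (t (2 * ℓ)) Real.pi) (h0 : slope ℓ p q x θ = 0) : θ = β x ∨ θ = s x := by
  by_contra! hne
  rcases lt_or_gt_of_ne hne.1 with hb | hb
  · exact (S.slope_lt_β x hx₁ θ ⟨hθ.1, hb⟩).ne h0
  · rcases le_or_gt θ m with hm | hm
    · exact (S.slope_β_m x hx₁ θ ⟨hb, hm⟩).ne' h0
    · rcases lt_or_gt_of_ne hne.2 with hs | hs
      · exact (S.slope_m_s x hx₀ θ ⟨hm.le, hs⟩).ne' h0
      · exact (S.slope_gt_s x hx₀ θ ⟨hs, hθ.2⟩).ne h0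

lemma eq_β (S : SlopeSigns ℓ p q (t (2 * ℓ)) v₀ v₁ m β s) {x : ℝ} (hx₀ : x ≤ v₀) {θ : ℝ}
    (hθ : θ ∈ Set.Ioo (t (2 * ℓ)) Real.pi) (h0 : slope ℓ p q x θ = 0) : θ = β x := by
  have hx₁ := hx₀.trans_lt S.v_lt
  by_contra! hne
  rcases lt_or_gt_of_ne hne with hb | hb
  · exact (S.slope_lt_β x hx₁ θ ⟨hθ.1, hb⟩).ne h0
  · rcases le_or_gt θ m with hm | hm
    · exact (S.slope_β_m x hx₁ θ ⟨hb, hm⟩).ne' h0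
    · exact h0.not_gt (S.slope_of_le x hx₀ θ ⟨hm.le, hθ.2⟩)

/-- The unique sign change of `gapV` between its minimum and its maximum. -/
lemma exists_sign_change (H : IsPencil ℓ t p q) (S : SlopeSigns ℓ p q (t (2 * ℓ)) v₀ v₁ m β s) :
    ∃ ρ : ℝ → ℝ, ∀ x ∈ Set.Ioo v₀ v₁,
    ρ x ∈ Set.Ioo (β x) (s x) ∧ gapV ℓ t p q x (ρ x) = 0 ∧
    (∀ θ ∈ Set.Ioo (t (2 * ℓ)) (ρ x), gapV ℓ t p q x θ < 0) ∧
    ∀ θ ∈ Set.Ioo (ρ x) Real.pi, 0 < gapV ℓ t p q x θ := by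
  have hex : ∀ x, ∃ r, x ∈ Set.Ioo v₀ v₁ → r ∈ Set.Ioo (β x) (s x) ∧ gapV ℓ t p q x r = 0 := by
    intro x
    by_cases hx : x ∈ Set.Ioo v₀ v₁
    · have hb := S.β_mem x hx.2
      have hs := S.s_mem x hx.1
      have hc : ContinuousOn (gapV ℓ t p q x) (Set.Icc (β x) (s x)) :=
        (H.nodes.continuousOn_gapPrimitive (continuous_slope ℓ p q x)).mono
          (Set.Icc_subset_Icc hb.1.le hs.2.le)
      obtain ⟨r, hr, hr0⟩ := intermediate_value_Ioo (hb.2.trans hs.1).le hc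
        ⟨H.gapV_β_neg S hx.2, H.gapV_s_pos S hx.1⟩
      exact ⟨r, fun _ => ⟨hr, hr0⟩⟩
    · exact ⟨0, fun h => absurd h hx⟩
  choose ρ hρ using hex
  refine ⟨ρ, fun x hx => ⟨(hρ x hx).1, (hρ x hx).2, fun θ hθ => ?_, fun θ hθ => ?_⟩⟩
  · obtain ⟨hm, h0⟩ := hρ x hx
    rcases le_or_gt θ (β x) with hb | hb
    · exact H.gapV_neg_of_le_β S hx.2 hθ.1 hb
    · have := H.gapV_lt_of_mem S hx.2 hx.1 hb.le hθ.2 hm.2.le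
      rwa [h0] at this
  · obtain ⟨hm, h0⟩ := hρ x hx
    rcases le_or_gt θ (s x) with hb | hb
    · have := H.gapV_lt_of_mem S hx.2 hx.1 hm.1.le hθ.1 hb
      rwa [h0] at this
    · exact H.gapV_pos_of_s_le S hx.1 hb.le hθ.2

lemma mem_Ioo_of_mem_β_s (S : SlopeSigns ℓ p q (t (2 * ℓ)) v₀ v₁ m β s)
    {x : ℝ} (hx : x ∈ Set.Ioo v₀ v₁) {θ : ℝ}
    (hθ : θ ∈ Set.Ioo (β x) (s x)) : θ ∈ Set.Ioo (t (2 * ℓ)) Real.pi :=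
  ⟨(S.β_mem x hx.2).1.trans hθ.1, hθ.2.trans (S.s_mem x hx.1).2⟩

variable {ρ : ℝ → ℝ}

/-- Raising x makes the value at the old sign change positive, so that point lies beyond the new
sign change. -/
lemma strictAntiOn_sign_change
    (H : IsPencil ℓ t p q) (S : SlopeSigns ℓ p q (t (2 * ℓ)) v₀ v₁ m β s) (hρ : ∀ x ∈ Set.Ioo v₀ v₁,
    ρ x ∈ Set.Ioo (β x) (s x) ∧ gapV ℓ t p q x (ρ x) = 0 ∧
    (∀ θ ∈ Set.Ioo (t (2 * ℓ)) (ρ x), gapV ℓ t p q x θ < 0) ∧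
    ∀ θ ∈ Set.Ioo (ρ x) Real.pi, 0 < gapV ℓ t p q x θ) :
    StrictAntiOn ρ (Set.Ioo v₀ v₁) := by
  intro x hx y hy hxy
  obtain ⟨hx1, hx2, -, -⟩ := hρ x hx
  obtain ⟨hy1, hy2, hy3, -⟩ := hρ y hy
  have hmem := mem_Ioo_of_mem_β_s S hx hx1
  have hpos := H.gapV_strictMono S hmem hxy
  simp only [hx2] at hpos
  by_contra! hle
  rcases hle.eq_or_lt with he | hlt
  · rw [he, hy2] at hpos
    exact lt_irrefl _ hpos
  · exact lt_asymm hpos (hy3 _ ⟨hmem.1, hlt⟩)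

/-- At x = v₀ the function is negative on the whole open gap; by continuity in x it is still
negative at a given angle for x slightly larger, and negative values occur only before ρ. -/
lemma eventually_lt_sign_change
    (H : IsPencil ℓ t p q) (S : SlopeSigns ℓ p q (t (2 * ℓ)) v₀ v₁ m β s) (hρ : ∀ x ∈ Set.Ioo v₀ v₁,
    ρ x ∈ Set.Ioo (β x) (s x) ∧ gapV ℓ t p q x (ρ x) = 0 ∧
    (∀ θ ∈ Set.Ioo (t (2 * ℓ)) (ρ x), gapV ℓ t p q x θ < 0) ∧
    ∀ θ ∈ Set.Ioo (ρ x) Real.pi, 0 < gapV ℓ t p q x θ)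
    {b : ℝ} (hb : b < Real.pi) : ∀ᶠ x in 𝓝[>] v₀, b < ρ x := by
  have hm := S.m_mem
  -- The maximum with m keeps the test angle inside the gap even if `b` lies before it.
  set b' := max b m with hb'
  have hmem : b' ∈ Set.Ioo (t (2 * ℓ)) Real.pi :=
    ⟨hm.1.trans_le (le_max_right _ _), max_lt hb hm.2⟩
  have h1 : ∀ᶠ x in 𝓝 v₀, gapV ℓ t p q x b' < 0 :=
    (H.continuous_gapV hmem).continuousAt.eventually_lt continuousAt_const
      (H.gapV_neg_of_le_v₀ S le_rfl hmem)
  filter_upwards [h1.filter_mono nhdsWithin_le_nhds, Ioo_mem_nhdsGT S.v_lt] with x hx hx'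
  refine (le_max_left b m).trans_lt ?_
  obtain ⟨-, h2, -, h4⟩ := hρ x hx'
  by_contra! hle
  rcases hle.eq_or_lt with he | hlt
  · exact hx.ne (by rw [hb', ← he, h2])
  · exact lt_asymm hx (h4 _ ⟨hlt, hmem.2⟩)

lemma tendsto_sign_change
    (H : IsPencil ℓ t p q) (S : SlopeSigns ℓ p q (t (2 * ℓ)) v₀ v₁ m β s) (hρ : ∀ x ∈ Set.Ioo v₀ v₁,
    ρ x ∈ Set.Ioo (β x) (s x) ∧ gapV ℓ t p q x (ρ x) = 0 ∧
    (∀ θ ∈ Set.Ioo (t (2 * ℓ)) (ρ x), gapV ℓ t p q x θ < 0) ∧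
    ∀ θ ∈ Set.Ioo (ρ x) Real.pi, 0 < gapV ℓ t p q x θ) :
    Tendsto ρ (𝓝[>] v₀) (𝓝 Real.pi) ∧
    Tendsto s (𝓝[>] v₀) (𝓝 Real.pi) := by
  have h1 : ∀ᶠ x in 𝓝[>] v₀, ρ x < s x ∧ s x < Real.pi := by
    filter_upwards [Ioo_mem_nhdsGT S.v_lt] with x hx
    exact ⟨(hρ x hx).1.2, (S.s_mem x hx.1).2⟩
  constructor
  · rw [tendsto_order]
    refine ⟨fun b hb => H.eventually_lt_sign_change S hρ hb, fun b hb => ?_⟩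
    filter_upwards [h1] with x hx
    linarith
  · rw [tendsto_order]
    refine ⟨fun b hb => ?_, fun b hb => ?_⟩
    · filter_upwards [h1, H.eventually_lt_sign_change S hρ hb] with x hx hx'
      linarith
    · filter_upwards [h1] with x hx
      linarith

/-- Every point of the last gap is a zero of `gapV` for one parameter between `v₀` and `v₁`. -/
lemma exists_gapV_eq_zero (H : IsPencil ℓ t p q) (S : SlopeSigns ℓ p q (t (2 * ℓ)) v₀ v₁ m β s)
    {θ : ℝ} (hθ : θ ∈ Set.Ioo (t (2 * ℓ)) Real.pi) :
    ∃ x ∈ Set.Ioo v₀ v₁, gapV ℓ t p q x θ = 0 := by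
  -- At x = v₁ the descent before β has shrunk to nothing: the function rises from 0 at the left end
  -- up to s.
  have h1 : 0 < gapV ℓ t p q v₁ θ := by
    rcases le_or_gt (s v₁) θ with hs | hs
    · exact H.gapV_pos_of_s_le S S.v_lt hs hθ.2
    · have := H.nodes.gapPrimitive_lt (continuous_slope ℓ p q v₁) le_rfl hθ.1 hθ.2.le
        (fun φ hφ => by
          rcases le_or_gt φ m with hm | hm
          · exact S.slope_v₁ φ ⟨hφ.1, hm⟩
          · exact S.slope_m_s v₁ S.v_lt φ ⟨hm.le, hφ.2.trans hs⟩)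
      rwa [gapPrimitive_left] at this
  exact intermediate_value_Ioo S.v_lt.le (H.continuous_gapV hθ).continuousOn
    ⟨H.gapV_neg_of_le_v₀ S le_rfl hθ, h1⟩

end IsPencil

end DarkGas

/-! ### From the complex differentials to the real pencil -/

namespace DarkGas

open Finset MeasureTheory Filter Topology Complex

/-- The arguments of the endpoints of the bands and gaps in the closed upper half plane. -/
noncomputable def node (η : ℕ → ℂ) (ℓ j : ℕ) : ℝ :=
  if j = 0 then 0 else if j ≤ 2 * ℓ then (η j).arg else Real.pi

lemma node_eq_arg (η : ℕ → ℂ) {ℓ j : ℕ} (h1 : 1 ≤ j) (h2 : j ≤ 2 * ℓ) :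
    node η ℓ j = (η j).arg := by
  rw [node, if_neg (by omega), if_pos h2]

lemma IsSpectrum.isNodes {N : ℕ} {η : ℕ → ℂ} (hη : IsSpectrum N η) {ℓ : ℕ}
    (hℓ : ℓ ∈ Set.Icc 1 N) : IsNodes ℓ (node η ℓ) := by
  obtain ⟨h1, h2⟩ := hℓ
  refine ⟨by simp [node], by simp [node], fun j hj => ?_⟩
  rcases Nat.eq_zero_or_pos j with rfl | hj0
  · have h0 : node η ℓ 0 = 0 := by simp [node]
    rw [h0, node_eq_arg η (j := 0 + 1) (by omega) (by omega)]
    exact hη.arg_pos _ ⟨by omega, by omega⟩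
  · rw [node_eq_arg η hj0 hj]
    rcases hj.eq_or_lt with rfl | hlt
    · rw [node, if_neg (by omega), if_neg (by omega)]
      exact hη.arg_lt _ ⟨by omega, by omega⟩
    · rw [node_eq_arg η (by omega) (by omega)]
      exact hη.arg_strictMono ⟨by omega, by omega⟩ ⟨by omega, by omega⟩ (by omega)

lemma eq_exp_arg {z : ℂ} (hz : ‖z‖ = 1) : z = exp (z.arg * I) := by
  have := norm_mul_exp_arg_mul_I z
  rw [hz, ofReal_one, one_mul] at this
  exact this.symm

lemma IsSpectrum.eq_exp_node {N : ℕ} {η : ℕ → ℂ} (hη : IsSpectrum N η) {ℓ : ℕ}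
    (hℓ : ℓ ≤ N) : ∀ j ∈ Icc 1 (2 * ℓ), η j = exp (node η ℓ j * I) := by
  intro j hj
  rw [Finset.mem_Icc] at hj
  rw [node_eq_arg η hj.1 hj.2]
  exact eq_exp_arg (hη.norm_eq j ⟨hj.1, by omega⟩)

lemma node_eq_gapEnd (η : ℕ → ℂ) {ℓ k : ℕ} (hk : k ≤ ℓ) :
    node η ℓ (2 * k + 1) = gapEnd η ℓ k := by
  rw [node, if_neg (by omega), gapEnd]
  by_cases h : k < ℓ
  · rw [if_pos h, if_pos (by omega)]
  · rw [if_neg h, if_neg (by omega)]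

/-- The differentials `palindrome (ℓ + e) B z / (z^(e+1) R̂_ℓ(z)) dz`, of which `P̂_ℓ dz / R̂_ℓ` is
the case `e = 1` and `Q̂_ℓ dz / R̂_ℓ` the case `e = 2`. -/
noncomputable def density (η : ℕ → ℂ) (ℓ e : ℕ) (B : Fin (ℓ + e + 1) → ℝ) (z : ℂ) : ℂ :=
  palindrome (ℓ + e) B z / z ^ (e + 1) / Rhat η ℓ z

section Density

variable {ℓ : ℕ} {t : ℕ → ℝ} {η : ℕ → ℂ} {e : ℕ} {B : Fin (ℓ + e + 1) → ℝ}

/-- The powers of e^{iθ} cancel. The remaining unit is ±i on gaps (even `i`) and ±1 on bands (odd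
`i`), which decides what each arc contributes to the imaginary part. -/
lemma IsNodes.density_exp (h : IsNodes ℓ t) (hη : ∀ j ∈ Icc 1 (2 * ℓ), η j = exp (t j * I))
    {i : ℕ} (hi : i ≤ 2 * ℓ) {θ : ℝ} (hθ : θ ∈ Set.Ioo (t i) (t (i + 1))) :
    density η ℓ e B (exp (θ * I)) * (I * exp (θ * I)) = I * (-I) ^ i *
      (((2 ^ ℓ)⁻¹ * ((chebPoly (ℓ + e) B).eval (Real.cos θ) * weight ℓ t θ) : ℝ) : ℂ) := by
  have hw : (weight ℓ t θ : ℂ) ≠ 0 := ofReal_ne_zero.2 (h.weight_pos hi hθ).ne'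
  rw [density, exp_mul_chebPoly, h.Rhat_exp hη hi hθ]
  have he := Complex.exp_ne_zero (θ * I)
  have hI : (-I) ^ i * I ^ i = 1 := by
    rw [← mul_pow]; simp
  have hI0 : I ^ i ≠ 0 := pow_ne_zero _ I_ne_zero
  push_cast
  generalize exp (θ * I) = E at *
  generalize (weight ℓ t θ : ℂ) = W at *
  generalize hJ : (-I) ^ i = J at *
  generalize hK : I ^ i = K at *
  rw [pow_add, pow_succ]
  field_simp
  linear_combination (-(((chebPoly (ℓ + e) B).eval (Real.cos θ) : ℝ) : ℂ)) * hI

lemma IsNodes.density_exp_neg (h : IsNodes ℓ t) (hη : ∀ j ∈ Icc 1 (2 * ℓ), η j = exp (t j * I))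
    {i : ℕ} (hi : i ≤ 2 * ℓ) {θ : ℝ} (hθ : θ ∈ Set.Ioo (t i) (t (i + 1))) :
    density η ℓ e B (exp ((-θ : ℝ) * I)) * (I * exp ((-θ : ℝ) * I)) = I * I ^ i *
      (((2 ^ ℓ)⁻¹ * ((chebPoly (ℓ + e) B).eval (Real.cos θ) * weight ℓ t θ) : ℝ) : ℂ) := by
  have h1 : density η ℓ e B (exp ((-θ : ℝ) * I)) =
      starRingEnd ℂ (density η ℓ e B (exp (θ * I))) := by
    rw [density, density, map_div₀, map_div₀, map_pow, conj_palindrome, conj_exp_mul_I,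
      h.Rhat_exp_neg hη hi hθ]
  have h2 := congrArg (starRingEnd ℂ) (h.density_exp (e := e) (B := B) hη hi hθ)
  rw [map_mul, map_mul, map_mul, map_mul, map_pow, map_neg, conj_I, conj_ofReal, conj_exp_mul_I,
    ← h1, neg_neg] at h2
  linear_combination -h2

lemma IsNodes.intervalIntegrable_density (h : IsNodes ℓ t)
    (hη : ∀ j ∈ Icc 1 (2 * ℓ), η j = exp (t j * I)) {i : ℕ} (hi : i ≤ 2 * ℓ) {θ : ℝ}
    (hθ : θ ∈ Set.Icc (t i) (t (i + 1))) :
    IntervalIntegrable (fun φ : ℝ => density η ℓ e B (exp (φ * I)) * (I * exp (φ * I))) volume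
      (t i) θ := by
  have hI := h.intervalIntegrable_mul_weight (continuous_eval_cos (chebPoly (ℓ + e) B))
    (h.mem_Icc (show i ≤ 2 * ℓ + 1 by omega)) (b := θ)
    ⟨(h.nonneg (by omega)).trans hθ.1, hθ.2.trans (h.le_pi (by omega))⟩
  have hI' : IntervalIntegrable (fun φ => (((2 ^ ℓ)⁻¹ *
      ((chebPoly (ℓ + e) B).eval (Real.cos φ) * weight ℓ t φ) : ℝ) : ℂ)) volume (t i) θ :=
    ⟨(hI.const_mul _).1.ofReal, (hI.const_mul _).2.ofReal⟩
  refine (hI'.const_mul (I * (-I) ^ i)).congr_uIoo fun φ hφ => ?_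
  rw [Set.uIoo_of_le hθ.1] at hφ
  exact (h.density_exp hη hi ⟨hφ.1, hφ.2.trans_le hθ.2⟩).symm

lemma IsNodes.arcIntegral_density (h : IsNodes ℓ t)
    (hη : ∀ j ∈ Icc 1 (2 * ℓ), η j = exp (t j * I)) {i : ℕ} (hi : i ≤ 2 * ℓ) {θ : ℝ}
    (hθ : θ ∈ Set.Icc (t i) (t (i + 1))) :
    arcIntegral (density η ℓ e B) (t i) θ = I * (-I) ^ i * (((2 ^ ℓ)⁻¹ *
      ∫ φ in t i..θ, (chebPoly (ℓ + e) B).eval (Real.cos φ) * weight ℓ t φ : ℝ) : ℂ) := by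
  rw [arcIntegral, intervalIntegral.integral_congr_Ioo_of_le hθ.1
    (fun φ hφ => h.density_exp hη hi ⟨hφ.1, hφ.2.trans_le hθ.2⟩),
    intervalIntegral.integral_const_mul, intervalIntegral.integral_ofReal,
    intervalIntegral.integral_const_mul]

lemma IsNodes.arcIntegral_density_neg (h : IsNodes ℓ t)
    (hη : ∀ j ∈ Icc 1 (2 * ℓ), η j = exp (t j * I)) {i : ℕ} (hi : i ≤ 2 * ℓ) :
    arcIntegral (density η ℓ e B) (-t (i + 1)) (-t i) = I * I ^ i * (((2 ^ ℓ)⁻¹ *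
      ∫ φ in t i..t (i + 1), (chebPoly (ℓ + e) B).eval (Real.cos φ) * weight ℓ t φ : ℝ) : ℂ) := by
  rw [arcIntegral, ← intervalIntegral.integral_comp_neg,
    intervalIntegral.integral_congr_Ioo_of_le (h.lt i hi).le
    (fun φ hφ => h.density_exp_neg hη hi hφ),
    intervalIntegral.integral_const_mul, intervalIntegral.integral_ofReal,
    intervalIntegral.integral_const_mul]

end Density

lemma gapIntegralsVanish_density_iff {N : ℕ} {η : ℕ → ℂ} (hη : IsSpectrum N η) {ℓ : ℕ}
    (hℓ : ℓ ∈ Set.Icc 1 N) {e : ℕ} {B : Fin (ℓ + e + 1) → ℝ} :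
    GapIntegralsVanish η ℓ (density η ℓ e B) ↔
      ∀ k ∈ Set.Icc 1 ℓ, gapIntegral ℓ (node η ℓ) (chebPoly (ℓ + e) B) k = 0 := by
  have h := hη.isNodes hℓ
  have hη' := hη.eq_exp_node hℓ.2
  refine forall₂_congr fun k hk => ?_
  have hle : node η ℓ (2 * k) ≤ node η ℓ (2 * k + 1) := (h.lt _ (by have := hk.2; omega)).le
  rw [← node_eq_gapEnd η hk.2, ← node_eq_arg η (ℓ := ℓ) (j := 2 * k) (by have := hk.1; omega)
    (by have := hk.2; omega), h.arcIntegral_density hη' (by have := hk.2; omega) ⟨hle, le_rfl⟩,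
    h.arcIntegral_density_neg hη' (by have := hk.2; omega)]
  simp only [gapIntegral]
  constructor
  · rintro ⟨h1, -⟩
    rw [mul_eq_zero] at h1
    rcases h1 with h1 | h1
    · exact absurd h1 (mul_ne_zero I_ne_zero (pow_ne_zero _ (neg_ne_zero.2 I_ne_zero)))
    · rw [ofReal_eq_zero] at h1
      exact (mul_eq_zero.1 h1).resolve_left (by positivity)
  · intro h1
    simp [h1]

/-- The prescribed coefficients and the gap conditions together form a square linear system of size
ℓ + e + 1; injectivity by root counting makes it bijective. -/
lemma IsNodes.existsUnique_coeffs {ℓ : ℕ} (hℓ : 1 ≤ ℓ) {t : ℕ → ℝ} (h : IsNodes ℓ t) (e : ℕ)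
    (v : Fin (ℓ + e + 1) → ℝ) :
    ∃! B : Fin (ℓ + e + 1) → ℝ, (∀ i : Fin (ℓ + e + 1), (i : ℕ) ≤ e → B i = v i) ∧
      ∀ k ∈ Set.Icc 1 ℓ, gapIntegral ℓ t (chebPoly (ℓ + e) B) k = 0 := by
  have hadd : ∀ k ≤ ℓ, ∀ p q : Polynomial ℝ,
      gapIntegral ℓ t (p + q) k = gapIntegral ℓ t p k + gapIntegral ℓ t q k := fun k hk p q => by
    have := gapIntegral_mul_add_mul h 1 1 p q hk
    simpa using this
  have hsmul : ∀ k ≤ ℓ, ∀ (c : ℝ) (p : Polynomial ℝ),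
      gapIntegral ℓ t (c • p) k = c * gapIntegral ℓ t p k := fun k hk c p => by
    have := gapIntegral_mul_add_mul h c 0 p 0 hk
    simpa [Polynomial.smul_eq_C_mul] using this
  let Φ : (Fin (ℓ + e + 1) → ℝ) →ₗ[ℝ] (Fin (ℓ + e + 1) → ℝ) :=
    { toFun := fun B i => if (i : ℕ) ≤ e then B i else
        gapIntegral ℓ t (chebPoly (ℓ + e) B) ((i : ℕ) - e)
      map_add' := fun B C => by
        funext i
        have := i.2
        by_cases hi : (i : ℕ) ≤ e
        · simp [hi]
        · simp only [hi, if_false, Pi.add_apply]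
          rw [chebPoly_add, hadd _ (by omega)]
      map_smul' := fun c B => by
        funext i
        have := i.2
        by_cases hi : (i : ℕ) ≤ e
        · simp [hi]
        · simp only [hi, if_false, Pi.smul_apply, smul_eq_mul, RingHom.id_apply]
          rw [chebPoly_smul, hsmul _ (by omega)] }
  have hΦ : ∀ B i, Φ B i = if (i : ℕ) ≤ e then B i else
      gapIntegral ℓ t (chebPoly (ℓ + e) B) ((i : ℕ) - e) := fun _ _ => rfl
  have hinj : Function.Injective Φ := by
    rw [injective_iff_map_eq_zero]
    intro B hB
    refine eq_zero_of_chebPoly_eq_zero (h.eq_zero_of_gapIntegral ?_ ?_)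
    -- With the coefficients of index 0 to e equal to 0, the degree is at most ℓ + e - (e + 1) = ℓ -
    -- 1, below the number ℓ of gap conditions.
    · have := (chebPoly_coeff (B := B) (j := ⟨e + 1, by omega⟩) (fun i hi => by
        have hi' : (i : ℕ) ≤ e := Nat.lt_succ_iff.1 hi
        have := congrFun hB i
        rwa [hΦ, if_pos hi'] at this)).1
      refine this.trans_lt ?_
      simp only
      omega
    · intro k hk
      rw [Finset.mem_Icc] at hk
      have := congrFun hB ⟨k + e, by omega⟩
      rw [hΦ, if_neg (by simp only; omega)] at this
      simpa using this
  have hsurj : Function.Surjective Φ := LinearMap.injective_iff_surjective.1 hinj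
  have hiff : ∀ B, Φ B = (fun i : Fin (ℓ + e + 1) => if (i : ℕ) ≤ e then v i else 0) ↔
      (∀ i : Fin (ℓ + e + 1), (i : ℕ) ≤ e → B i = v i) ∧
      ∀ k ∈ Set.Icc 1 ℓ, gapIntegral ℓ t (chebPoly (ℓ + e) B) k = 0 := by
    intro B
    constructor
    · intro hB
      refine ⟨fun i hi => ?_, fun k hk => ?_⟩
      · have := congrFun hB i
        simpa only [hΦ, if_pos hi] using this
      · obtain ⟨hk1, hk2⟩ := hk
        have := congrFun hB ⟨k + e, by omega⟩
        rw [hΦ, if_neg (by simp only; omega), if_neg (by simp only; omega)] at this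
        simpa using this
    · rintro ⟨h1, h2⟩
      funext i
      have := i.2
      rw [hΦ]
      by_cases hi : (i : ℕ) ≤ e
      · rw [if_pos hi, if_pos hi, h1 i hi]
      · rw [if_neg hi, if_neg hi, h2 _ ⟨by omega, by omega⟩]
  obtain ⟨B, hB⟩ := hsurj (fun i : Fin (ℓ + e + 1) => if (i : ℕ) ≤ e then v i else 0)
  exact ⟨B, (hiff B).1 hB, fun B' hB' => hinj (((hiff B').2 hB').trans hB.symm)⟩

lemma log_exp_mul_I {θ : ℝ} (hθ : θ ∈ Set.Ioc (-Real.pi) Real.pi) :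
    log (exp (θ * I)) = θ * I :=
  log_exp (by simpa using hθ.1) (by simpa using hθ.2)

/-- Between two points of the unit circle the logarithms are imaginary, so the spiral is the arc
traversed at constant speed. -/
lemma spiralIntegral_exp (F : ℂ → ℂ) {a θ : ℝ} (ha : a ∈ Set.Ioc (-Real.pi) Real.pi)
    (hθ : θ ∈ Set.Ioc (-Real.pi) Real.pi) :
    spiralIntegral F (exp (a * I)) (exp (θ * I)) = arcIntegral F a θ := by
  have hs : ∀ u : ℝ, spiral (exp (a * I)) (exp (θ * I)) u =
      exp (((θ - a) * u + a : ℝ) * I) := fun u => by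
    rw [spiral, log_exp_mul_I ha, log_exp_mul_I hθ]
    congr 1
    push_cast
    ring
  rw [spiralIntegral, arcIntegral, log_exp_mul_I ha, log_exp_mul_I hθ]
  have := intervalIntegral.smul_integral_comp_mul_add (a := 0) (b := 1)
    (fun φ : ℝ => F (exp (φ * I)) * (I * exp (φ * I))) (θ - a) a
  rw [mul_zero, zero_add, mul_one, sub_add_cancel] at this
  rw [← this, ← intervalIntegral.integral_smul]
  congr 1
  funext u
  rw [hs, real_smul]
  push_cast
  ring

/-- Up to η_{2ℓ} the imaginary part does not change: bands contribute real integrals and the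
complete gaps contribute 0. Hence V may be started at η_{2ℓ} as far as Im V on the last gap is
concerned. -/
lemma IsNodes.arcIntegral_density_im {ℓ : ℕ} (hℓ : 1 ≤ ℓ) {t : ℕ → ℝ} (h : IsNodes ℓ t)
    {η : ℕ → ℂ} (hη : ∀ j ∈ Icc 1 (2 * ℓ), η j = exp (t j * I)) {e : ℕ}
    {B : Fin (ℓ + e + 1) → ℝ}
    (hB : ∀ k ∈ Set.Icc 1 ℓ, gapIntegral ℓ t (chebPoly (ℓ + e) B) k = 0) {θ : ℝ}
    (hθ : θ ∈ Set.Icc (t (2 * ℓ)) Real.pi) :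
    (arcIntegral (density η ℓ e B) (t 1) θ).im =
      gapPrimitive ℓ t (fun φ => (-1) ^ ℓ * (chebPoly (ℓ + e) B).eval (Real.cos φ)) θ := by
  have hθ' : θ ∈ Set.Icc (t (2 * ℓ)) (t (2 * ℓ + 1)) := by rwa [h.last]
  have hInt : ∀ k ∈ Set.Ico 1 (2 * ℓ), IntervalIntegrable
      (fun φ : ℝ => density η ℓ e B (exp (φ * I)) * (I * exp (φ * I))) volume
      (t k) (t (k + 1)) := fun k hk =>
    h.intervalIntegrable_density hη hk.2.le ⟨(h.lt k hk.2.le).le, le_rfl⟩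
  have hsum := intervalIntegral.sum_integral_adjacent_intervals_Ico (μ := volume)
    (show 1 ≤ 2 * ℓ by omega) hInt
  have hfirst : (arcIntegral (density η ℓ e B) (t 1) (t (2 * ℓ))).im = 0 := by
    rw [arcIntegral, ← hsum, im_sum]
    refine Finset.sum_eq_zero fun k hk => ?_
    rw [Finset.mem_Ico] at hk
    have := h.arcIntegral_density (e := e) (B := B) hη hk.2.le ⟨(h.lt k hk.2.le).le, le_rfl⟩
    rw [arcIntegral] at this
    rw [this]
    rcases Nat.even_or_odd' k with ⟨j, rfl | rfl⟩
    · have h0 := hB j ⟨by omega, by omega⟩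
      rw [gapIntegral] at h0
      simp [h0]
    · have : I * (-I) ^ (2 * j + 1) = (((-1) ^ j : ℝ) : ℂ) := by
        rw [pow_succ, pow_mul, neg_sq, I_sq]
        push_cast
        linear_combination (-(-1) ^ j) * I_sq
      rw [this, ← ofReal_mul, ofReal_im]
  have hadd : arcIntegral (density η ℓ e B) (t 1) θ =
      arcIntegral (density η ℓ e B) (t 1) (t (2 * ℓ)) +
        arcIntegral (density η ℓ e B) (t (2 * ℓ)) θ := by
    rw [arcIntegral, arcIntegral, arcIntegral]
    exact (intervalIntegral.integral_add_adjacent_intervals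
      (IntervalIntegrable.trans_iterate_Ico (show 1 ≤ 2 * ℓ by omega) hInt)
      (h.intervalIntegrable_density hη le_rfl hθ')).symm
  rw [hadd, add_im, hfirst, zero_add, h.arcIntegral_density hη le_rfl hθ', pow_mul, neg_sq, I_sq,
    gapPrimitive]
  have e1 : I * (-1) ^ ℓ * (((2 ^ ℓ)⁻¹ *
      ∫ φ in t (2 * ℓ)..θ, (chebPoly (ℓ + e) B).eval (Real.cos φ) * weight ℓ t φ : ℝ) : ℂ) =
      (((-1) ^ ℓ * ((2 ^ ℓ)⁻¹ *
      ∫ φ in t (2 * ℓ)..θ, (chebPoly (ℓ + e) B).eval (Real.cos φ) * weight ℓ t φ) : ℝ) : ℂ) *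
        I := by
    push_cast; ring
  rw [e1, im_ofReal_mul, I_im, mul_one]
  simp only [mul_assoc, intervalIntegral.integral_const_mul]
  ring

end DarkGas

/-! ### Coefficients, Im V and transition values in terms of the pencil -/

namespace DarkGas

open Finset MeasureTheory Filter Topology Complex

section Coeffs

variable {N : ℕ} {η : ℕ → ℂ} {ℓ : ℕ}

lemma IsSpectrum.sum_re (hη : IsSpectrum N η) (hℓ : ℓ ≤ N) :
    ∑ j ∈ Icc 1 (2 * ℓ), (η j).re = ∑ j ∈ Icc 1 (2 * ℓ), Real.cos (node η ℓ j) :=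
  Finset.sum_congr rfl fun j hj => by
    conv_lhs => rw [hη.eq_exp_node hℓ j hj, exp_ofReal_mul_I_re]

lemma IsSpectrum.second_coeff (hη : IsSpectrum N η) (hℓ : ℓ ≤ N) :
    1 / 8 * ((∑ j ∈ Icc 1 (2 * ℓ), 2 * (η j).re) ^ 2 -
      2 * ∑ j ∈ Icc 1 (2 * ℓ), 2 * (η j ^ 2).re) =
    (∑ j ∈ Icc 1 (2 * ℓ), Real.cos (node η ℓ j)) ^ 2 / 2 -
      ∑ j ∈ Icc 1 (2 * ℓ), Real.cos (node η ℓ j) ^ 2 + ℓ := by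
  have h2 : ∑ j ∈ Icc 1 (2 * ℓ), 2 * (η j ^ 2).re =
      ∑ j ∈ Icc 1 (2 * ℓ), (4 * Real.cos (node η ℓ j) ^ 2 - 2) :=
    Finset.sum_congr rfl fun j hj => by
      have := hη.eq_exp_node hℓ j hj
      rw [congrArg (fun z : ℂ => (z ^ 2).re) this, ← Complex.exp_nat_mul, ← mul_assoc,
        show ((2 : ℕ) : ℂ) * (node η ℓ j : ℂ) = ((2 * node η ℓ j : ℝ) : ℂ) by push_cast; ring,
        exp_ofReal_mul_I_re, Real.cos_two_mul]
      ring
  rw [← Finset.mul_sum, hη.sum_re hℓ, h2, Finset.sum_sub_distrib, ← Finset.mul_sum]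
  simp only [sum_const, Nat.card_Icc, add_tsub_cancel_right, nsmul_eq_mul]
  push_cast
  ring

lemma isFirstCoeffs_iff (hη : IsSpectrum N η) (hℓ : ℓ ∈ Set.Icc 1 N) {B : Fin (ℓ + 2) → ℝ} :
    IsFirstCoeffs η ℓ B ↔ (B 0 = 1 ∧ B 1 = -∑ j ∈ Icc 1 (2 * ℓ), Real.cos (node η ℓ j)) ∧
      ∀ k ∈ Set.Icc 1 ℓ, gapIntegral ℓ (node η ℓ) (chebPoly (ℓ + 1) B) k = 0 := by
  rw [← gapIntegralsVanish_density_iff hη hℓ, ← hη.sum_re hℓ.2]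
  exact ⟨fun h => ⟨⟨h.zero, h.one⟩, h.gaps⟩, fun h => ⟨h.1.1, h.1.2, h.2⟩⟩

lemma isSecondCoeffs_iff (hη : IsSpectrum N η) (hℓ : ℓ ∈ Set.Icc 1 N) {C : Fin (ℓ + 3) → ℝ} :
    IsSecondCoeffs η ℓ C ↔ (C 0 = 1 ∧ C 1 = -∑ j ∈ Icc 1 (2 * ℓ), Real.cos (node η ℓ j) ∧
      C 2 = (∑ j ∈ Icc 1 (2 * ℓ), Real.cos (node η ℓ j)) ^ 2 / 2 -
        ∑ j ∈ Icc 1 (2 * ℓ), Real.cos (node η ℓ j) ^ 2 + ℓ) ∧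
      ∀ k ∈ Set.Icc 1 ℓ, gapIntegral ℓ (node η ℓ) (chebPoly (ℓ + 2) C) k = 0 := by
  rw [← gapIntegralsVanish_density_iff hη hℓ, ← hη.second_coeff hℓ.2, ← hη.sum_re hℓ.2]
  exact ⟨fun h => ⟨⟨h.zero, h.one, h.two⟩, h.gaps⟩, fun h => ⟨h.1.1, h.1.2.1, h.1.2.2, h.2⟩⟩

lemma existsUnique_isFirstCoeffs (hη : IsSpectrum N η) (hℓ : ℓ ∈ Set.Icc 1 N) :
    ∃! B : Fin (ℓ + 2) → ℝ, IsFirstCoeffs η ℓ B := by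
  have h := (hη.isNodes hℓ).existsUnique_coeffs hℓ.1 1 (fun i => if (i : ℕ) = 0 then 1 else
    -∑ j ∈ Icc 1 (2 * ℓ), Real.cos (node η ℓ j))
  refine (existsUnique_congr fun B => ?_).1 h
  rw [isFirstCoeffs_iff hη hℓ]
  refine and_congr ⟨fun h => ⟨?_, ?_⟩, fun h i hi => ?_⟩ Iff.rfl
  · simpa using h 0 (by simp)
  · simpa using h 1 (by simp)
  · rcases Nat.le_one_iff_eq_zero_or_eq_one.1 hi with hi' | hi'
    · obtain rfl : i = 0 := Fin.ext hi'
      simpa using h.1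
    · obtain rfl : i = 1 := Fin.ext (by simpa using hi')
      simpa using h.2

lemma existsUnique_isSecondCoeffs (hη : IsSpectrum N η) (hℓ : ℓ ∈ Set.Icc 1 N) :
    ∃! C : Fin (ℓ + 3) → ℝ, IsSecondCoeffs η ℓ C := by
  have h := (hη.isNodes hℓ).existsUnique_coeffs hℓ.1 2 (fun i => if (i : ℕ) = 0 then 1 else
    if (i : ℕ) = 1 then -∑ j ∈ Icc 1 (2 * ℓ), Real.cos (node η ℓ j) else
      (∑ j ∈ Icc 1 (2 * ℓ), Real.cos (node η ℓ j)) ^ 2 / 2 -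
        ∑ j ∈ Icc 1 (2 * ℓ), Real.cos (node η ℓ j) ^ 2 + ℓ)
  have h2 : ((2 : Fin (ℓ + 2 + 1)) : ℕ) = 2 :=
    Nat.mod_eq_of_lt (show 2 < ℓ + 2 + 1 by omega)
  refine (existsUnique_congr fun B => ?_).1 h
  rw [isSecondCoeffs_iff hη hℓ]
  refine and_congr ⟨fun h => ⟨?_, ?_, ?_⟩, fun h i hi => ?_⟩ Iff.rfl
  · simpa using h 0 (by simp)
  · simpa using h 1 (by simp)
  · have := h 2 h2.le
    rwa [h2, if_neg (by omega), if_neg (by omega)] at this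
  · obtain hi' | hi' | hi' : (i : ℕ) = 0 ∨ (i : ℕ) = 1 ∨ (i : ℕ) = 2 := by omega
    · obtain rfl : i = 0 := Fin.ext hi'
      simpa using h.1
    · obtain rfl : i = 1 := Fin.ext (by simpa using hi')
      simpa using h.2.1
    · obtain rfl : i = 2 := Fin.ext (hi'.trans h2.symm)
      rw [h2, if_neg (by omega), if_neg (by omega)]
      exact h.2.2

lemma isPencil_of_coeffs (hη : IsSpectrum N η) (hℓ : ℓ ∈ Set.Icc 1 N) {B : Fin (ℓ + 2) → ℝ}
    {C : Fin (ℓ + 3) → ℝ} (hB : IsFirstCoeffs η ℓ B) (hC : IsSecondCoeffs η ℓ C) :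
    IsPencil ℓ (node η ℓ) (chebPoly (ℓ + 1) B) (chebPoly (ℓ + 2) C) := by
  have h := hη.isNodes hℓ
  obtain ⟨⟨hB0, hB1⟩, hB2⟩ := (isFirstCoeffs_iff hη hℓ).1 hB
  obtain ⟨⟨hC0, hC1, hC2⟩, hC3⟩ := (isSecondCoeffs_iff hη hℓ).1 hC
  exact ⟨h, (chebPoly_natDegree_of_zero hB0).1, (chebPoly_natDegree_of_zero hC0).1,
    (chebPoly_natDegree_of_zero hB0).2, (chebPoly_natDegree_of_zero hC0).2,
    h.gap_integrals_first hℓ.1 hB0 hB1 hB2, h.gap_integrals_second hC0 hC1 hC2 hC3⟩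

lemma im_V_exp (hη : IsSpectrum N η) (hℓ : ℓ ∈ Set.Icc 1 N) {B : Fin (ℓ + 2) → ℝ}
    {C : Fin (ℓ + 3) → ℝ} (hB : IsFirstCoeffs η ℓ B) (hC : IsSecondCoeffs η ℓ C) (ξ : ℝ) {θ : ℝ}
    (hθ : θ ∈ Set.Ioo (η (2 * ℓ)).arg Real.pi) :
    (V η ℓ B C ξ (exp (θ * I))).im =
      gapV ℓ (node η ℓ) (chebPoly (ℓ + 1) B) (chebPoly (ℓ + 2) C) (ξ / 2) θ := by
  have H := isPencil_of_coeffs hη hℓ hB hC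
  have h := H.nodes
  have hη' := hη.eq_exp_node hℓ.2
  have h1 := hℓ.1
  rw [← node_eq_arg η (ℓ := ℓ) (by omega) le_rfl] at hθ
  have hθ' : θ ∈ Set.Icc (node η ℓ (2 * ℓ)) Real.pi := ⟨hθ.1.le, hθ.2.le⟩
  have ht1 : node η ℓ 1 ∈ Set.Ioc (-Real.pi) Real.pi :=
    ⟨by linarith [Real.pi_pos, h.nonneg (show 1 ≤ 2 * ℓ + 1 by omega)], h.le_pi (by omega)⟩
  have hθπ : θ ∈ Set.Ioc (-Real.pi) Real.pi :=
    ⟨by linarith [Real.pi_pos, hθ.1, h.nonneg (show 2 * ℓ ≤ 2 * ℓ + 1 by omega)], hθ.2.le⟩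
  have e1 : phi1 η ℓ B (exp (θ * I)) = arcIntegral (density η ℓ 1 B) (node η ℓ 1) θ := by
    rw [phi1, hη' 1 (Finset.mem_Icc.2 ⟨le_rfl, by omega⟩), spiralIntegral_exp _ ht1 hθπ]
    rfl
  have e2 : phi2 η ℓ C (exp (θ * I)) = arcIntegral (density η ℓ 2 C) (node η ℓ 1) θ := by
    rw [phi2, hη' 1 (Finset.mem_Icc.2 ⟨le_rfl, by omega⟩), spiralIntegral_exp _ ht1 hθπ]
    rfl
  rw [V, e1, e2, sub_im, show (ξ : ℂ) / 2 = ((ξ / 2 : ℝ) : ℂ) by push_cast; rfl, im_ofReal_mul,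
    h.arcIntegral_density_im h1 hη' ((isFirstCoeffs_iff hη hℓ).1 hB).2 hθ',
    h.arcIntegral_density_im h1 hη' ((isSecondCoeffs_iff hη hℓ).1 hC).2 hθ', H.gapV_eq _ hθ']

/-- After division by their powers of z, both numerators carry the same factor z^{ℓ-1}, which
cancels and leaves a real quotient. -/
lemma xiEven_eq (hη : IsSpectrum N η) (hℓ : ℓ ∈ Set.Icc 1 N) (B : Fin (ℓ + 2) → ℝ)
    (C : Fin (ℓ + 3) → ℝ) : xiEven η ℓ B C =
      2 * ((chebPoly (ℓ + 2) C).eval (Real.cos (node η ℓ (2 * ℓ))) /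
        (chebPoly (ℓ + 1) B).eval (Real.cos (node η ℓ (2 * ℓ)))) := by
  have h1 := hℓ.1
  rw [xiEven, hη.eq_exp_node hℓ.2 _ (Finset.mem_Icc.2 ⟨by omega, le_rfl⟩), Qhat, Phat,
    exp_mul_chebPoly, exp_mul_chebPoly, ← ofReal_re (2 * _)]
  congr 1
  have he := Complex.exp_ne_zero (node η ℓ (2 * ℓ) * I)
  push_cast
  generalize exp (node η ℓ (2 * ℓ) * I) = E at *
  have e2 : ∀ b : ℂ, E ^ (ℓ + 1) * b / E ^ 2 = E ^ ℓ / E * b := fun b => by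
    rw [pow_succ]; field_simp
  have e3 : ∀ b : ℂ, E ^ (ℓ + 2) * b / E ^ 3 = E ^ ℓ / E * b := fun b => by
    rw [pow_add]; field_simp
  rw [e2, e3, mul_left_comm, mul_div_mul_left _ _ (div_ne_zero (pow_ne_zero _ he) he),
    mul_div_assoc]

lemma xiOdd_eq (hη : IsSpectrum N η) (hℓ : ℓ ∈ Set.Icc 1 N) (B : Fin (ℓ + 2) → ℝ)
    (C : Fin (ℓ + 3) → ℝ) {θ : ℝ} (hθ : θ ∈ Set.Ioo (η (2 * ℓ)).arg Real.pi)
    (harg : (η (2 * ℓ + 1)).arg = θ) : xiOdd η ℓ B C =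
      2 * (gapPrimitive ℓ (node η ℓ)
          (fun φ => (-1) ^ ℓ * (chebPoly (ℓ + 2) C).eval (Real.cos φ)) θ /
        gapPrimitive ℓ (node η ℓ)
          (fun φ => (-1) ^ ℓ * (chebPoly (ℓ + 1) B).eval (Real.cos φ)) θ) := by
  have h := hη.isNodes hℓ
  have h1 := hℓ.1
  rw [← node_eq_arg η (ℓ := ℓ) (by omega) le_rfl] at hθ
  have hθ' : θ ∈ Set.Icc (node η ℓ (2 * ℓ)) (node η ℓ (2 * ℓ + 1)) := by
    rw [h.last]; exact ⟨hθ.1.le, hθ.2.le⟩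
  have key : ∀ (e : ℕ) (D : Fin (ℓ + e + 1) → ℝ),
      arcIntegral (density η ℓ e D) (node η ℓ (2 * ℓ)) θ = I * ((gapPrimitive ℓ (node η ℓ)
        (fun φ => (-1) ^ ℓ * (chebPoly (ℓ + e) D).eval (Real.cos φ)) θ : ℝ) : ℂ) := fun e D => by
    rw [h.arcIntegral_density (hη.eq_exp_node hℓ.2) le_rfl hθ', gapPrimitive]
    simp only [mul_assoc, intervalIntegral.integral_const_mul]
    rw [pow_mul, neg_sq, I_sq]
    push_cast
    ring
  have eC : (fun z => Qhat ℓ C z / Rhat η ℓ z) = density η ℓ 2 C := rfl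
  have eB : (fun z => Phat ℓ B z / Rhat η ℓ z) = density η ℓ 1 B := rfl
  rw [xiOdd, harg, ← node_eq_arg η (ℓ := ℓ) (by omega) le_rfl, eC, eB, key, key, mul_left_comm,
    mul_div_mul_left _ _ I_ne_zero, mul_div_assoc, ← ofReal_div, ← ofReal_ofNat, ← ofReal_mul,
    ofReal_re]

lemma arg_exp_of_mem {θ : ℝ} (hθ : θ ∈ Set.Ioo (η (2 * ℓ)).arg Real.pi) :
    (exp (θ * I)).arg = θ := by
  rw [arg_exp_mul_I, toIocMod_eq_self]
  exact ⟨(neg_pi_lt_arg _).trans hθ.1, by linarith [hθ.2]⟩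

lemma mem_lastGap_iff {z : ℂ} : z ∈ lastGap η ℓ ↔
    ∃ θ ∈ Set.Ioo (η (2 * ℓ)).arg Real.pi, z = exp (θ * I) := by
  constructor
  · rintro ⟨h1, h2, h3⟩
    exact ⟨z.arg, ⟨h2, h3⟩, eq_exp_arg h1⟩
  · rintro ⟨θ, hθ, rfl⟩
    have := arg_exp_of_mem hθ
    exact ⟨norm_exp_ofReal_mul_I θ, by rw [this]; exact hθ.1, by rw [this]; exact hθ.2⟩

end Coeffs

end DarkGas

/-! ### The theorem -/

open DarkGas

theorem mainTheorem6 (N : ℕ) (η : ℕ → ℂ) (hη : IsSpectrum N η) (ℓ : ℕ) (hℓ : ℓ ∈ Set.Icc 1 N) :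
    (∃! B : Fin (ℓ + 2) → ℝ, IsFirstCoeffs η ℓ B) ∧
    (∃! C : Fin (ℓ + 3) → ℝ, IsSecondCoeffs η ℓ C) ∧
    ∀ (B : Fin (ℓ + 2) → ℝ) (C : Fin (ℓ + 3) → ℝ), IsFirstCoeffs η ℓ B → IsSecondCoeffs η ℓ C →
      ∃ ξ₀ < xiEven η ℓ B C, ∃ ρ s β : ℝ → ℂ,
        -- regularity along the gap, and the minimum, for all `ξ < ξ_{2ℓ}`
        (∀ ξ < xiEven η ℓ B C,
          ContDiffOn ℝ 2 (imV η ℓ B C ξ) (Set.Ioo (η (2 * ℓ)).arg Real.pi) ∧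
          β ξ ∈ lastGap η ℓ ∧
          (V η ℓ B C ξ (β ξ)).im < 0 ∧
          (∀ z ∈ lastGap η ℓ, z ≠ β ξ → (V η ℓ B C ξ (β ξ)).im < (V η ℓ B C ξ z).im) ∧
          deriv (imV η ℓ B C ξ) (β ξ).arg = 0 ∧
          0 < deriv (deriv (imV η ℓ B C ξ)) (β ξ).arg) ∧
        -- the sign change and the maximum, for `ξ₀ < ξ < ξ_{2ℓ}`
        (∀ ξ ∈ Set.Ioo ξ₀ (xiEven η ℓ B C),
          ρ ξ ∈ lastGap η ℓ ∧ s ξ ∈ lastGap η ℓ ∧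
          (β ξ).arg < (ρ ξ).arg ∧ (ρ ξ).arg < (s ξ).arg ∧
          (V η ℓ B C ξ (ρ ξ)).im = 0 ∧
          (∀ z ∈ lastGap η ℓ, z.arg < (ρ ξ).arg → (V η ℓ B C ξ z).im < 0) ∧
          (∀ z ∈ lastGap η ℓ, (ρ ξ).arg < z.arg → 0 < (V η ℓ B C ξ z).im) ∧
          0 < (V η ℓ B C ξ (s ξ)).im ∧
          (∀ z ∈ lastGap η ℓ, z ≠ s ξ → (V η ℓ B C ξ z).im < (V η ℓ B C ξ (s ξ)).im) ∧
          deriv (imV η ℓ B C ξ) (s ξ).arg = 0 ∧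
          deriv (deriv (imV η ℓ B C ξ)) (s ξ).arg < 0 ∧
          ∀ z ∈ lastGap η ℓ, deriv (imV η ℓ B C ξ) z.arg = 0 → z = β ξ ∨ z = s ξ) ∧
        -- after the collision at `-1` the sign change and the maximum have disappeared
        (∀ ξ ≤ ξ₀, ∀ z ∈ lastGap η ℓ, (V η ℓ B C ξ z).im < 0 ∧
          (deriv (imV η ℓ B C ξ) z.arg = 0 → z = β ξ)) ∧
        -- monotonicity and limits
        StrictAntiOn (fun ξ => (β ξ).arg) (Set.Iio (xiEven η ℓ B C)) ∧
        StrictAntiOn (fun ξ => (s ξ).arg) (Set.Ioo ξ₀ (xiEven η ℓ B C)) ∧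
        StrictAntiOn (fun ξ => (ρ ξ).arg) (Set.Ioo ξ₀ (xiEven η ℓ B C)) ∧
        Filter.Tendsto s (nhdsWithin ξ₀ (Set.Ioi ξ₀)) (nhds (-1)) ∧
        Filter.Tendsto ρ (nhdsWithin ξ₀ (Set.Ioi ξ₀)) (nhds (-1)) ∧
        -- the next odd transition value is well defined
        (ℓ < N →
          (∃! ξ : ℝ, ξ ∈ Set.Ioo ξ₀ (xiEven η ℓ B C) ∧ ρ ξ = η (2 * ℓ + 1)) ∧
          ∀ ξ ∈ Set.Ioo ξ₀ (xiEven η ℓ B C), ρ ξ = η (2 * ℓ + 1) → ξ = xiOdd η ℓ B C) := by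
  refine ⟨existsUnique_isFirstCoeffs hη hℓ, existsUnique_isSecondCoeffs hη hℓ,
    fun B C hB hC => ?_⟩
  have H := isPencil_of_coeffs hη hℓ hB hC
  obtain ⟨hp, m, β, s, S⟩ := H.exists_slopeSigns
  obtain ⟨ρ, hρ⟩ := H.exists_sign_change S
  obtain ⟨hρπ, hsπ⟩ := H.tendsto_sign_change S hρ
  have hρanti := H.strictAntiOn_sign_change S hρ
  have hnode : node η ℓ (2 * ℓ) = (η (2 * ℓ)).arg :=
    node_eq_arg η (by have := hℓ.1; omega) le_rfl
  rw [xiEven_eq hη hℓ]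
  set p := chebPoly (ℓ + 1) B
  set q := chebPoly (ℓ + 2) C
  set v₁ := q.eval (Real.cos (node η ℓ (2 * ℓ))) / p.eval (Real.cos (node η ℓ (2 * ℓ)))
  set v₀ := q.eval (-1) / p.eval (-1)
  have hV : ∀ ξ : ℝ, ∀ θ ∈ Set.Ioo (η (2 * ℓ)).arg Real.pi,
      (V η ℓ B C ξ (Complex.exp (θ * Complex.I))).im = gapV ℓ (node η ℓ) p q (ξ / 2) θ :=
    fun ξ θ hθ => im_V_exp hη hℓ hB hC ξ hθ
  have harg : ∀ θ ∈ Set.Ioo (η (2 * ℓ)).arg Real.pi, (Complex.exp (θ * Complex.I)).arg = θ :=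
    fun θ hθ => arg_exp_of_mem hθ
  have hexp : ∀ θ ∈ Set.Ioo (η (2 * ℓ)).arg Real.pi, Complex.exp (θ * Complex.I) ∈ lastGap η ℓ :=
    fun θ hθ => mem_lastGap_iff.2 ⟨θ, hθ, rfl⟩
  have hEq : ∀ ξ : ℝ, ∀ θ ∈ Set.Ioo (η (2 * ℓ)).arg Real.pi,
      imV η ℓ B C ξ =ᶠ[nhds θ] gapV ℓ (node η ℓ) p q (ξ / 2) := fun ξ θ hθ => by
    filter_upwards [isOpen_Ioo.mem_nhds hθ] with φ hφ using hV ξ φ hφ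
  rw [hnode] at S
  have hderiv : ∀ ξ : ℝ, ∀ θ ∈ Set.Ioo (η (2 * ℓ)).arg Real.pi,
      deriv (imV η ℓ B C ξ) θ = 0 ↔ slope ℓ p q (ξ / 2) θ = 0 := fun ξ θ hθ => by
    rw [(hEq ξ θ hθ).deriv_eq, H.deriv_gapV_eq_zero_iff _ (hnode ▸ hθ)]
  have hderiv2 : ∀ ξ : ℝ, ∀ θ ∈ Set.Ioo (η (2 * ℓ)).arg Real.pi, slope ℓ p q (ξ / 2) θ = 0 →
      deriv (deriv (imV η ℓ B C ξ)) θ =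
        (2 ^ ℓ)⁻¹ * (deriv (slope ℓ p q (ξ / 2)) θ * weight ℓ (node η ℓ) θ) :=
    fun ξ θ hθ h0 => by
      rw [(hEq ξ θ hθ).deriv.deriv_eq, H.deriv_deriv_gapV _ (hnode ▸ hθ) h0]
  have hw : ∀ θ ∈ Set.Ioo (η (2 * ℓ)).arg Real.pi, 0 < weight ℓ (node η ℓ) θ :=
    fun θ hθ => H.nodes.weight_pos_last (hnode ▸ hθ)
  have h2 : (0 : ℝ) < (2 ^ ℓ)⁻¹ := by positivity
  have hβ : ∀ ξ < 2 * v₁, β (ξ / 2) ∈ Set.Ioo (η (2 * ℓ)).arg Real.pi := fun ξ hξ =>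
    ⟨(S.β_mem (ξ / 2) (by linarith)).1, (S.β_mem (ξ / 2) (by linarith)).2.trans S.m_mem.2⟩
  have hs : ∀ ξ > 2 * v₀, s (ξ / 2) ∈ Set.Ioo (η (2 * ℓ)).arg Real.pi := fun ξ hξ =>
    ⟨S.m_mem.1.trans (S.s_mem (ξ / 2) (by linarith)).1, (S.s_mem (ξ / 2) (by linarith)).2⟩
  have hhalf : ∀ ξ ∈ Set.Ioo (2 * v₀) (2 * v₁), ξ / 2 ∈ Set.Ioo v₀ v₁ := fun ξ hξ =>
    ⟨by linarith [hξ.1], by linarith [hξ.2]⟩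
  have hρm : ∀ ξ ∈ Set.Ioo (2 * v₀) (2 * v₁), ρ (ξ / 2) ∈ Set.Ioo (η (2 * ℓ)).arg Real.pi :=
    fun ξ hξ => ⟨(hβ ξ hξ.2).1.trans (hρ _ (hhalf ξ hξ)).1.1,
      (hρ _ (hhalf ξ hξ)).1.2.trans (hs ξ hξ.1).2⟩
  -- Limits are taken for angles tending to π and pushed to the circle, because the argument is
  -- discontinuous at -1.
  have hlim : ∀ f : ℝ → ℝ, Filter.Tendsto f (nhdsWithin v₀ (Set.Ioi v₀)) (nhds Real.pi) →
      Filter.Tendsto (fun ξ : ℝ => Complex.exp (f (ξ / 2) * Complex.I))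
        (nhdsWithin (2 * v₀) (Set.Ioi (2 * v₀))) (nhds (-1)) := fun f hf => by
    have h1 : Filter.Tendsto (fun ξ : ℝ => ξ / 2) (nhdsWithin (2 * v₀) (Set.Ioi (2 * v₀)))
        (nhdsWithin v₀ (Set.Ioi v₀)) := by
      refine tendsto_nhdsWithin_iff.2 ⟨tendsto_nhdsWithin_of_tendsto_nhds ?_, ?_⟩
      · have : Filter.Tendsto (fun ξ : ℝ => ξ / 2) (nhds (2 * v₀)) (nhds (2 * v₀ / 2)) :=
          (continuous_id.div_const 2).tendsto _
        rwa [mul_div_cancel_left₀ _ two_ne_zero] at this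
      · filter_upwards [self_mem_nhdsWithin] with ξ hξ
        have : 2 * v₀ < ξ := hξ
        exact Set.mem_Ioi.2 (by linarith)
    have h3 : Continuous fun θ : ℝ => Complex.exp (θ * Complex.I) := by fun_prop
    have := (h3.tendsto Real.pi).comp (hf.comp h1)
    rwa [Complex.exp_pi_mul_I] at this
  -- The factor 2 converts x = ξ/2 back to ξ. Thus ξ₀ = 2(q/p)(-1), the parameter at which the
  -- critical point s reaches -1, just as ξ_{2ℓ} is the one at which β reaches η_{2ℓ}.
  refine ⟨2 * v₀, by linarith [S.v_lt], fun ξ => Complex.exp (ρ (ξ / 2) * Complex.I),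
    fun ξ => Complex.exp (s (ξ / 2) * Complex.I), fun ξ => Complex.exp (β (ξ / 2) * Complex.I),
    fun ξ hξ => ?_, fun ξ hξ => ?_, fun ξ hξ z hz => ?_, ?_, ?_, ?_, hlim s hsπ, hlim ρ hρπ, ?_⟩
  · have hb := hβ ξ hξ
    have hx : ξ / 2 < v₁ := by linarith
    have h0 := S.slope_β _ hx
    rw [harg _ hb, hderiv ξ _ hb, hderiv2 ξ _ hb h0, hV ξ _ hb]
    refine ⟨?_, hexp _ hb, H.gapV_β_neg (hnode ▸ S) hx, ?_, h0,
      mul_pos h2 (mul_pos (S.deriv_pos _ _ (S.β_mem _ hx) h0) (hw _ hb))⟩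
    · exact (hnode ▸ H.contDiffOn_gapV (ξ / 2)).congr fun θ hθ => hV ξ θ hθ
    · intro z hz hne
      obtain ⟨θ, hθ, rfl⟩ := mem_lastGap_iff.1 hz
      rw [hV ξ θ hθ]
      exact H.gapV_β_lt (hnode ▸ S) hx (hnode ▸ hθ) fun h => hne (by rw [h])
  · have hb := hβ ξ hξ.2
    have hs' := hs ξ hξ.1
    have hr := hρm ξ hξ
    have hx := hhalf ξ hξ
    have h0 := S.slope_s _ hx.1
    obtain ⟨hr1, hr2, hr3, hr4⟩ := hρ _ hx
    rw [hnode] at hr3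
    simp only [harg _ hb, harg _ hs', harg _ hr, hderiv ξ _ hs', hderiv2 ξ _ hs' h0, hV ξ _ hs',
      hV ξ _ hr]
    refine ⟨hexp _ hr, hexp _ hs', hr1.1, hr1.2, hr2, ?_, ?_, H.gapV_s_pos (hnode ▸ S) hx.1, ?_, h0,
      mul_neg_of_pos_of_neg h2 (mul_neg_of_neg_of_pos (S.deriv_neg _ _ (S.s_mem _ hx.1) h0)
        (hw _ hs')), ?_⟩
    all_goals
      intro z hz
      obtain ⟨θ, hθ, rfl⟩ := mem_lastGap_iff.1 hz
      first | rw [hV ξ θ hθ] | skip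
      first | rw [harg θ hθ] | skip
      intro hz'
    · exact hr3 θ ⟨hθ.1, hz'⟩
    · exact hr4 θ ⟨hz', hθ.2⟩
    · exact H.gapV_lt_s (hnode ▸ S) hx.2 hx.1 (hnode ▸ hθ) fun h => hz' (by rw [h])
    · rcases IsPencil.eq_β_or_eq_s (hnode ▸ S) hx.2 hx.1 (hnode ▸ hθ) ((hderiv ξ θ hθ).1 hz')
        with h | h
      · exact Or.inl (by rw [h])
      · exact Or.inr (by rw [h])
  · obtain ⟨θ, hθ, rfl⟩ := mem_lastGap_iff.1 hz
    have hx : ξ / 2 ≤ v₀ := by linarith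
    rw [hV ξ θ hθ, harg θ hθ, hderiv ξ θ hθ]
    exact ⟨H.gapV_neg_of_le_v₀ (hnode ▸ S) hx (hnode ▸ hθ),
      fun h0 => by rw [IsPencil.eq_β (hnode ▸ S) hx (hnode ▸ hθ) h0]⟩
  · intro x hx y hy hxy
    simp only [harg _ (hβ x hx), harg _ (hβ y hy)]
    have hx' : x < 2 * v₁ := hx
    have hy' : y < 2 * v₁ := hy
    exact S.anti_β (Set.mem_Iio.2 (by linarith)) (Set.mem_Iio.2 (by linarith)) (by linarith)
  · intro x hx y hy hxy
    simp only [harg _ (hs x hx.1), harg _ (hs y hy.1)]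
    exact S.anti_s (hhalf x hx).1 (hhalf y hy).1 (by linarith)
  · intro x hx y hy hxy
    simp only [harg _ (hρm x hx), harg _ (hρm y hy)]
    exact hρanti (hhalf x hx) (hhalf y hy) (by linarith)
  · intro hN
    have hm : 2 * ℓ + 1 ∈ Set.Icc 1 (2 * N) := ⟨by omega, by omega⟩
    have hm' : 2 * ℓ ∈ Set.Icc 1 (2 * N) := ⟨by have := hℓ.1; omega, by omega⟩
    have hθ : (η (2 * ℓ + 1)).arg ∈ Set.Ioo (η (2 * ℓ)).arg Real.pi :=
      ⟨hη.arg_strictMono hm' hm (by omega), hη.arg_lt _ hm⟩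
    have hpos := H.gapPrimitive_pos (hnode ▸ S) (hnode ▸ hθ)
    -- Vanishing of the affine function of x at the angle of η_{2ℓ+1} determines x as a quotient of
    -- two primitives. This proves the formula and the uniqueness at once.
    have hformula : ∀ ξ ∈ Set.Ioo (2 * v₀) (2 * v₁),
        Complex.exp (ρ (ξ / 2) * Complex.I) = η (2 * ℓ + 1) → ξ = xiOdd η ℓ B C := by
      intro ξ hξ h
      have e1 : ρ (ξ / 2) = (η (2 * ℓ + 1)).arg := by rw [← h, harg _ (hρm ξ hξ)]
      have h0 := (hρ _ (hhalf ξ hξ)).2.1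
      rw [e1, H.gapV_eq _ (by rw [hnode]; exact ⟨hθ.1.le, hθ.2.le⟩), sub_eq_zero] at h0
      rw [xiOdd_eq hη hℓ B C hθ rfl, ← h0, mul_div_cancel_right₀ _ hpos.ne']
      ring
    refine ⟨?_, hformula⟩
    obtain ⟨x, hx, hx0⟩ := H.exists_gapV_eq_zero (hnode ▸ S) (hnode ▸ hθ)
    have hx2 : 2 * x / 2 = x := by ring
    have hξ : 2 * x ∈ Set.Ioo (2 * v₀) (2 * v₁) := ⟨by linarith [hx.1], by linarith [hx.2]⟩
    have hρx : Complex.exp (ρ (2 * x / 2) * Complex.I) = η (2 * ℓ + 1) := by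
      obtain ⟨-, -, h3, h4⟩ := hρ x hx
      have : ρ x = (η (2 * ℓ + 1)).arg := by
        rcases lt_trichotomy (ρ x) (η (2 * ℓ + 1)).arg with h | h | h
        · exact absurd hx0 (h4 _ ⟨h, hθ.2⟩).ne'
        · exact h
        · exact absurd hx0 (h3 _ ⟨hnode ▸ hθ.1, h⟩).ne
      rw [hx2, this]
      exact (eq_exp_arg (hη.norm_eq _ hm)).symm
    exact ⟨2 * x, ⟨hξ, hρx⟩, fun y hy => (hformula y hy.1 hy.2).trans (hformula _ hξ hρx).symm⟩
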